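/- Let $W^1,\dots,W^m$ be independent Brownian motions on a filtered probability space $(\Omega,\mathfrak F,(\mathfrak F_t)_{t\ge 0},\mathbb P)$, let $T>0$, and let $b,\sigma_1,\dots,\sigma_m:[0,T]\times\mathbb R^d\to\mathbb R^d$ have continuous partial derivatives of first order in $t$ and up to second order in $x$. Put $$\mathcal L_0=\frac{\partial}{\partial t}+\sum_{j=1}^d b^j\frac{\partial}{\partial x^j}+\frac12\sum_{i,j=1}^d\Big(\sum_{k=1}^m\sigma_k^i\sigma_k^j\Big)\frac{\partial^2}{\partial x^i\partial x^j},\qquad \mathcal L_k=\sum_{j=1}^d\sigma_k^j\frac{\partial}{\partial x^j}\quad(k=1,\dots,m),$$ acting componentwise on vector fields. Let $\tau_n$ be a stopping time with values in $[0,T]$, let $Y_n$ be an $\mathfrak F_{\tau_n}$-measurable $\mathbb R^d$-valued random variable and let $\Delta$ be an $\mathfrak F_{\tau_n}$-measurable positive random variable. With $b,\sigma_k$ and their images under $\mathcal L_0,\mathcal L_k$ evaluated at $(\tau_n,Y_n)$, define the Euler step $$Y_n(\tau_n+\Delta)=Y_n+b\,\Delta+\sum_{k=1}^m\sigma_k\,(W^k_{\tau_n+\Delta}-W^k_{\tau_n})$$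 and the second-order truncated weak Itô–Taylor step $$\begin{aligned}\hat Y_n(\tau_n+\Delta)={}&Y_n+b\,\Delta+\tfrac12\mathcal L_0b\,\Delta^2+\sum_{k=1}^m\sigma_k\,(W^k_{\tau_n+\Delta}-W^k_{\tau_n})+\sum_{k=1}^m\mathcal L_kb\int_{\tau_n}^{\tau_n+\Delta}(W^k_t-W^k_{\tau_n})\,dt\\&+\sum_{k=1}^m\mathcal L_0\sigma_k\int_{\tau_n}^{\tau_n+\Delta}(t-\tau_n)\,dW^k_t+\sum_{k,\ell=1}^m\mathcal L_k\sigma_\ell\int_{\tau_n}^{\tau_n+\Delta}(W^k_t-W^k_{\tau_n})\,dW^\ell_t .\end{aligned}$$ Then the following conditional expectations exist (in the generalized sense for random variables that need not be integrable: $\mathbb E(X\mid\mathfrak G)$ exists when $\Omega$ is, up to a null set, a countable union of events of $\mathfrak G$ on each of which $X$ is integrable; for integrable $X$ it is the usual one), and almost surely $$\mathbb E\big(\hat Y_n(\tau_n+\Delta)\mid\mathfrak F_{\tau_n}\big)-\mathbb E\big(Y_n(\tau_n+\Delta)\mid\mathfrak F_{\tau_n}\big)=\tfrac12\,\mathcal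 L_0b(\tau_n,Y_n)\,\Delta^2,$$ and, for all $i,j=1,\dots,d$, $$\begin{aligned}&\mathbb E\Big(\prod_{k=i,j}\big(\hat Y^k_n(\tau_n+\Delta)-Y^k_n\big)\,\Big|\,\mathfrak F_{\tau_n}\Big)-\mathbb E\Big(\prod_{k=i,j}\big(Y^k_n(\tau_n+\Delta)-Y^k_n\big)\,\Big|\,\mathfrak F_{\tau_n}\Big)\\&\qquad=T_2^{i,j}(\tau_n,Y_n)\Delta^2+T_3^{i,j}(\tau_n,Y_n)\Delta^3+T_4^{i,j}(\tau_n,Y_n)\Delta^4,\end{aligned}$$ where $$T_2^{i,j}=\tfrac12\sum_{k=1}^m\sigma_k^i(\mathcal L_0\sigma_k^j+\mathcal L_kb^j)+\tfrac12\sum_{k=1}^m\sigma_k^j(\mathcal L_0\sigma_k^i+\mathcal L_kb^i)+\tfrac12\sum_{k,\ell=1}^m\mathcal L_k\sigma_\ell^i\cdot\mathcal L_k\sigma_\ell^j,$$ $$T_3^{i,j}=\tfrac12 b^i\mathcal L_0b^j+\tfrac12 b^j\mathcal L_0b^i+\tfrac16\sum_{k=1}^m\mathcal L_0\sigma_k^i(\mathcal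 L_kb^j+2\mathcal L_0\sigma_k^j)+\tfrac16\sum_{k=1}^m\mathcal L_kb^i(2\mathcal L_kb^j+\mathcal L_0\sigma_k^j),$$ $$T_4^{i,j}=\tfrac14\,\mathcal L_0b^i\cdot\mathcal L_0b^j .$$ -/

import Mathlib

open MeasureTheory ProbabilityTheory Filter Set
open scoped NNReal ENNReal Topology

noncomputable section

namespace WeakStep

/-! ### Conditional expectation of random variables that need not be integrable -/

section CondExp

variable {Ω : Type*} {E : Type*} [NormedAddCommGroup E] [NormedSpace ℝ E]

/-- `Z` is a (generalized) conditional expectation of `X` given the sub-σ-algebra `m`: `Z` is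
`m`-measurable and `Ω` is, up to a null set, a countable union of events `A n ∈ m` on each of which
`X` and `Z` are integrable and have the same integral over every `B ∈ m` with `B ⊆ A n`.
For integrable `X` this is the usual conditional expectation
(see `genCondExp_ae_eq_condExp`). -/
def IsGenCondExp (m : MeasurableSpace Ω) {mΩ : MeasurableSpace Ω} (μ : Measure Ω)
    (X Z : Ω → E) : Prop :=
  StronglyMeasurable[m] Z ∧
  ∃ A : ℕ → Set Ω, (∀ n, MeasurableSet[m] (A n)) ∧ (∀ᵐ ω ∂μ, ∃ n, ω ∈ A n) ∧
    ∀ n, IntegrableOn X (A n) μ ∧ IntegrableOn Z (A n) μ ∧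
      ∀ B, MeasurableSet[m] B → B ⊆ A n → ∫ ω in B, X ω ∂μ = ∫ ω in B, Z ω ∂μ

/-- `X` possesses a (generalized) conditional expectation given `m`. -/
def HasGenCondExp (m : MeasurableSpace Ω) {mΩ : MeasurableSpace Ω} (μ : Measure Ω)
    (X : Ω → E) : Prop :=
  ∃ Z, IsGenCondExp m μ X Z

open Classical in
/-- The (generalized) conditional expectation `E(X / m)`, unique up to null sets
(see `IsGenCondExp.ae_eq`); it is `0` if there is none. -/
def genCondExp (m : MeasurableSpace Ω) {mΩ : MeasurableSpace Ω} (μ : Measure Ω)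
    (X : Ω → E) : Ω → E :=
  if h : HasGenCondExp m μ X then h.choose else 0

/-- Generalized conditional expectations are unique up to null sets. -/
theorem IsGenCondExp.ae_eq [CompleteSpace E] {m mΩ : MeasurableSpace Ω} (hm : m ≤ mΩ)
    {μ : Measure Ω} [IsFiniteMeasure μ] {X Z Z' : Ω → E}
    (h : IsGenCondExp m μ X Z) (h' : IsGenCondExp m μ X Z') : Z =ᵐ[μ] Z' := by
  obtain ⟨hZ, A, hA, hcov, hI⟩ := h
  obtain ⟨hZ', A', hA', hcov', hI'⟩ := h'
  have key : ∀ p : ℕ × ℕ, (A p.1 ∩ A' p.2).indicator Z =ᵐ[μ] (A p.1 ∩ A' p.2).indicator Z' := by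
    intro p
    have hC : MeasurableSet[m] (A p.1 ∩ A' p.2) := (hA _).inter (hA' _)
    have i1 : Integrable ((A p.1 ∩ A' p.2).indicator Z) μ :=
      (integrable_indicator_iff (hm _ hC)).2 ((hI p.1).2.1.mono_set inter_subset_left)
    have i2 : Integrable ((A p.1 ∩ A' p.2).indicator Z') μ :=
      (integrable_indicator_iff (hm _ hC)).2 ((hI' p.2).2.1.mono_set inter_subset_right)
    refine ae_eq_of_forall_setIntegral_eq_of_sigmaFinite' hm (fun _ _ _ => i1.integrableOn)
      (fun _ _ _ => i2.integrableOn) (fun s hs _ => ?_)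
      (hZ.indicator hC).aestronglyMeasurable (hZ'.indicator hC).aestronglyMeasurable
    rw [setIntegral_indicator (hm _ hC), setIntegral_indicator (hm _ hC),
      ← (hI p.1).2.2 _ (hs.inter hC) (inter_subset_right.trans inter_subset_left),
      ← (hI' p.2).2.2 _ (hs.inter hC) (inter_subset_right.trans inter_subset_right)]
  filter_upwards [ae_all_iff.2 key, hcov, hcov'] with ω hω ⟨n, hn⟩ ⟨k, hk⟩
  simpa [hn, hk] using hω (n, k)

/-- For integrable random variables this is the usual conditional expectation. -/
theorem genCondExp_ae_eq_condExp [CompleteSpace E] {m mΩ : MeasurableSpace Ω} (hm : m ≤ mΩ)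
    {μ : Measure Ω} [IsFiniteMeasure μ] {X : Ω → E} (hX : Integrable X μ) :
    genCondExp m μ X =ᵐ[μ] μ[X | m] := by
  have h : IsGenCondExp m μ X (μ[X | m]) :=
    ⟨stronglyMeasurable_condExp, fun _ => univ, fun _ => MeasurableSet.univ,
      Eventually.of_forall fun _ => ⟨0, mem_univ _⟩, fun _ => ⟨hX.integrableOn,
        integrable_condExp.integrableOn, fun B hB _ => (setIntegral_condExp hm hX hB).symm⟩⟩
  have h' : HasGenCondExp m μ X := ⟨_, h⟩
  rw [genCondExp, dif_pos h']
  exact h'.choose_spec.ae_eq hm h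

end CondExp

/-! ### Brownian motion and the Itô integral -/

section Ito

variable {Ω : Type*} {mΩ : MeasurableSpace Ω}

/-- `W 0, …, W (m - 1)` are independent Brownian motions with respect to the filtration `𝓕`:
adapted, independent, each a Brownian motion, and with the increments after time `s` independent
of `𝓕 s`. -/
structure IsBrownianFamily {m : ℕ} (𝓕 : Filtration ℝ≥0 mΩ) (μ : Measure Ω)
    (W : Fin m → ℝ≥0 → Ω → ℝ) : Prop where
  adapted : ∀ k t, Measurable[𝓕 t] (W k t)
  brownian : ∀ k, IsBrownianReal (W k) μ
  indep : iIndepFun (fun k ω t => W k t ω) μ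
  indep_increment : ∀ s t : ℝ≥0, s ≤ t →
    Indep (MeasurableSpace.comap (fun ω k => W k t ω - W k s ω) inferInstance) (𝓕 s) μ

/-- A simple integrand `∑ i < n, ξ i * 1_(t i, t (i + 1)]` with deterministic times and bounded
`𝓕 (t i)`-measurable coefficients `ξ i`. -/
structure SimpleIntegrand (𝓕 : Filtration ℝ≥0 mΩ) where
  n : ℕ
  t : ℕ → ℝ≥0
  mono : Monotone t
  ξ : ℕ → Ω → ℝ
  measurable_ξ : ∀ i, Measurable[𝓕 (t i)] (ξ i)
  bounded_ξ : ∃ C : ℝ, ∀ i ω, |ξ i ω| ≤ C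

/-- The value of the simple integrand at time `s`. -/
def SimpleIntegrand.value {𝓕 : Filtration ℝ≥0 mΩ} (S : SimpleIntegrand 𝓕)
    (s : ℝ≥0) (ω : Ω) : ℝ :=
  ∑ i ∈ Finset.range S.n, (Ioc (S.t i) (S.t (i + 1))).indicator (fun _ => S.ξ i ω) s

/-- The elementary stochastic integral of a simple integrand over `[0, ∞)`. -/
def SimpleIntegrand.integral {𝓕 : Filtration ℝ≥0 mΩ} (S : SimpleIntegrand 𝓕)
    (W : ℝ≥0 → Ω → ℝ) (ω : Ω) : ℝ :=
  ∑ i ∈ Finset.range S.n, S.ξ i ω * (W (S.t (i + 1)) ω - W (S.t i) ω)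

/-- `I` is the Itô integral `∫_0^∞ H dW`: there are simple integrands `S n` with
`∫_0^∞ |S n - H|² ds → 0` in probability and `∫_0^∞ S n dW → I` in probability. -/
def IsItoIntegral (𝓕 : Filtration ℝ≥0 mΩ) (μ : Measure Ω) (W H : ℝ≥0 → Ω → ℝ)
    (I : Ω → ℝ) : Prop :=
  (∀ᵐ ω ∂μ, Measurable fun s => H s ω) ∧
  ∃ S : ℕ → SimpleIntegrand 𝓕,
    TendstoInMeasure μ
      (fun n ω => ∫⁻ s in Ioi (0 : ℝ),
        ENNReal.ofReal (((S n).value s.toNNReal ω - H s.toNNReal ω) ^ 2)) atTop 0 ∧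
    TendstoInMeasure μ (fun n => (S n).integral W) atTop I

open Classical in
/-- The Itô integral `∫_0^∞ H dW` (`0` if it does not exist). -/
def itoIntegral (𝓕 : Filtration ℝ≥0 mΩ) (μ : Measure Ω) (W H : ℝ≥0 → Ω → ℝ) : Ω → ℝ :=
  if h : ∃ I, IsItoIntegral 𝓕 μ W H I then h.choose else 0

/-- The Itô integral `∫_τ^ρ H dW` between two random times `τ ≤ ρ`. -/
def itoIntegralBetween (𝓕 : Filtration ℝ≥0 mΩ) (μ : Measure Ω) (W : ℝ≥0 → Ω → ℝ)
    (τ ρ : Ω → ℝ≥0) (H : ℝ≥0 → Ω → ℝ) : Ω → ℝ :=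
  itoIntegral 𝓕 μ W fun s ω => (Ioc (τ ω) (ρ ω)).indicator (fun _ => H s ω) s

end Ito

/-! ### Differential operators -/

section Operators

variable {d m : ℕ}

/-- The partial derivative `∂f/∂x^j`. -/
def pdX (j : Fin d) (f : ℝ → EuclideanSpace ℝ (Fin d) → ℝ) (t : ℝ)
    (x : EuclideanSpace ℝ (Fin d)) : ℝ :=
  fderiv ℝ (f t) x (EuclideanSpace.single j 1)

/-- The time derivative `∂f/∂t` on `[0, T]` (one-sided at the end points). -/
def pdT (T : ℝ) (f : ℝ → EuclideanSpace ℝ (Fin d) → ℝ) (t : ℝ)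
    (x : EuclideanSpace ℝ (Fin d)) : ℝ :=
  derivWithin (fun s => f s x) (Icc 0 T) t

/-- `f ∈ C^{1,2}([0,T] × ℝ^d)`: once continuously differentiable in time and twice in space. -/
structure IsC12 (T : ℝ) (f : ℝ → EuclideanSpace ℝ (Fin d) → ℝ) : Prop where
  continuousOn : ContinuousOn (Function.uncurry f) (Icc 0 T ×ˢ univ)
  differentiable_time : ∀ x, DifferentiableOn ℝ (fun s => f s x) (Icc 0 T)
  contDiff_space : ∀ t ∈ Icc 0 T, ContDiff ℝ 2 (f t)
  continuousOn_pdT : ContinuousOn (Function.uncurry (pdT T f)) (Icc 0 T ×ˢ univ)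
  continuousOn_pdX : ∀ j, ContinuousOn (Function.uncurry (pdX j f)) (Icc 0 T ×ˢ univ)
  continuousOn_pdXX : ∀ i j,
    ContinuousOn (Function.uncurry (pdX i (pdX j f))) (Icc 0 T ×ˢ univ)

/-- The `i`-th component of a vector field. -/
def comp (g : ℝ → EuclideanSpace ℝ (Fin d) → EuclideanSpace ℝ (Fin d)) (i : Fin d) :
    ℝ → EuclideanSpace ℝ (Fin d) → ℝ :=
  fun t x => g t x i

/-- `𝓛₀ = ∂/∂t + ∑ⱼ bʲ ∂/∂xʲ + ½ ∑ᵢⱼ (∑ₖ σₖⁱ σₖʲ) ∂²/∂xⁱ∂xʲ`. -/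
def L0 (T : ℝ) (b : ℝ → EuclideanSpace ℝ (Fin d) → EuclideanSpace ℝ (Fin d))
    (σ : Fin m → ℝ → EuclideanSpace ℝ (Fin d) → EuclideanSpace ℝ (Fin d))
    (f : ℝ → EuclideanSpace ℝ (Fin d) → ℝ) (t : ℝ) (x : EuclideanSpace ℝ (Fin d)) : ℝ :=
  pdT T f t x + ∑ j, b t x j * pdX j f t x
    + 1 / 2 * ∑ i, ∑ j, (∑ k, σ k t x i * σ k t x j) * pdX i (pdX j f) t x

/-- `𝓛ₖ = ∑ⱼ σₖʲ ∂/∂xʲ`. -/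
def L (σ : Fin m → ℝ → EuclideanSpace ℝ (Fin d) → EuclideanSpace ℝ (Fin d)) (k : Fin m)
    (f : ℝ → EuclideanSpace ℝ (Fin d) → ℝ) (t : ℝ) (x : EuclideanSpace ℝ (Fin d)) : ℝ :=
  ∑ j, σ k t x j * pdX j f t x

/-- `𝓛₀` applied to a vector field componentwise. -/
def L0vec (T : ℝ) (b : ℝ → EuclideanSpace ℝ (Fin d) → EuclideanSpace ℝ (Fin d))
    (σ : Fin m → ℝ → EuclideanSpace ℝ (Fin d) → EuclideanSpace ℝ (Fin d))
    (g : ℝ → EuclideanSpace ℝ (Fin d) → EuclideanSpace ℝ (Fin d)) (t : ℝ)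
    (x : EuclideanSpace ℝ (Fin d)) : EuclideanSpace ℝ (Fin d) :=
  WithLp.toLp 2 fun i => L0 T b σ (comp g i) t x

/-- `𝓛ₖ` applied to a vector field componentwise. -/
def Lvec (σ : Fin m → ℝ → EuclideanSpace ℝ (Fin d) → EuclideanSpace ℝ (Fin d)) (k : Fin m)
    (g : ℝ → EuclideanSpace ℝ (Fin d) → EuclideanSpace ℝ (Fin d)) (t : ℝ)
    (x : EuclideanSpace ℝ (Fin d)) : EuclideanSpace ℝ (Fin d) :=
  WithLp.toLp 2 fun i => L σ k (comp g i) t x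

/-- The coefficient `T₂^{ij}`. -/
def T2 (T : ℝ) (b : ℝ → EuclideanSpace ℝ (Fin d) → EuclideanSpace ℝ (Fin d))
    (σ : Fin m → ℝ → EuclideanSpace ℝ (Fin d) → EuclideanSpace ℝ (Fin d)) (i j : Fin d)
    (t : ℝ) (x : EuclideanSpace ℝ (Fin d)) : ℝ :=
  1 / 2 * ∑ k, σ k t x i * (L0 T b σ (comp (σ k) j) t x + L σ k (comp b j) t x)
  + 1 / 2 * ∑ k, σ k t x j * (L0 T b σ (comp (σ k) i) t x + L σ k (comp b i) t x)
  + 1 / 2 * ∑ k, ∑ l, L σ k (comp (σ l) i) t x * L σ k (comp (σ l) j) t x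

/-- The coefficient `T₃^{ij}`. -/
def T3 (T : ℝ) (b : ℝ → EuclideanSpace ℝ (Fin d) → EuclideanSpace ℝ (Fin d))
    (σ : Fin m → ℝ → EuclideanSpace ℝ (Fin d) → EuclideanSpace ℝ (Fin d)) (i j : Fin d)
    (t : ℝ) (x : EuclideanSpace ℝ (Fin d)) : ℝ :=
  1 / 2 * (b t x i * L0 T b σ (comp b j) t x)
  + 1 / 2 * (b t x j * L0 T b σ (comp b i) t x)
  + 1 / 6 * ∑ k, L0 T b σ (comp (σ k) i) t x *
      (L σ k (comp b j) t x + 2 * L0 T b σ (comp (σ k) j) t x)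
  + 1 / 6 * ∑ k, L σ k (comp b i) t x *
      (2 * L σ k (comp b j) t x + L0 T b σ (comp (σ k) j) t x)

/-- The coefficient `T₄^{ij}`. -/
def T4 (T : ℝ) (b : ℝ → EuclideanSpace ℝ (Fin d) → EuclideanSpace ℝ (Fin d))
    (σ : Fin m → ℝ → EuclideanSpace ℝ (Fin d) → EuclideanSpace ℝ (Fin d)) (i j : Fin d)
    (t : ℝ) (x : EuclideanSpace ℝ (Fin d)) : ℝ :=
  1 / 4 * (L0 T b σ (comp b i) t x * L0 T b σ (comp b j) t x)

end Operators

/-! ### The two one-step approximations -/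

section Steps

variable {d m : ℕ} {Ω : Type*} {mΩ : MeasurableSpace Ω}

/-- The Euler step from `(τ, Y)` with step size `Δ`. -/
def eulerStep (W : Fin m → ℝ≥0 → Ω → ℝ)
    (b : ℝ → EuclideanSpace ℝ (Fin d) → EuclideanSpace ℝ (Fin d))
    (σ : Fin m → ℝ → EuclideanSpace ℝ (Fin d) → EuclideanSpace ℝ (Fin d))
    (τ : Ω → ℝ≥0) (Y : Ω → EuclideanSpace ℝ (Fin d)) (Δ : Ω → ℝ≥0) (ω : Ω) :
    EuclideanSpace ℝ (Fin d) :=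
  Y ω + (Δ ω : ℝ) • b (τ ω) (Y ω)
    + ∑ k, (W k (τ ω + Δ ω) ω - W k (τ ω) ω) • σ k (τ ω) (Y ω)

/-- The second-order truncated weak Itô–Taylor step from `(τ, Y)` with step size `Δ`. -/
def itoTaylorStep (𝓕 : Filtration ℝ≥0 mΩ) (μ : Measure Ω) (W : Fin m → ℝ≥0 → Ω → ℝ) (T : ℝ)
    (b : ℝ → EuclideanSpace ℝ (Fin d) → EuclideanSpace ℝ (Fin d))
    (σ : Fin m → ℝ → EuclideanSpace ℝ (Fin d) → EuclideanSpace ℝ (Fin d))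
    (τ : Ω → ℝ≥0) (Y : Ω → EuclideanSpace ℝ (Fin d)) (Δ : Ω → ℝ≥0) (ω : Ω) :
    EuclideanSpace ℝ (Fin d) :=
  Y ω + (Δ ω : ℝ) • b (τ ω) (Y ω)
    + (1 / 2 * (Δ ω : ℝ) ^ 2) • L0vec T b σ b (τ ω) (Y ω)
    + ∑ k, (W k (τ ω + Δ ω) ω - W k (τ ω) ω) • σ k (τ ω) (Y ω)
    + ∑ k, (∫ t in (τ ω : ℝ)..(τ ω + Δ ω : ℝ), (W k t.toNNReal ω - W k (τ ω) ω)) •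
        Lvec σ k b (τ ω) (Y ω)
    + ∑ k, itoIntegralBetween 𝓕 μ (W k) τ (fun ω' => τ ω' + Δ ω')
          (fun t ω' => (t : ℝ) - τ ω') ω •
        L0vec T b σ (σ k) (τ ω) (Y ω)
    + ∑ k, ∑ l, itoIntegralBetween 𝓕 μ (W l) τ (fun ω' => τ ω' + Δ ω')
          (fun t ω' => W k t ω' - W k (τ ω') ω') ω •
        Lvec σ k (σ l) (τ ω) (Y ω)

end Steps

end WeakStep

end

open WeakStep

/-!
# Conditional moments of the weak Itô–Taylor step

Both steps are affine in finitely many stochastic integrals over `[τ, τ + Δ]` with `𝓕_τ`-measurable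
coefficients: the increments of the Brownian motions, their time integrals, the integrals of the
elapsed time, and the iterated integrals. So it is enough to know that these integrals have
conditional expectation zero and to know their conditional second moments given `𝓕_τ`
(`momentMatrix`); known factors are pulled out by `IsGenCondExp.smul`, and the rest is algebra
(`sum_momentMatrix_mul`).

All conditional second moments come from one isometry. Call `I` the square-integrable Itô integral
of `H` after `τ` (`IsL2Ito`) if simple integrands vanishing before `τ` tend to `H` in `L²(ds ⊗ μ)`
and their elementary integrals tend to `I` in `L²(μ)`. Such pairs inherit
`E(I I') = E ∫ H H' ds` from simple integrands, and `E(I I') = 0` for different Brownian motions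
(`IsL2Ito.integral_mul`). Since the integrands vanish before `τ`, they can be multiplied by any
bounded `𝓕_τ`-measurable random variable (`IsL2Ito.mul`), which turns the isometry into one for
conditional expectations; no strong Markov property is needed. The increment of a Brownian motion,
its time integral and the integral of the elapsed time are the integrals of `1`, `τ + Δ - s` and
`s - τ`, as one sees by discretizing the integrands on uniform grids and passing to the limit
pathwise. For the iterated integrals, the isometry leads to the integrand `W_s - W_τ`, whose
conditional moments at a fixed time `s` are those of an increment over a step of the
`𝓕_τ`-measurable size `s - τ`; Fubini's theorem finishes the computation.

The step size `Δ` is not bounded, so the moments are computed on the events `{Δ ≤ N}`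
(`IsLocIto`), which also exhaust `Ω` as the generalized conditional expectation requires. That the
pairs so constructed are the Itô integrals of the statement, which are limits in probability, rests
on the uniqueness of the latter (`IsItoIntegral.ae_eq`), a consequence of a Lenglart-type inequality
for simple integrands (`SimpleIntegrand.measure_integral_ge_le`).
-/

namespace WeakStep

/-! ### Simple integrands -/

section Simple

variable {Ω : Type*} {mΩ : MeasurableSpace Ω} {𝓕 : Filtration ℝ≥0 mΩ}

/-- The simple integrand `S` vanishes before the random time `τ`, in the strong sense that each of
its coefficients vanishes where the left end point of its interval precedes `τ`. Such integrands
can be multiplied by any bounded `𝓕_τ`-measurable random variable. -/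
def SimpleIntegrand.After (S : SimpleIntegrand 𝓕) (τ : Ω → ℝ≥0) : Prop :=
  ∀ i < S.n, ∀ ω, S.ξ i ω ≠ 0 → τ ω ≤ S.t i

/-- The value at time `s` is itself an elementary integral, with the integrator `t ↦ 1_{s ≤ t}`. So
an identity between elementary integrals for all integrators contains the identity of the values. -/
theorem SimpleIntegrand.value_eq_integral (S : SimpleIntegrand 𝓕) (s : ℝ≥0) (ω : Ω) :
    S.value s ω = S.integral (fun t _ => if s ≤ t then 1 else 0) ω := by
  unfold SimpleIntegrand.value SimpleIntegrand.integral
  refine Finset.sum_congr rfl fun i _ => ?_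
  have h := S.mono (Nat.le_succ i)
  simp only [indicator, mem_Ioc]
  by_cases h1 : s ≤ S.t i
  · have : s ≤ S.t (i + 1) := h1.trans h
    simp [h1, this, not_lt.2 h1]
  · by_cases h2 : s ≤ S.t (i + 1) <;> simp [h1, h2, not_le.1 h1]

theorem SimpleIntegrand.abs_ξ_le (S : SimpleIntegrand 𝓕) :
    ∃ C : ℝ, 0 ≤ C ∧ ∀ i ω, |S.ξ i ω| ≤ C := by
  obtain ⟨C, hC⟩ := S.bounded_ξ
  exact ⟨|C|, abs_nonneg _, fun i ω => (hC i ω).trans (le_abs_self C)⟩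

/-- The increasing enumeration of a finite set of times, constant after its last element. -/
noncomputable def gridEnum (P : Finset ℝ≥0) (i : ℕ) : ℝ≥0 :=
  if h : i < P.card then P.orderEmbOfFin rfl ⟨i, h⟩ else P.sup id

theorem gridEnum_lt (P : Finset ℝ≥0) {i j : ℕ} (hij : i < j) (hj : j < P.card) :
    gridEnum P i < gridEnum P j := by
  unfold gridEnum
  rw [dif_pos hj, dif_pos (hij.trans hj)]
  exact (P.orderEmbOfFin rfl).strictMono hij

theorem gridEnum_mono (P : Finset ℝ≥0) : Monotone (gridEnum P) := by
  intro i j hij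
  by_cases hj : j < P.card
  · rcases hij.eq_or_lt with rfl | h
    · exact le_rfl
    · exact (gridEnum_lt P h hj).le
  · by_cases hi : i < P.card
    · unfold gridEnum
      rw [dif_pos hi, dif_neg hj]
      exact Finset.le_sup (f := id) (Finset.orderEmbOfFin_mem P rfl _)
    · simp [gridEnum, hi, hj]

theorem exists_gridEnum_eq (P : Finset ℝ≥0) {p : ℝ≥0} (hp : p ∈ P) :
    ∃ j < P.card, gridEnum P j = p := by
  have : p ∈ range (P.orderEmbOfFin rfl) := by
    rw [Finset.range_orderEmbOfFin]; exact hp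
  obtain ⟨⟨j, hj⟩, h⟩ := this
  exact ⟨j, hj, by rw [gridEnum, dif_pos hj, h]⟩

/-- A simple integrand can be rewritten on every finer grid. -/
theorem SimpleIntegrand.exists_refine (S : SimpleIntegrand 𝓕) (P : Finset ℝ≥0)
    (hP : ∀ i ≤ S.n, S.t i ∈ P) :
    ∃ R : SimpleIntegrand 𝓕, R.n = P.card - 1 ∧ R.t = gridEnum P ∧
      (∀ (w : ℝ≥0 → Ω → ℝ) ω, R.integral w ω = S.integral w ω) ∧
      ∀ τ, S.After τ → R.After τ := by
  classical
  set u := gridEnum P with hu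
  -- an interval of the fine grid that meets an interval of `S` starts after its left end point,
  -- so the coefficient is known there
  have hle : ∀ i, i + 1 < P.card → ∀ j < S.n, u (i + 1) ∈ Ioc (S.t j) (S.t (j + 1)) →
      S.t j ≤ u i := by
    intro i hi j hj hm
    obtain ⟨a, ha, h⟩ := exists_gridEnum_eq P (hP j hj.le)
    rw [← h] at hm ⊢
    have : a < i + 1 := by
      by_contra hcon
      exact absurd hm.1 (not_lt.2 (gridEnum_mono P (not_lt.1 hcon)))
    exact gridEnum_mono P (Nat.lt_succ_iff.1 this)
  let η : ℕ → Ω → ℝ := fun i ω => if i + 1 < P.card then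
    ∑ j ∈ Finset.range S.n, (if u (i + 1) ∈ Ioc (S.t j) (S.t (j + 1)) then S.ξ j ω else 0) else 0
  obtain ⟨C, hC0, hC⟩ := S.abs_ξ_le
  let R : SimpleIntegrand 𝓕 :=
    { n := P.card - 1
      t := u
      mono := gridEnum_mono P
      ξ := η
      measurable_ξ := by
        intro i
        by_cases hi : i + 1 < P.card
        · simp only [η, hi, if_true]
          refine Finset.measurable_sum _ fun j hj => ?_
          by_cases hm : u (i + 1) ∈ Ioc (S.t j) (S.t (j + 1))
          · simp only [hm, if_true]
            exact (S.measurable_ξ j).mono (𝓕.mono (hle i hi j (Finset.mem_range.1 hj) hm)) le_rfl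
          · simp only [hm, if_false]
            exact measurable_const
        · simp only [η, hi, if_false]
          exact measurable_const
      bounded_ξ := by
        refine ⟨S.n * C, fun i ω => ?_⟩
        simp only [η]
        split_ifs with hi
        · refine (Finset.abs_sum_le_sum_abs _ _).trans ?_
          refine (Finset.sum_le_sum (g := fun _ => C) fun j _ => ?_).trans (by simp)
          split_ifs
          · exact hC j ω
          · simpa using hC0
        · simp only [abs_zero]; positivity }
  refine ⟨R, rfl, rfl, fun w ω => ?_, fun τ hS i hi ω hne => ?_⟩
  · have key : ∀ j ∈ Finset.range S.n, ∑ i ∈ Finset.range (P.card - 1),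
        (if u (i + 1) ∈ Ioc (S.t j) (S.t (j + 1)) then S.ξ j ω else 0) *
          (w (u (i + 1)) ω - w (u i) ω) = S.ξ j ω * (w (S.t (j + 1)) ω - w (S.t j) ω) := by
      intro j hj
      have hj' := Finset.mem_range.1 hj
      obtain ⟨a, ha, hau⟩ := exists_gridEnum_eq P (hP j hj'.le)
      obtain ⟨c, hc, hcu⟩ := exists_gridEnum_eq P (hP (j + 1) hj')
      rcases (S.mono (Nat.le_succ j)).eq_or_lt with he | hlt
      · simp [← he]
      have hac : a ≤ c := by
        by_contra hcon
        have := gridEnum_mono P (not_le.1 hcon).le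
        rw [hau, hcu] at this
        exact absurd hlt (not_lt.2 this)
      have hsub : ∀ i ∈ Finset.range (P.card - 1),
          (u (i + 1) ∈ Ioc (S.t j) (S.t (j + 1)) ↔ i ∈ Finset.Ico a c) := by
        intro i hi
        have hi' : i + 1 < P.card := by have := Finset.mem_range.1 hi; omega
        rw [← hau, ← hcu, mem_Ioc, Finset.mem_Ico]
        constructor
        · rintro ⟨h1, h2⟩
          constructor
          · by_contra hcon
            exact absurd h1 (not_lt.2 (gridEnum_mono P (by omega)))
          · by_contra hcon
            exact absurd h2 (not_le.2 (gridEnum_lt P (by omega) hi'))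
        · rintro ⟨h1, h2⟩
          exact ⟨gridEnum_lt P (by omega) hi', gridEnum_mono P (by omega)⟩
      calc _ = ∑ i ∈ Finset.range (P.card - 1), (if i ∈ Finset.Ico a c then
            S.ξ j ω * (w (u (i + 1)) ω - w (u i) ω) else 0) := by
            refine Finset.sum_congr rfl fun i hi => ?_
            simp only [hsub i hi, ite_mul, zero_mul]
        _ = ∑ i ∈ Finset.Ico a c, S.ξ j ω * (w (u (i + 1)) ω - w (u i) ω) := by
            rw [← Finset.sum_filter]
            congr 1
            ext i
            simp only [Finset.mem_filter, Finset.mem_range, Finset.mem_Ico]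
            omega
        _ = _ := by
            rw [← Finset.mul_sum, Finset.sum_Ico_sub (fun i => w (u i) ω) hac, hu, hau, hcu]
    have : R.integral w ω = ∑ i ∈ Finset.range (P.card - 1), ∑ j ∈ Finset.range S.n,
        (if u (i + 1) ∈ Ioc (S.t j) (S.t (j + 1)) then S.ξ j ω else 0) *
          (w (u (i + 1)) ω - w (u i) ω) := by
      refine Finset.sum_congr rfl fun i hi => ?_
      have hi' : i + 1 < P.card := by have := Finset.mem_range.1 hi; omega
      simp only [R, η, hi', if_true, Finset.sum_mul]
    rw [this, Finset.sum_comm]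
    exact Finset.sum_congr rfl key
  · have hi' : i + 1 < P.card := by
      have : i < P.card - 1 := hi
      omega
    simp only [R, η, hi', if_true] at hne ⊢
    obtain ⟨j, hj, hne⟩ := Finset.exists_ne_zero_of_sum_ne_zero hne
    have hj' := Finset.mem_range.1 hj
    split_ifs at hne with hm
    · exact (hS j hj' ω hne).trans (hle i hi' j hj' hm)
    · exact absurd rfl hne

/-- Two simple integrands can be rewritten on a common grid. -/
theorem SimpleIntegrand.exists_common_grid (S S' : SimpleIntegrand 𝓕) :
    ∃ R R' : SimpleIntegrand 𝓕, R'.n = R.n ∧ R'.t = R.t ∧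
      (∀ (w : ℝ≥0 → Ω → ℝ) ω, R.integral w ω = S.integral w ω) ∧
      (∀ (w : ℝ≥0 → Ω → ℝ) ω, R'.integral w ω = S'.integral w ω) ∧
      ∀ τ, (S.After τ → R.After τ) ∧ (S'.After τ → R'.After τ) := by
  classical
  let P := (Finset.range (S.n + 1)).image S.t ∪ (Finset.range (S'.n + 1)).image S'.t
  obtain ⟨R, hn, ht, hI, hA⟩ := S.exists_refine P fun i hi => by
    simp only [P, Finset.mem_union, Finset.mem_image, Finset.mem_range]
    exact Or.inl ⟨i, by omega, rfl⟩
  obtain ⟨R', hn', ht', hI', hA'⟩ := S'.exists_refine P fun i hi => by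
    simp only [P, Finset.mem_union, Finset.mem_image, Finset.mem_range]
    exact Or.inr ⟨i, by omega, rfl⟩
  exact ⟨R, R', hn'.trans hn.symm, ht'.trans ht.symm, hI, hI', fun τ => ⟨hA τ, hA' τ⟩⟩

/-- Linear combinations of simple integrands. -/
theorem SimpleIntegrand.exists_linear_comb (S S' : SimpleIntegrand 𝓕) (a c : ℝ) :
    ∃ R : SimpleIntegrand 𝓕,
      (∀ (w : ℝ≥0 → Ω → ℝ) ω, R.integral w ω = a * S.integral w ω + c * S'.integral w ω) ∧
      ∀ τ, S.After τ → S'.After τ → R.After τ := by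
  obtain ⟨R, R', hn, ht, hI, hI', hA⟩ := S.exists_common_grid S'
  obtain ⟨C, hC0, hC⟩ := R.abs_ξ_le
  obtain ⟨C', hC0', hC'⟩ := R'.abs_ξ_le
  refine ⟨⟨R.n, R.t, R.mono, fun i ω => a * R.ξ i ω + c * R'.ξ i ω, fun i => ?_, |a| * C + |c| * C',
    fun i ω => ?_⟩, fun w ω => ?_, fun τ h1 h2 i hi ω hne => ?_⟩
  · have := R'.measurable_ξ i
    rw [ht] at this
    exact ((R.measurable_ξ i).const_mul a).add (this.const_mul c)
  · refine (abs_add_le _ _).trans ?_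
    rw [abs_mul, abs_mul]
    exact add_le_add (mul_le_mul_of_nonneg_left (hC i ω) (abs_nonneg _))
      (mul_le_mul_of_nonneg_left (hC' i ω) (abs_nonneg _))
  · rw [← hI, ← hI']
    simp only [SimpleIntegrand.integral, hn, ht, Finset.mul_sum, ← Finset.sum_add_distrib]
    exact Finset.sum_congr rfl fun i _ => by ring
  · by_cases h : R.ξ i ω = 0
    · have h' : R'.ξ i ω ≠ 0 := by
        intro h0
        exact hne (by simp [h, h0])
      have := (hA τ).2 h2 i (hn ▸ hi) ω h'
      rwa [ht] at this
    · exact (hA τ).1 h1 i hi ω h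

/-- A random variable that is measurable at the stopping time `τ`, set to zero off `{τ ≤ s}`, is
measurable at time `s`. -/
theorem measurable_ite_of_measurable_stopping {τ : Ω → ℝ≥0}
    (hτ : IsStoppingTime 𝓕 (fun ω => (τ ω : WithTop ℝ≥0))) {f : Ω → ℝ}
    (hf : Measurable[hτ.measurableSpace] f) (s : ℝ≥0) :
    Measurable[𝓕 s] ({ω | τ ω ≤ s}.indicator f) := by
  intro B hB
  have hset : MeasurableSet[𝓕 s] {ω | τ ω ≤ s} := by
    have := hτ s
    simpa only [WithTop.coe_le_coe] using this
  have h1 : MeasurableSet[𝓕 s] (f ⁻¹' B ∩ {ω | τ ω ≤ s}) := by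
    have := (hf hB).2 s
    simpa only [WithTop.coe_le_coe] using this
  rw [indicator_preimage, Set.ite]
  exact h1.union ((measurable_const (a := (0 : ℝ)) hB).diff hset)

/-- A simple integrand after `τ` stays one when multiplied by a bounded `𝓕_τ`-measurable random
variable `f`: where the `i`-th coefficient does not vanish, `τ ≤ t i`, and there `f` is known at
time `t i`. -/
theorem SimpleIntegrand.exists_mul (S : SimpleIntegrand 𝓕) {τ : Ω → ℝ≥0}
    (hτ : IsStoppingTime 𝓕 (fun ω => (τ ω : WithTop ℝ≥0))) (hS : S.After τ) {f : Ω → ℝ}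
    (hf : Measurable[hτ.measurableSpace] f) {C : ℝ} (hfC : ∀ ω, |f ω| ≤ C) :
    ∃ R : SimpleIntegrand 𝓕,
      (∀ (w : ℝ≥0 → Ω → ℝ) ω, R.integral w ω = f ω * S.integral w ω) ∧ R.After τ := by
  obtain ⟨D, hD0, hD⟩ := S.abs_ξ_le
  refine ⟨⟨S.n, S.t, S.mono, fun i ω => {ω | τ ω ≤ S.t i}.indicator f ω * S.ξ i ω, fun i => ?_,
    C * D, fun i ω => ?_⟩, fun w ω => ?_, fun i hi ω hne => ?_⟩
  · exact (measurable_ite_of_measurable_stopping hτ hf _).mul (S.measurable_ξ i)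
  · rw [abs_mul]
    have hC0 : 0 ≤ C := (abs_nonneg _).trans (hfC ω)
    refine mul_le_mul ?_ (hD i ω) (abs_nonneg _) hC0
    by_cases h : ω ∈ {ω | τ ω ≤ S.t i}
    · rw [indicator_of_mem h]; exact hfC ω
    · rw [indicator_of_notMem h]; simpa using hC0
  · simp only [SimpleIntegrand.integral, Finset.mul_sum]
    refine Finset.sum_congr rfl fun i hi => ?_
    by_cases h : S.ξ i ω = 0
    · simp [h]
    · have : ω ∈ {ω | τ ω ≤ S.t i} := hS i (Finset.mem_range.1 hi) ω h
      rw [indicator_of_mem this]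
      ring
  · exact hS i hi ω (right_ne_zero_of_mul hne)

end Simple

/-! ### Increments of the Brownian motions -/

section Increments

variable {Ω : Type*} {mΩ : MeasurableSpace Ω} {μ : Measure Ω} {𝓕 : Filtration ℝ≥0 mΩ}
  {m : ℕ} {W : Fin m → ℝ≥0 → Ω → ℝ}

theorem IsBrownianFamily.memLp_increment (hW : IsBrownianFamily 𝓕 μ W) (k : Fin m) (s t : ℝ≥0) :
    MemLp (fun ω => W k t ω - W k s ω) 2 μ :=
  ((hW.brownian k).hasLaw_sub t s).hasGaussianLaw.memLp_two

theorem IsBrownianFamily.measurable (hW : IsBrownianFamily 𝓕 μ W) (k : Fin m) (t : ℝ≥0) :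
    Measurable (W k t) :=
  (hW.adapted k t).mono (𝓕.le t) le_rfl

theorem IsBrownianFamily.integral_increment (hW : IsBrownianFamily 𝓕 μ W) (k : Fin m)
    (s t : ℝ≥0) : ∫ ω, (W k t ω - W k s ω) ∂μ = 0 := by
  have := ((hW.brownian k).hasLaw_sub t s).integral_eq
  rw [integral_id_gaussianReal] at this
  exact this

theorem IsBrownianFamily.integral_increment_mul_increment [IsProbabilityMeasure μ]
    (hW : IsBrownianFamily 𝓕 μ W) (k l : Fin m)
    {s t : ℝ≥0} (hst : s ≤ t) :
    ∫ ω, (W k t ω - W k s ω) * (W l t ω - W l s ω) ∂μ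
      = if k = l then ((t : ℝ) - s) else 0 := by
  split_ifs with h
  · subst h
    have h1 := ((hW.brownian k).hasLaw_sub t s).variance_eq
    rw [variance_id_gaussianReal, variance_of_integral_eq_zero] at h1
    · have h2 : ((nndist (t : ℝ) (s : ℝ) : ℝ≥0) : ℝ) = (t : ℝ) - s := by
        rw [coe_nndist, Real.dist_eq, abs_of_nonneg (sub_nonneg.2 (by exact_mod_cast hst))]
      rw [← h2]
      refine Eq.trans (integral_congr_ae (Eventually.of_forall fun ω => ?_)) h1
      simp only [Pi.sub_apply]
      ring
    · exact (hW.memLp_increment k s t).aestronglyMeasurable.aemeasurable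
    · exact hW.integral_increment k s t
  · have hind : IndepFun (fun ω => W k t ω - W k s ω) (fun ω => W l t ω - W l s ω) μ := by
      have := (hW.indep.indepFun h).comp
        (φ := fun x : ℝ≥0 → ℝ => x t - x s) (ψ := fun x : ℝ≥0 → ℝ => x t - x s)
        (by fun_prop) (by fun_prop)
      exact this
    rw [hind.integral_fun_mul_eq_mul_integral (hW.memLp_increment k s t).aestronglyMeasurable
      (hW.memLp_increment l s t).aestronglyMeasurable, hW.integral_increment, zero_mul]

/-- Functions of the increments after time `s` are independent of what is known at time `s`. -/
theorem IsBrownianFamily.indepFun_increment (hW : IsBrownianFamily 𝓕 μ W)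
    {s t : ℝ≥0} (hst : s ≤ t) {f : Ω → ℝ} (hf : Measurable[𝓕 s] f) {g : (Fin m → ℝ) → ℝ}
    (hg : Measurable g) : IndepFun f (fun ω => g fun k => W k t ω - W k s ω) μ := by
  rw [IndepFun_iff_Indep]
  refine (indep_of_indep_of_le_right
    (indep_of_indep_of_le_left (hW.indep_increment s t hst) ?_) hf.comap_le).symm
  change MeasurableSpace.comap (g ∘ fun ω k => W k t ω - W k s ω) _ ≤ _
  rw [← MeasurableSpace.comap_comp]
  exact MeasurableSpace.comap_mono hg.comap_le

theorem IsBrownianFamily.integral_mul_increment (hW : IsBrownianFamily 𝓕 μ W)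
    {s t : ℝ≥0} (hst : s ≤ t) {f : Ω → ℝ} (hf : Measurable[𝓕 s] f) (k : Fin m) :
    ∫ ω, f ω * (W k t ω - W k s ω) ∂μ = 0 := by
  have := hW.indepFun_increment hst hf (measurable_pi_apply k)
  rw [this.integral_fun_mul_eq_mul_integral (hf.mono (𝓕.le s) le_rfl).aestronglyMeasurable
    (hW.memLp_increment k s t).aestronglyMeasurable, hW.integral_increment, mul_zero]

theorem IsBrownianFamily.integral_mul_increment_mul_increment [IsProbabilityMeasure μ]
    (hW : IsBrownianFamily 𝓕 μ W)
    {s t : ℝ≥0} (hst : s ≤ t) {f : Ω → ℝ} (hf : Measurable[𝓕 s] f) (k l : Fin m) :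
    ∫ ω, f ω * ((W k t ω - W k s ω) * (W l t ω - W l s ω)) ∂μ
      = (∫ ω, f ω ∂μ) * if k = l then ((t : ℝ) - s) else 0 := by
  have := hW.indepFun_increment (g := fun x => x k * x l) hst hf (by fun_prop)
  rw [this.integral_fun_mul_eq_mul_integral (hf.mono (𝓕.le s) le_rfl).aestronglyMeasurable
    ((hW.memLp_increment k s t).aestronglyMeasurable.mul
      (hW.memLp_increment l s t).aestronglyMeasurable), hW.integral_increment_mul_increment k l hst]

/-- Terms of elementary integrals over different intervals of a grid are orthogonal. -/
theorem SimpleIntegrand.integral_term_mul_term_of_lt (S S' : SimpleIntegrand 𝓕)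
    (hW : IsBrownianFamily 𝓕 μ W) (ht : S'.t = S.t) (k l : Fin m) {i j : ℕ} (hij : i < j) :
    ∫ ω, (S.ξ i ω * (W k (S.t (i + 1)) ω - W k (S.t i) ω)) *
      (S'.ξ j ω * (W l (S.t (j + 1)) ω - W l (S.t j) ω)) ∂μ = 0 := by
  have hm := S'.measurable_ξ j
  rw [ht] at hm
  have hf : Measurable[𝓕 (S.t j)]
      fun ω => S.ξ i ω * (W k (S.t (i + 1)) ω - W k (S.t i) ω) * S'.ξ j ω :=
    (((S.measurable_ξ i).mono (𝓕.mono (S.mono hij.le)) le_rfl).mul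
      (((hW.adapted k _).mono (𝓕.mono (S.mono hij)) le_rfl).sub
        ((hW.adapted k _).mono (𝓕.mono (S.mono hij.le)) le_rfl))).mul hm
  refine Eq.trans (integral_congr_ae (Eventually.of_forall fun ω => ?_))
    (hW.integral_mul_increment (S.mono (Nat.le_succ j)) hf l)
  simp only
  ring

theorem IsBrownianFamily.ae_continuous (hW : IsBrownianFamily 𝓕 μ W) :
    ∀ᵐ ω ∂μ, ∀ k, Continuous fun t => W k t ω :=
  ae_all_iff.2 fun k => (hW.brownian k).cont

end Increments

/-! ### The isometry for simple integrands -/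

section Isometry

variable {Ω : Type*} {mΩ : MeasurableSpace Ω} {μ : Measure Ω} [IsProbabilityMeasure μ]
  {𝓕 : Filtration ℝ≥0 mΩ} {m : ℕ} {W : Fin m → ℝ≥0 → Ω → ℝ}

theorem SimpleIntegrand.memLp_term (S : SimpleIntegrand 𝓕) (hW : IsBrownianFamily 𝓕 μ W)
    (k : Fin m) (i : ℕ) :
    MemLp (fun ω => S.ξ i ω * (W k (S.t (i + 1)) ω - W k (S.t i) ω)) 2 μ := by
  obtain ⟨C, _, hC⟩ := S.abs_ξ_le
  have hm := ((S.measurable_ξ i).mono (𝓕.le _) le_rfl).aestronglyMeasurable (μ := μ)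
  exact (hW.memLp_increment k (S.t i) (S.t (i + 1))).mul
    (MemLp.of_bound (p := ∞) hm C (Eventually.of_forall fun ω => hC i ω))

theorem SimpleIntegrand.memLp_integral (S : SimpleIntegrand 𝓕) (hW : IsBrownianFamily 𝓕 μ W)
    (k : Fin m) : MemLp (S.integral (W k)) 2 μ :=
  memLp_finsetSum _ fun i _ => S.memLp_term hW k i

theorem SimpleIntegrand.integral_integral (S : SimpleIntegrand 𝓕) (hW : IsBrownianFamily 𝓕 μ W)
    (k : Fin m) : ∫ ω, S.integral (W k) ω ∂μ = 0 := by
  unfold SimpleIntegrand.integral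
  rw [integral_finsetSum _ fun i _ => (S.memLp_term hW k i).integrable one_le_two]
  exact Finset.sum_eq_zero fun i _ =>
    hW.integral_mul_increment (S.mono (Nat.le_succ i)) (S.measurable_ξ i) k

theorem SimpleIntegrand.integral_mul_integral_of_same_grid (S S' : SimpleIntegrand 𝓕)
    (hW : IsBrownianFamily 𝓕 μ W) (hn : S'.n = S.n) (ht : S'.t = S.t) (k l : Fin m) :
    ∫ ω, S.integral (W k) ω * S'.integral (W l) ω ∂μ =
      if k = l then ∫ ω, (∑ i ∈ Finset.range S.n,
        S.ξ i ω * S'.ξ i ω * ((S.t (i + 1) : ℝ) - S.t i)) ∂μ else 0 := by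
  have hint : ∀ i j, Integrable (fun ω => (S.ξ i ω * (W k (S.t (i + 1)) ω - W k (S.t i) ω)) *
      (S'.ξ j ω * (W l (S.t (j + 1)) ω - W l (S.t j) ω))) μ := fun i j => by
    have := S'.memLp_term hW l j
    rw [ht] at this
    exact (S.memLp_term hW k i).integrable_mul this
  have hbdd : ∀ i, Integrable (fun ω => S.ξ i ω * S'.ξ i ω) μ := fun i => by
    obtain ⟨C, hC0, hC⟩ := S.abs_ξ_le
    obtain ⟨C', hC0', hC'⟩ := S'.abs_ξ_le
    refine Integrable.of_bound (((S.measurable_ξ i).mono (𝓕.le _) le_rfl).mul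
      ((S'.measurable_ξ i).mono (𝓕.le _) le_rfl)).aestronglyMeasurable (C * C')
      (Eventually.of_forall fun ω => ?_)
    rw [Real.norm_eq_abs, abs_mul]
    exact mul_le_mul (hC i ω) (hC' i ω) (abs_nonneg _) hC0
  have hterm : ∀ i j, ∫ ω, (S.ξ i ω * (W k (S.t (i + 1)) ω - W k (S.t i) ω)) *
      (S'.ξ j ω * (W l (S.t (j + 1)) ω - W l (S.t j) ω)) ∂μ =
      if i = j then (∫ ω, S.ξ i ω * S'.ξ i ω ∂μ) *
        (if k = l then ((S.t (i + 1) : ℝ) - S.t i) else 0) else 0 := by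
    intro i j
    rcases lt_trichotomy i j with h | h | h
    · rw [if_neg h.ne, S.integral_term_mul_term_of_lt S' hW ht k l h]
    · subst h
      have hm := S'.measurable_ξ i
      rw [ht] at hm
      rw [if_pos rfl]
      refine Eq.trans (integral_congr_ae (Eventually.of_forall fun ω => ?_))
        (hW.integral_mul_increment_mul_increment (S.mono (Nat.le_succ i))
          ((S.measurable_ξ i).mul hm) k l)
      simp only [Pi.mul_apply, Nat.succ_eq_add_one]
      ring
    · rw [if_neg h.ne']
      have := S'.integral_term_mul_term_of_lt S hW ht.symm l k h
      rw [ht] at this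
      rw [← this]
      exact integral_congr_ae (Eventually.of_forall fun ω => mul_comm _ _)
  calc _ = ∫ ω, ∑ i ∈ Finset.range S.n, ∑ j ∈ Finset.range S.n,
        (S.ξ i ω * (W k (S.t (i + 1)) ω - W k (S.t i) ω)) *
          (S'.ξ j ω * (W l (S.t (j + 1)) ω - W l (S.t j) ω)) ∂μ := by
        simp only [SimpleIntegrand.integral, hn, ht, Finset.sum_mul_sum]
    _ = ∑ i ∈ Finset.range S.n, (∫ ω, S.ξ i ω * S'.ξ i ω ∂μ) *
        (if k = l then ((S.t (i + 1) : ℝ) - S.t i) else 0) := by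
        rw [integral_finsetSum _ fun i _ => integrable_finsetSum _ fun j _ => hint i j]
        refine Finset.sum_congr rfl fun i hi => ?_
        rw [integral_finsetSum _ fun j _ => hint i j]
        simp only [hterm, Finset.sum_ite_eq, hi, if_true]
    _ = _ := by
        split_ifs with h
        · rw [integral_finsetSum _ fun i _ => (hbdd i).mul_const _]
          exact Finset.sum_congr rfl fun i _ => (integral_mul_const _ _).symm
        · simp

/-- Lebesgue measure on the half-line of times. It is transported from `ℝ`, because the time
integral in `IsItoIntegral` runs over real times. -/
noncomputable def timeMeasure : Measure ℝ≥0 :=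
  (volume.restrict (Ioi (0 : ℝ))).map Real.toNNReal

instance : SigmaFinite timeMeasure := by
  refine ⟨⟨⟨fun n => Iic (n : ℝ≥0), fun _ => trivial, fun n => ?_, ?_⟩⟩⟩
  · rw [timeMeasure, Measure.map_apply measurable_real_toNNReal measurableSet_Iic,
      Measure.restrict_apply (measurable_real_toNNReal measurableSet_Iic)]
    refine (measure_mono (t := Ioc 0 (n : ℝ)) ?_).trans_lt (by simp)
    rintro x ⟨h1, h2⟩
    exact ⟨h2, by simpa using (Real.toNNReal_le_iff_le_coe.1 h1)⟩
  · refine eq_univ_of_forall fun x => ?_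
    obtain ⟨n, hn⟩ := exists_nat_ge x
    exact mem_iUnion.2 ⟨n, hn⟩

theorem timeMeasure_Ioc (a b : ℝ≥0) :
    timeMeasure (Ioc a b) = ENNReal.ofReal ((b : ℝ) - a) := by
  rw [timeMeasure, Measure.map_apply measurable_real_toNNReal measurableSet_Ioc,
    Measure.restrict_apply (measurable_real_toNNReal measurableSet_Ioc), ← Real.volume_Ioc]
  congr 1
  ext x
  simp only [mem_inter_iff, mem_preimage, mem_Ioc, mem_Ioi]
  constructor
  · rintro ⟨⟨h1, h2⟩, h3⟩
    exact ⟨Real.lt_toNNReal_iff_coe_lt.1 h1, Real.toNNReal_le_iff_le_coe.1 h2⟩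
  · rintro ⟨h1, h2⟩
    exact ⟨⟨Real.lt_toNNReal_iff_coe_lt.2 h1, Real.toNNReal_le_iff_le_coe.2 h2⟩,
      a.2.trans_lt h1⟩

instance : NullSingletonClass timeMeasure := by
  refine ⟨fun x => ?_⟩
  rw [timeMeasure, Measure.map_apply measurable_real_toNNReal (measurableSet_singleton x),
    Measure.restrict_apply (measurable_real_toNNReal (measurableSet_singleton x))]
  refine measure_mono_null (t := {(x : ℝ)}) ?_ (by simp)
  rintro y ⟨h1, h2⟩
  have : y.toNNReal = x := h1
  rw [mem_singleton_iff, ← this, Real.coe_toNNReal _ (le_of_lt h2)]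

theorem lintegral_timeMeasure {f : ℝ≥0 → ℝ≥0∞} (hf : Measurable f) :
    ∫⁻ s, f s ∂timeMeasure = ∫⁻ s in Ioi (0 : ℝ), f s.toNNReal := by
  rw [timeMeasure, lintegral_map hf measurable_real_toNNReal]

theorem SimpleIntegrand.measurable_value (S : SimpleIntegrand 𝓕) (ω : Ω) :
    Measurable fun s => S.value s ω := by
  unfold SimpleIntegrand.value
  exact Finset.measurable_sum _ fun i _ => measurable_const.indicator measurableSet_Ioc

theorem SimpleIntegrand.value_mul_value_of_same_grid (S S' : SimpleIntegrand 𝓕)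
    (hn : S'.n = S.n) (ht : S'.t = S.t) (s : ℝ≥0) (ω : Ω) :
    S.value s ω * S'.value s ω = ∑ i ∈ Finset.range S.n,
      (Ioc (S.t i) (S.t (i + 1))).indicator (fun _ => S.ξ i ω * S'.ξ i ω) s := by
  unfold SimpleIntegrand.value
  rw [hn, ht, Finset.sum_mul_sum]
  refine Finset.sum_congr rfl fun i hi => ?_
  rw [Finset.sum_eq_single i]
  · by_cases h : s ∈ Ioc (S.t i) (S.t (i + 1)) <;> simp [h]
  · intro j _ hji
    by_cases h : s ∈ Ioc (S.t i) (S.t (i + 1))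
    · have : s ∉ Ioc (S.t j) (S.t (j + 1)) := by
        intro h'
        have := (S.mono.pairwise_disjoint_on_Ioc_succ hji).le_bot ⟨h', h⟩
        exact this
      simp [this]
    · simp [h]
  · exact fun h => absurd hi h

theorem SimpleIntegrand.integral_value_mul_value_of_same_grid (S S' : SimpleIntegrand 𝓕)
    (hn : S'.n = S.n) (ht : S'.t = S.t) (ω : Ω) :
    ∫ s, S.value s ω * S'.value s ω ∂timeMeasure =
      ∑ i ∈ Finset.range S.n, S.ξ i ω * S'.ξ i ω * ((S.t (i + 1) : ℝ) - S.t i) := by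
  simp_rw [S.value_mul_value_of_same_grid S' hn ht]
  rw [integral_finsetSum]
  · refine Finset.sum_congr rfl fun i _ => ?_
    rw [integral_indicator measurableSet_Ioc, setIntegral_const, Measure.real, timeMeasure_Ioc,
      ENNReal.toReal_ofReal (sub_nonneg.2 (by exact_mod_cast S.mono (Nat.le_succ i))), smul_eq_mul,
      mul_comm]
  · intro i _
    refine (integrable_indicator_iff measurableSet_Ioc).2 (integrableOn_const ?_)
    rw [timeMeasure_Ioc]
    exact ENNReal.ofReal_ne_top

theorem SimpleIntegrand.lintegral_value_sq (S : SimpleIntegrand 𝓕) (ω : Ω) :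
    ∫⁻ s, ENNReal.ofReal (S.value s ω ^ 2) ∂timeMeasure =
      ENNReal.ofReal (∑ i ∈ Finset.range S.n, S.ξ i ω ^ 2 * ((S.t (i + 1) : ℝ) - S.t i)) := by
  have h := S.integral_value_mul_value_of_same_grid S rfl rfl ω
  simp only [← sq] at h
  rw [← h, ofReal_integral_eq_lintegral_ofReal _ (Eventually.of_forall fun s => sq_nonneg _)]
  simp_rw [sq, S.value_mul_value_of_same_grid S rfl rfl]
  refine integrable_finsetSum _ fun i _ => ?_
  refine (integrable_indicator_iff measurableSet_Ioc).2 (integrableOn_const ?_)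
  rw [timeMeasure_Ioc]
  exact ENNReal.ofReal_ne_top

/-- A Lenglart-type inequality: the elementary integral is small in probability where the quadratic
variation of the integrand is. The integrand is stopped as soon as its quadratic variation over the
present interval would exceed `δ`, which is known at the left end point. -/
theorem SimpleIntegrand.measure_integral_ge_le (S : SimpleIntegrand 𝓕)
    (hW : IsBrownianFamily 𝓕 μ W) (k : Fin m) {ε δ : ℝ} (hε : 0 < ε) (hδ : 0 < δ) :
    μ {ω | ε ≤ |S.integral (W k) ω|} ≤
      μ {ω | ENNReal.ofReal δ ≤ ∫⁻ s, ENNReal.ofReal (S.value s ω ^ 2) ∂timeMeasure} +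
        ENNReal.ofReal (δ / ε ^ 2) := by
  -- the quadratic variation up to the end of the `i`-th interval; it is known at its left end
  -- point, so cutting the integrand off where it exceeds `δ` leaves a simple integrand `R`
  let A : ℕ → Ω → ℝ := fun i ω =>
    ∑ j ∈ Finset.range (i + 1), S.ξ j ω ^ 2 * ((S.t (j + 1) : ℝ) - S.t j)
  have hinc : ∀ j, 0 ≤ ((S.t (j + 1) : ℝ) - S.t j) := fun j =>
    sub_nonneg.2 (by exact_mod_cast S.mono (Nat.le_succ j))
  have hAm : ∀ i, Measurable[𝓕 (S.t i)] (A i) := fun i => by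
    refine Finset.measurable_sum _ fun j hj => ?_
    have hj' : j ≤ i := Nat.lt_succ_iff.1 (Finset.mem_range.1 hj)
    exact (((S.measurable_ξ j).mono (𝓕.mono (S.mono hj')) le_rfl).pow_const 2).mul_const _
  have hset : ∀ i, MeasurableSet[𝓕 (S.t i)] {ω | A i ω ≤ δ} := fun i =>
    (hAm i) measurableSet_Iic
  obtain ⟨C, hC0, hC⟩ := S.abs_ξ_le
  let R : SimpleIntegrand 𝓕 :=
    { n := S.n
      t := S.t
      mono := S.mono
      ξ := fun i => {ω | A i ω ≤ δ}.indicator (S.ξ i)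
      measurable_ξ := fun i => (S.measurable_ξ i).indicator (hset i)
      bounded_ξ := ⟨C, fun i ω => by
        by_cases h : ω ∈ {ω | A i ω ≤ δ}
        · rw [indicator_of_mem h]; exact hC i ω
        · rw [indicator_of_notMem h]; simpa using hC0⟩ }
  have hqv : ∀ N ω, ∑ i ∈ Finset.range N, R.ξ i ω * R.ξ i ω * ((S.t (i + 1) : ℝ) - S.t i) ≤ δ := by
    intro N ω
    induction N with
    | zero => simpa using hδ.le
    | succ N ih =>
      by_cases h : A N ω ≤ δ
      · refine le_trans (Finset.sum_le_sum fun i _ => ?_) h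
        refine mul_le_mul_of_nonneg_right ?_ (hinc i)
        simp only [R, indicator]
        split_ifs
        · rw [sq]
        · simpa using sq_nonneg _
      · rw [Finset.sum_range_succ]
        have : R.ξ N ω = 0 := by simp [R, h]
        simpa [this] using ih
  have hsub : {ω | ε ≤ |S.integral (W k) ω|} ⊆
      {ω | ENNReal.ofReal δ ≤ ∫⁻ s, ENNReal.ofReal (S.value s ω ^ 2) ∂timeMeasure} ∪
        {ω | ENNReal.ofReal (ε ^ 2) ≤ ENNReal.ofReal (R.integral (W k) ω ^ 2)} := by
    intro ω hω
    by_cases h : ∑ i ∈ Finset.range S.n, S.ξ i ω ^ 2 * ((S.t (i + 1) : ℝ) - S.t i) ≤ δ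
    · right
      have heq : R.integral (W k) ω = S.integral (W k) ω := by
        refine Finset.sum_congr rfl fun i hi => ?_
        have : A i ω ≤ δ := by
          refine le_trans (Finset.sum_le_sum_of_subset_of_nonneg ?_ ?_) h
          · exact Finset.range_mono (Finset.mem_range.1 hi)
          · exact fun j _ _ => mul_nonneg (sq_nonneg _) (hinc j)
        simp [R, this]
      simp only [mem_ofPred_eq]
      rw [heq, ← sq_abs (S.integral (W k) ω)]
      exact ENNReal.ofReal_le_ofReal (pow_le_pow_left₀ hε.le hω 2)
    · left
      simp only [mem_ofPred_eq]
      rw [S.lintegral_value_sq]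
      exact ENNReal.ofReal_le_ofReal (not_le.1 h).le
  refine (measure_mono hsub).trans ((measure_union_le _ _).trans (add_le_add le_rfl ?_))
  have hε2 : ENNReal.ofReal (ε ^ 2) ≠ 0 := by
    rw [Ne, ENNReal.ofReal_eq_zero, not_le]; positivity
  refine (meas_ge_le_lintegral_div ?_ hε2 ENNReal.ofReal_ne_top).trans ?_
  · exact ((R.memLp_integral hW k).aestronglyMeasurable.aemeasurable.pow_const 2).ennreal_ofReal
  · rw [← ofReal_integral_eq_lintegral_ofReal (R.memLp_integral hW k).integrable_sq
      (Eventually.of_forall fun _ => sq_nonneg _), ENNReal.ofReal_div_of_pos (by positivity)]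
    gcongr
    have h1 := R.integral_mul_integral_of_same_grid R hW rfl rfl k k
    rw [if_pos rfl] at h1
    simp only [sq]
    rw [h1]
    refine (integral_mono_of_nonneg (g := fun _ => δ) (Eventually.of_forall fun ω => ?_)
      (integrable_const _) (Eventually.of_forall fun ω => hqv S.n ω)).trans (by simp)
    exact Finset.sum_nonneg fun i _ => mul_nonneg (mul_self_nonneg _) (hinc i)

end Isometry

/-! ### Uniqueness of the Itô integral -/

section Unique

theorem ENNReal_edist_zero_right (x : ℝ≥0∞) : edist x 0 = x := by
  cases x with
  | top => exact (ENNReal.edist_eq_top_iff _ _).2 ⟨ENNReal.top_ne_zero, Or.inl rfl⟩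
  | coe x =>
    change edist x 0 = (x : ℝ≥0∞)
    rw [edist_nndist, NNReal.nndist_eq]
    simp

variable {Ω : Type*} {mΩ : MeasurableSpace Ω} {μ : Measure Ω} [IsProbabilityMeasure μ]
  {𝓕 : Filtration ℝ≥0 mΩ} {m : ℕ} {W : Fin m → ℝ≥0 → Ω → ℝ}

/-- Two Itô integrals of the same integrand agree almost surely: the difference of the
approximating simple integrands has small quadratic variation, so `measure_integral_ge_le`
applies. -/
theorem IsItoIntegral.ae_eq (hW : IsBrownianFamily 𝓕 μ W) {k : Fin m} {H : ℝ≥0 → Ω → ℝ}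
    {I I' : Ω → ℝ} (h : IsItoIntegral 𝓕 μ (W k) H I) (h' : IsItoIntegral 𝓕 μ (W k) H I') :
    I =ᵐ[μ] I' := by
  obtain ⟨hH, S, hS, hSI⟩ := h
  obtain ⟨-, S', hS', hSI'⟩ := h'
  choose R hR _ using fun n => (S n).exists_linear_comb (S' n) 1 (-1)
  have hqv : ∀ᵐ ω ∂μ, ∀ n, ∫⁻ s, ENNReal.ofReal ((R n).value s ω ^ 2) ∂timeMeasure ≤
      2 * (∫⁻ s in Ioi (0 : ℝ), ENNReal.ofReal (((S n).value s.toNNReal ω - H s.toNNReal ω) ^ 2)) +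
      2 * (∫⁻ s in Ioi (0 : ℝ),
        ENNReal.ofReal (((S' n).value s.toNNReal ω - H s.toNNReal ω) ^ 2)) := by
    filter_upwards [hH] with ω hω n
    have m1 : Measurable fun s => ENNReal.ofReal (((S n).value s ω - H s ω) ^ 2) :=
      ((((S n).measurable_value ω).sub hω).pow_const 2).ennreal_ofReal
    have m2 : Measurable fun s => ENNReal.ofReal (((S' n).value s ω - H s ω) ^ 2) :=
      ((((S' n).measurable_value ω).sub hω).pow_const 2).ennreal_ofReal
    rw [← lintegral_timeMeasure m1, ← lintegral_timeMeasure m2, ← lintegral_const_mul _ m1,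
      ← lintegral_const_mul _ m2, ← lintegral_add_left (m1.const_mul 2)]
    refine lintegral_mono fun s => ?_
    rw [SimpleIntegrand.value_eq_integral, hR, ← SimpleIntegrand.value_eq_integral,
      ← SimpleIntegrand.value_eq_integral]
    rw [show (2 : ℝ≥0∞) = ENNReal.ofReal 2 by simp, ← ENNReal.ofReal_mul (by norm_num),
      ← ENNReal.ofReal_mul (by norm_num), ← ENNReal.ofReal_add (by positivity) (by positivity)]
    refine ENNReal.ofReal_le_ofReal ?_
    -- `(x - y) ^ 2 ≤ 2 * x ^ 2 + 2 * y ^ 2`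
    nlinarith [sq_nonneg (((S n).value s ω - H s ω) + ((S' n).value s ω - H s ω))]
  have hRI : ∀ ε : ℝ, 0 < ε →
      Tendsto (fun n => μ {ω | ε ≤ |(R n).integral (W k) ω|}) atTop (𝓝 0) := by
    intro ε hε
    rw [ENNReal.tendsto_nhds_zero]
    intro η hη
    obtain ⟨δ, hδ, hδη⟩ : ∃ δ : ℝ, 0 < δ ∧ ENNReal.ofReal (δ / ε ^ 2) ≤ η / 2 := by
      rcases eq_or_ne η ∞ with rfl | hη'
      · exact ⟨1, one_pos, by simp [ENNReal.top_div]⟩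
      · have : 0 < η.toReal := ENNReal.toReal_pos hη.ne' hη'
        refine ⟨η.toReal / 2 * ε ^ 2, by positivity, ?_⟩
        rw [mul_div_cancel_right₀ _ (by positivity), ENNReal.ofReal_div_of_pos (by norm_num),
          ENNReal.ofReal_toReal hη']
        simp
    have hδ4 : 0 < ENNReal.ofReal (δ / 4) := ENNReal.ofReal_pos.2 (by positivity)
    have hη4 : 0 < η / 4 := ENNReal.div_pos hη.ne' (by simp)
    filter_upwards [ENNReal.tendsto_nhds_zero.1 (hS _ hδ4) _ hη4,
      ENNReal.tendsto_nhds_zero.1 (hS' _ hδ4) _ hη4] with n h1 h2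
    refine ((R n).measure_integral_ge_le hW k hε hδ).trans ?_
    have hle : μ {ω | ENNReal.ofReal δ ≤
        ∫⁻ s, ENNReal.ofReal ((R n).value s ω ^ 2) ∂timeMeasure} ≤ η / 4 + η / 4 := by
      refine le_trans ?_ ((measure_union_le _ _).trans (add_le_add h1 h2))
      refine measure_mono_ae ?_
      filter_upwards [hqv] with ω hω hmem
      by_contra hcon
      simp only [Pi.zero_apply, ENNReal_edist_zero_right] at hcon
      have c1' : ∫⁻ s in Ioi (0 : ℝ), ENNReal.ofReal
          (((S n).value s.toNNReal ω - H s.toNNReal ω) ^ 2) < ENNReal.ofReal (δ / 4) :=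
        lt_of_not_ge fun hx => hcon (Or.inl hx)
      have c2' : ∫⁻ s in Ioi (0 : ℝ), ENNReal.ofReal
          (((S' n).value s.toNNReal ω - H s.toNNReal ω) ^ 2) < ENNReal.ofReal (δ / 4) :=
        lt_of_not_ge fun hx => hcon (Or.inr hx)
      have := hmem.trans (hω n)
      refine absurd this (not_le.2 ?_)
      calc _ < 2 * ENNReal.ofReal (δ / 4) + 2 * ENNReal.ofReal (δ / 4) := by
            refine ENNReal.add_lt_add ?_ ?_
            · exact ENNReal.mul_lt_mul_right (by norm_num) (by norm_num) c1'
            · exact ENNReal.mul_lt_mul_right (by norm_num) (by norm_num) c2'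
        _ = ENNReal.ofReal δ := by
            rw [show (2 : ℝ≥0∞) = ENNReal.ofReal 2 by simp, ← ENNReal.ofReal_mul (by norm_num),
              ← ENNReal.ofReal_add (by positivity) (by positivity)]
            congr 1
            ring
    calc _ ≤ (η / 4 + η / 4) + η / 2 := add_le_add hle hδη
      _ = η := by
        rw [← ENNReal.add_div, ← two_mul, show (4 : ℝ≥0∞) = 2 * 2 by norm_num,
          ENNReal.mul_div_mul_left _ _ (by norm_num) (by norm_num), ENNReal.add_halves]
  -- hence the integrals of `S n` also tend to `I'`
  have hSI'' : TendstoInMeasure μ (fun n => (S n).integral (W k)) atTop I' := by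
    rw [tendstoInMeasure_iff_norm] at hSI' ⊢
    intro ε hε
    have := (hRI (ε / 2) (half_pos hε)).add (hSI' (ε / 2) (half_pos hε))
    rw [add_zero] at this
    refine tendsto_of_tendsto_of_tendsto_of_le_of_le tendsto_const_nhds this
      (fun _ => zero_le) fun n => ?_
    refine (measure_mono ?_).trans (measure_union_le _ _)
    intro ω hω
    simp only [mem_union, mem_ofPred_eq, Real.norm_eq_abs] at hω ⊢
    by_contra! hcon
    have heq : (S n).integral (W k) ω - I' ω =
        (R n).integral (W k) ω + ((S' n).integral (W k) ω - I' ω) := by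
      rw [hR]; ring
    rw [heq] at hω
    have := abs_add_le ((R n).integral (W k) ω) ((S' n).integral (W k) ω - I' ω)
    linarith [hcon.1, hcon.2]
  exact tendstoInMeasure_ae_unique hSI hSI''

end Unique

/-! ### Square-integrable Itô integrals -/

section L2

variable {Ω : Type*} {mΩ : MeasurableSpace Ω} {μ : Measure Ω}
  {𝓕 : Filtration ℝ≥0 mΩ} {m : ℕ} {W : Fin m → ℝ≥0 → Ω → ℝ}

theorem tendsto_integral_mul_of_tendsto_eLpNorm {α : Type*} {mα : MeasurableSpace α}
    {ν : Measure α} {f g : ℕ → α → ℝ} {F G : α → ℝ} (hf : ∀ n, MemLp (f n) 2 ν)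
    (hg : ∀ n, MemLp (g n) 2 ν) (hF : MemLp F 2 ν) (hG : MemLp G 2 ν)
    (hfF : Tendsto (fun n => eLpNorm (f n - F) 2 ν) atTop (𝓝 0))
    (hgG : Tendsto (fun n => eLpNorm (g n - G) 2 ν) atTop (𝓝 0)) :
    Tendsto (fun n => ∫ x, f n x * g n x ∂ν) atTop (𝓝 (∫ x, F x * G x ∂ν)) := by
  have h1 := (Lp.tendsto_Lp_iff_tendsto_eLpNorm'' f hf F hF).2 hfF
  have h2 := (Lp.tendsto_Lp_iff_tendsto_eLpNorm'' g hg G hG).2 hgG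
  have key : ∀ {a c : α → ℝ} (ha : MemLp a 2 ν) (hc : MemLp c 2 ν),
      inner ℝ (hc.toLp c) (ha.toLp a) = ∫ x, a x * c x ∂ν := by
    intro a c ha hc
    rw [L2.inner_def]
    refine integral_congr_ae ?_
    filter_upwards [ha.coeFn_toLp, hc.coeFn_toLp] with x h1 h2
    rw [h1, h2]
    simp
  have := h2.inner (𝕜 := ℝ) h1
  simpa only [key] using this

theorem SimpleIntegrand.memLp_value (S : SimpleIntegrand 𝓕) [IsProbabilityMeasure μ] :
    MemLp (fun p : ℝ≥0 × Ω => S.value p.1 p.2) 2 (timeMeasure.prod μ) := by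
  obtain ⟨C, hC0, hC⟩ := S.abs_ξ_le
  refine memLp_finsetSum _ fun i _ => ?_
  have heq : (fun p : ℝ≥0 × Ω => (Ioc (S.t i) (S.t (i + 1))).indicator (fun _ => S.ξ i p.2) p.1) =
      (Ioc (S.t i) (S.t (i + 1)) ×ˢ univ).indicator fun p => S.ξ i p.2 := by
    ext p
    by_cases h : p.1 ∈ Ioc (S.t i) (S.t (i + 1)) <;> simp [indicator, h]
  have hms : MeasurableSet (Ioc (S.t i) (S.t (i + 1)) ×ˢ (univ : Set Ω)) :=
    measurableSet_Ioc.prod MeasurableSet.univ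
  rw [heq, memLp_indicator_iff_restrict hms]
  have : IsFiniteMeasure ((timeMeasure.prod μ).restrict
      (Ioc (S.t i) (S.t (i + 1)) ×ˢ (univ : Set Ω))) := by
    refine ⟨?_⟩
    rw [Measure.restrict_apply_univ, Measure.prod_prod, timeMeasure_Ioc]
    simp
  exact MemLp.of_bound ((((S.measurable_ξ i).mono (𝓕.le _) le_rfl).comp
    measurable_snd).aestronglyMeasurable) C (Eventually.of_forall fun p => hC i p.2)

/-- The Itô isometry for simple integrands, and the orthogonality of the integrals with respect to
different Brownian motions. -/
theorem SimpleIntegrand.integral_mul_integral (S S' : SimpleIntegrand 𝓕) [IsProbabilityMeasure μ]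
    (hW : IsBrownianFamily 𝓕 μ W) (k l : Fin m) :
    ∫ ω, S.integral (W k) ω * S'.integral (W l) ω ∂μ =
      if k = l then ∫ p, S.value p.1 p.2 * S'.value p.1 p.2 ∂(timeMeasure.prod μ) else 0 := by
  obtain ⟨R, R', hn, ht, hI, hI', -⟩ := S.exists_common_grid S'
  simp only [← hI, ← hI', SimpleIntegrand.value_eq_integral]
  rw [R.integral_mul_integral_of_same_grid R' hW hn ht]
  simp only [← SimpleIntegrand.value_eq_integral]
  have := integral_prod_symm _ ((R.memLp_value (μ := μ)).integrable_mul R'.memLp_value)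
  simp only [Pi.mul_apply] at this
  rw [this]
  simp only [R.integral_value_mul_value_of_same_grid R' hn ht]

theorem eLpNorm_two_eq_of_integral_eq {α β : Type*} {mα : MeasurableSpace α}
    {mβ : MeasurableSpace β} {ν : Measure α} {ρ : Measure β} {f : α → ℝ} {g : β → ℝ}
    (hf : MemLp f 2 ν) (hg : MemLp g 2 ρ) (h : ∫ x, f x * f x ∂ν = ∫ x, g x * g x ∂ρ) :
    eLpNorm f 2 ν = eLpNorm g 2 ρ := by
  rw [hf.eLpNorm_eq_integral_rpow_norm (by norm_num) (by norm_num),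
    hg.eLpNorm_eq_integral_rpow_norm (by norm_num) (by norm_num)]
  simp only [ENNReal.toReal_ofNat, Real.rpow_two, Real.norm_eq_abs, sq_abs]
  simp only [sq, h]

theorem SimpleIntegrand.eLpNorm_integral (S : SimpleIntegrand 𝓕) [IsProbabilityMeasure μ]
    (hW : IsBrownianFamily 𝓕 μ W) (k : Fin m) : eLpNorm (S.integral (W k)) 2 μ =
      eLpNorm (fun p : ℝ≥0 × Ω => S.value p.1 p.2) 2 (timeMeasure.prod μ) :=
  eLpNorm_two_eq_of_integral_eq (S.memLp_integral hW k) S.memLp_value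
    (by rw [S.integral_mul_integral S hW k k, if_pos rfl])

/-- `I` is the square-integrable Itô integral of `H` with respect to `w`, and `H` lives after the
random time `τ`: there are simple integrands after `τ` that tend to `H` in `L²(ds ⊗ μ)` and whose
elementary integrals tend to `I` in `L²(μ)`. -/
structure IsL2Ito (𝓕 : Filtration ℝ≥0 mΩ) (μ : Measure Ω) (τ : Ω → ℝ≥0) (w H : ℝ≥0 → Ω → ℝ)
    (I : Ω → ℝ) : Prop where
  memLp_integrand : MemLp (fun p : ℝ≥0 × Ω => H p.1 p.2) 2 (timeMeasure.prod μ)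
  memLp_integral : MemLp I 2 μ
  exists_approx : ∃ S : ℕ → SimpleIntegrand 𝓕, (∀ n, (S n).After τ) ∧
    Tendsto (fun n => eLpNorm ((fun p : ℝ≥0 × Ω => (S n).value p.1 p.2) - fun p => H p.1 p.2) 2
      (timeMeasure.prod μ)) atTop (𝓝 0) ∧
    Tendsto (fun n => eLpNorm ((S n).integral w - I) 2 μ) atTop (𝓝 0)

variable {τ : Ω → ℝ≥0}

/-- The elementary integrals of simple integrands that converge in `L²` converge in `L²`, by the
isometry and completeness. -/
theorem exists_tendsto_integral [IsProbabilityMeasure μ] (hW : IsBrownianFamily 𝓕 μ W) (k : Fin m)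
    {H : ℝ≥0 → Ω → ℝ}
    (hH : MemLp (fun p : ℝ≥0 × Ω => H p.1 p.2) 2 (timeMeasure.prod μ))
    (S : ℕ → SimpleIntegrand 𝓕)
    (hS : Tendsto (fun n => eLpNorm ((fun p : ℝ≥0 × Ω => (S n).value p.1 p.2) -
      fun p => H p.1 p.2) 2 (timeMeasure.prod μ)) atTop (𝓝 0)) :
    ∃ I, MemLp I 2 μ ∧ Tendsto (fun n => eLpNorm ((S n).integral (W k) - I) 2 μ) atTop (𝓝 0) := by
  let f : ℕ → Lp ℝ 2 μ := fun n => ((S n).memLp_integral hW k).toLp _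
  let g : ℕ → Lp ℝ 2 (timeMeasure.prod μ) := fun n => (S n).memLp_value.toLp _
  have hg : CauchySeq g :=
    ((Lp.tendsto_Lp_iff_tendsto_eLpNorm'' _ (fun n => (S n).memLp_value) _ hH).2 hS).cauchySeq
  -- the isometry makes the sequence of integrals as Cauchy as that of the integrands
  have hdist : ∀ i j, dist (f i) (f j) = dist (g i) (g j) := by
    intro i j
    rw [dist_eq_norm, dist_eq_norm, ← MemLp.toLp_sub, ← MemLp.toLp_sub, Lp.norm_toLp, Lp.norm_toLp]
    obtain ⟨R, hR, -⟩ := (S i).exists_linear_comb (S j) 1 (-1)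
    have h1 : (S i).integral (W k) - (S j).integral (W k) = R.integral (W k) := by
      ext ω; rw [hR, Pi.sub_apply]; ring
    have h2 : ((fun p : ℝ≥0 × Ω => (S i).value p.1 p.2) - fun p => (S j).value p.1 p.2) =
        fun p => R.value p.1 p.2 := by
      ext p
      simp only [Pi.sub_apply, SimpleIntegrand.value_eq_integral, hR]; ring
    rw [h1, h2, R.eLpNorm_integral hW k]
  have hf : CauchySeq f := by
    rw [Metric.cauchySeq_iff] at hg ⊢
    simpa only [hdist] using hg
  obtain ⟨F, hF⟩ := cauchySeq_tendsto_of_complete hf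
  refine ⟨F, Lp.memLp F, ?_⟩
  rw [← Lp.tendsto_Lp_iff_tendsto_eLpNorm'' _ (fun n => (S n).memLp_integral hW k) _ (Lp.memLp F)]
  rwa [Lp.toLp_coeFn]

theorem exists_isL2Ito_of_forall_approx [IsProbabilityMeasure μ] (hW : IsBrownianFamily 𝓕 μ W)
    (k : Fin m) {H : ℝ≥0 → Ω → ℝ} (hH : MemLp (fun p : ℝ≥0 × Ω => H p.1 p.2) 2 (timeMeasure.prod μ))
    (happ : ∀ ε : ℝ≥0∞, 0 < ε → ∃ S : SimpleIntegrand 𝓕, S.After τ ∧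
      eLpNorm ((fun p : ℝ≥0 × Ω => S.value p.1 p.2) - fun p => H p.1 p.2) 2
        (timeMeasure.prod μ) ≤ ε) :
    ∃ I, IsL2Ito 𝓕 μ τ (W k) H I := by
  choose S hS1 hS2 using fun n : ℕ => happ ((n : ℝ≥0∞) + 1)⁻¹ (by simp)
  have hS : Tendsto (fun n => eLpNorm ((fun p : ℝ≥0 × Ω => (S n).value p.1 p.2) -
      fun p => H p.1 p.2) 2 (timeMeasure.prod μ)) atTop (𝓝 0) := by
    refine tendsto_of_tendsto_of_tendsto_of_le_of_le tendsto_const_nhds ?_ (fun _ => zero_le) hS2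
    have := (tendsto_add_atTop_iff_nat 1).2 ENNReal.tendsto_inv_nat_nhds_zero
    simpa using this
  obtain ⟨I, hI, hSI⟩ := exists_tendsto_integral hW k hH S hS
  exact ⟨I, hH, hI, S, hS1, hS, hSI⟩

/-- If the elementary integrals of an approximating sequence converge almost surely, the limit is
the square-integrable Itô integral. -/
theorem isL2Ito_of_tendsto_ae [IsProbabilityMeasure μ] (hW : IsBrownianFamily 𝓕 μ W) (k : Fin m)
    {H : ℝ≥0 → Ω → ℝ}
    (hH : MemLp (fun p : ℝ≥0 × Ω => H p.1 p.2) 2 (timeMeasure.prod μ))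
    (S : ℕ → SimpleIntegrand 𝓕) (hSτ : ∀ n, (S n).After τ)
    (hS : Tendsto (fun n => eLpNorm ((fun p : ℝ≥0 × Ω => (S n).value p.1 p.2) -
      fun p => H p.1 p.2) 2 (timeMeasure.prod μ)) atTop (𝓝 0)) {I : Ω → ℝ}
    (hI : ∀ᵐ ω ∂μ, Tendsto (fun n => (S n).integral (W k) ω) atTop (𝓝 (I ω))) :
    IsL2Ito 𝓕 μ τ (W k) H I := by
  obtain ⟨J, hJ, hSJ⟩ := exists_tendsto_integral hW k hH S hS
  have hm : ∀ n, AEStronglyMeasurable ((S n).integral (W k)) μ :=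
    fun n => ((S n).memLp_integral hW k).aestronglyMeasurable
  have heq : J =ᵐ[μ] I := tendstoInMeasure_ae_unique
    (tendstoInMeasure_of_tendsto_eLpNorm two_ne_zero hm hJ.aestronglyMeasurable hSJ)
    (tendstoInMeasure_of_tendsto_ae hm hI)
  refine ⟨hH, hJ.ae_eq heq, S, hSτ, hS, ?_⟩
  refine hSJ.congr fun n => eLpNorm_congr_ae ?_
  filter_upwards [heq] with ω h
  simp [h]

theorem IsL2Ito.congr {k : Fin m} {H H' : ℝ≥0 → Ω → ℝ} {I I' : Ω → ℝ}
    (h : IsL2Ito 𝓕 μ τ (W k) H I)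
    (hH : ∀ᵐ p ∂(timeMeasure.prod μ), H p.1 p.2 = H' p.1 p.2) (hI : I =ᵐ[μ] I') :
    IsL2Ito 𝓕 μ τ (W k) H' I' := by
  obtain ⟨h1, h2, S, hS1, hS2, hS3⟩ := h
  refine ⟨h1.ae_eq hH, h2.ae_eq hI, S, hS1, hS2.congr fun n => eLpNorm_congr_ae ?_,
    hS3.congr fun n => eLpNorm_congr_ae ?_⟩
  · filter_upwards [hH] with p hp
    simp [hp]
  · filter_upwards [hI] with p hp
    simp [hp]

theorem tendsto_eLpNorm_linear_comb {α : Type*} {mα : MeasurableSpace α} {ν : Measure α}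
    {f g h : ℕ → α → ℝ} {F G : α → ℝ} (a c : ℝ)
    (hf : ∀ n, AEStronglyMeasurable (f n - F) ν) (hg : ∀ n, AEStronglyMeasurable (g n - G) ν)
    (hh : ∀ n x, h n x = a * f n x + c * g n x)
    (hfF : Tendsto (fun n => eLpNorm (f n - F) 2 ν) atTop (𝓝 0))
    (hgG : Tendsto (fun n => eLpNorm (g n - G) 2 ν) atTop (𝓝 0)) :
    Tendsto (fun n => eLpNorm (h n - fun x => a * F x + c * G x) 2 ν) atTop (𝓝 0) := by
  have h0 := (ENNReal.Tendsto.const_mul (a := ‖a‖ₑ) hfF (Or.inr (by simp))).add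
    (ENNReal.Tendsto.const_mul (a := ‖c‖ₑ) hgG (Or.inr (by simp)))
  simp only [mul_zero, add_zero] at h0
  refine tendsto_of_tendsto_of_tendsto_of_le_of_le tendsto_const_nhds h0
    (fun _ => zero_le) fun n => ?_
  have : (h n - fun x => a * F x + c * G x) = a • (f n - F) + c • (g n - G) := by
    ext x
    simp only [Pi.sub_apply, Pi.add_apply, Pi.smul_apply, smul_eq_mul, hh]
    ring
  rw [this]
  refine (eLpNorm_add_le ((hf n).const_smul a) ((hg n).const_smul c) one_le_two).trans ?_
  rw [eLpNorm_const_smul, eLpNorm_const_smul]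

theorem IsL2Ito.linear_comb [IsProbabilityMeasure μ] (hW : IsBrownianFamily 𝓕 μ W) {k : Fin m}
    {H H' : ℝ≥0 → Ω → ℝ}
    {I I' : Ω → ℝ} (h : IsL2Ito 𝓕 μ τ (W k) H I) (h' : IsL2Ito 𝓕 μ τ (W k) H' I') (a c : ℝ) :
    IsL2Ito 𝓕 μ τ (W k) (fun s ω => a * H s ω + c * H' s ω) fun ω => a * I ω + c * I' ω := by
  obtain ⟨h1, h2, S, hS1, hS2, hS3⟩ := h
  obtain ⟨h1', h2', S', hS1', hS2', hS3'⟩ := h'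
  choose R hR hRτ using fun n => (S n).exists_linear_comb (S' n) a c
  refine ⟨(h1.const_mul a).add (h1'.const_mul c), (h2.const_mul a).add (h2'.const_mul c), R,
    fun n => hRτ n τ (hS1 n) (hS1' n), ?_, ?_⟩
  · refine tendsto_eLpNorm_linear_comb a c (fun n => ?_) (fun n => ?_) (fun n p => ?_) hS2 hS2'
    · exact ((S n).memLp_value.sub h1).aestronglyMeasurable
    · exact ((S' n).memLp_value.sub h1').aestronglyMeasurable
    · simp only [SimpleIntegrand.value_eq_integral, hR]
  · refine tendsto_eLpNorm_linear_comb a c (fun n => ?_) (fun n => ?_) (fun n ω => hR n _ ω)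
      hS3 hS3'
    · exact (((S n).memLp_integral hW k).sub h2).aestronglyMeasurable
    · exact (((S' n).memLp_integral hW k).sub h2').aestronglyMeasurable

theorem isL2Ito_zero (k : Fin m) : IsL2Ito 𝓕 μ τ (W k) (fun _ _ => 0) fun _ => 0 := by
  refine ⟨MemLp.zero', MemLp.zero', fun _ => ⟨0, fun _ => 0, monotone_const, fun _ _ => 0,
    fun _ => measurable_const, 0, by simp⟩, fun n i hi => absurd hi (Nat.not_lt_zero i), ?_, ?_⟩
  · refine tendsto_const_nhds.congr fun n => ?_
    rw [← eLpNorm_zero (p := 2) (μ := timeMeasure.prod μ) (α := ℝ≥0 × Ω) (ε := ℝ)]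
    congr 1
    ext p
    simp [SimpleIntegrand.value]
  · refine tendsto_const_nhds.congr fun n => ?_
    rw [← eLpNorm_zero (p := 2) (μ := μ) (ε := ℝ)]
    congr 1
    ext p
    simp [SimpleIntegrand.integral]

theorem IsL2Ito.sum [IsProbabilityMeasure μ] (hW : IsBrownianFamily 𝓕 μ W) {k : Fin m}
    {ι : Type*} (s : Finset ι)
    {H : ι → ℝ≥0 → Ω → ℝ} {I : ι → Ω → ℝ} (h : ∀ i ∈ s, IsL2Ito 𝓕 μ τ (W k) (H i) (I i)) :
    IsL2Ito 𝓕 μ τ (W k) (fun t ω => ∑ i ∈ s, H i t ω) fun ω => ∑ i ∈ s, I i ω := by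
  classical
  induction s using Finset.induction_on with
  | empty => simpa using isL2Ito_zero k
  | insert a s ha ih =>
    have := (h a (Finset.mem_insert_self a s)).linear_comb hW
      (ih fun i hi => h i (Finset.mem_insert_of_mem hi)) 1 1
    simpa only [Finset.sum_insert ha, one_mul] using this

theorem tendsto_eLpNorm_mul {α : Type*} {mα : MeasurableSpace α} {ν : Measure α}
    {f h : ℕ → α → ℝ} {F φ : α → ℝ} {C : ℝ} (hφ : ∀ x, |φ x| ≤ C)
    (hh : ∀ n x, h n x = φ x * f n x)
    (hfF : Tendsto (fun n => eLpNorm (f n - F) 2 ν) atTop (𝓝 0)) :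
    Tendsto (fun n => eLpNorm (h n - fun x => φ x * F x) 2 ν) atTop (𝓝 0) := by
  have h0 := ENNReal.Tendsto.const_mul (a := ENNReal.ofReal C) hfF (Or.inr (by simp))
  simp only [mul_zero] at h0
  refine tendsto_of_tendsto_of_tendsto_of_le_of_le tendsto_const_nhds h0
    (fun _ => zero_le) fun n => ?_
  refine eLpNorm_le_mul_eLpNorm_of_ae_le_mul (Eventually.of_forall fun x => ?_) 2
  simp only [Pi.sub_apply, hh, ← mul_sub, norm_mul]
  exact mul_le_mul_of_nonneg_right (hφ x) (norm_nonneg _)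

/-- Square-integrable Itô integrals after the stopping time `τ` commute with the multiplication by
bounded `𝓕_τ`-measurable random variables. -/
theorem IsL2Ito.mul (hτ : IsStoppingTime 𝓕 (fun ω => (τ ω : WithTop ℝ≥0))) {k : Fin m}
    {H : ℝ≥0 → Ω → ℝ} {I : Ω → ℝ} (h : IsL2Ito 𝓕 μ τ (W k) H I) {φ : Ω → ℝ}
    (hφ : Measurable[hτ.measurableSpace] φ) {C : ℝ} (hφC : ∀ ω, |φ ω| ≤ C) :
    IsL2Ito 𝓕 μ τ (W k) (fun s ω => φ ω * H s ω) fun ω => φ ω * I ω := by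
  obtain ⟨h1, h2, S, hS1, hS2, hS3⟩ := h
  have hφm : Measurable φ := hφ.mono hτ.measurableSpace_le le_rfl
  choose R hR hRτ using fun n => (S n).exists_mul hτ (hS1 n) hφ hφC
  refine ⟨?_, ?_, R, hRτ, ?_, ?_⟩
  · have hb : MemLp (fun p : ℝ≥0 × Ω => φ p.2) ∞ (timeMeasure.prod μ) :=
      memLp_top_of_bound (hφm.comp measurable_snd).aestronglyMeasurable C
        (Eventually.of_forall fun p => hφC p.2)
    exact h1.mul hb
  · have hb : MemLp φ ∞ μ :=
      memLp_top_of_bound hφm.aestronglyMeasurable C (Eventually.of_forall hφC)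
    exact h2.mul hb
  · refine tendsto_eLpNorm_mul (φ := fun p : ℝ≥0 × Ω => φ p.2) (fun p => hφC p.2) (fun n p => ?_)
      hS2
    simp only [SimpleIntegrand.value_eq_integral, hR]
  · exact tendsto_eLpNorm_mul hφC (fun n ω => hR n _ ω) hS3

/-- The Itô isometry for square-integrable integrals, and orthogonality with respect to different
Brownian motions. -/
theorem IsL2Ito.integral_mul [IsProbabilityMeasure μ] (hW : IsBrownianFamily 𝓕 μ W) {k l : Fin m}
    {τ' : Ω → ℝ≥0}
    {H H' : ℝ≥0 → Ω → ℝ} {I I' : Ω → ℝ} (h : IsL2Ito 𝓕 μ τ (W k) H I)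
    (h' : IsL2Ito 𝓕 μ τ' (W l) H' I') :
    ∫ ω, I ω * I' ω ∂μ =
      if k = l then ∫ p, H p.1 p.2 * H' p.1 p.2 ∂(timeMeasure.prod μ) else 0 := by
  obtain ⟨h1, h2, S, -, hS2, hS3⟩ := h
  obtain ⟨h1', h2', S', -, hS2', hS3'⟩ := h'
  have t1 := tendsto_integral_mul_of_tendsto_eLpNorm (fun n => (S n).memLp_integral hW k)
    (fun n => (S' n).memLp_integral hW l) h2 h2' hS3 hS3'
  have t2 := tendsto_integral_mul_of_tendsto_eLpNorm (fun n => (S n).memLp_value)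
    (fun n => (S' n).memLp_value) h1 h1' hS2 hS2'
  refine tendsto_nhds_unique t1 ?_
  simp only [SimpleIntegrand.integral_mul_integral _ _ hW]
  split_ifs
  · exact t2
  · exact tendsto_const_nhds

theorem IsL2Ito.integral_eq_zero [IsProbabilityMeasure μ] (hW : IsBrownianFamily 𝓕 μ W) {k : Fin m}
    {H : ℝ≥0 → Ω → ℝ} {I : Ω → ℝ} (h : IsL2Ito 𝓕 μ τ (W k) H I) : ∫ ω, I ω ∂μ = 0 := by
  obtain ⟨-, h2, S, -, -, hS3⟩ := h
  have t1 := tendsto_integral_mul_of_tendsto_eLpNorm (fun n => (S n).memLp_integral hW k)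
    (fun _ => memLp_const (1 : ℝ)) h2 (memLp_const (1 : ℝ)) hS3 (by simp)
  simp only [mul_one, SimpleIntegrand.integral_integral _ hW] at t1
  exact tendsto_nhds_unique t1 tendsto_const_nhds

end L2

/-! ### Discretization on uniform grids -/

section Grid

variable {Ω : Type*} {mΩ : MeasurableSpace Ω} {μ : Measure Ω}
  {𝓕 : Filtration ℝ≥0 mΩ} {m : ℕ} {W : Fin m → ℝ≥0 → Ω → ℝ}

/-- Dominated convergence in `L²`. -/
theorem tendsto_eLpNorm_two_of_dominated {α : Type*} {mα : MeasurableSpace α} {ν : Measure α}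
    {f : ℕ → α → ℝ} {F g : α → ℝ} (hf : ∀ n, AEStronglyMeasurable (f n) ν) (hg : MemLp g 2 ν)
    (hfg : ∀ n, ∀ᵐ x ∂ν, |f n x| ≤ g x)
    (hlim : ∀ᵐ x ∂ν, Tendsto (fun n => f n x) atTop (𝓝 (F x))) :
    MemLp F 2 ν ∧ Tendsto (fun n => eLpNorm (f n - F) 2 ν) atTop (𝓝 0) := by
  have hFg : ∀ᵐ x ∂ν, |F x| ≤ g x := by
    filter_upwards [hlim, ae_all_iff.2 hfg] with x h1 h2
    exact le_of_tendsto h1.abs (Eventually.of_forall h2)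
  have hFm : AEStronglyMeasurable F ν := aestronglyMeasurable_of_tendsto_ae _ hf hlim
  have hF : MemLp F 2 ν := hg.mono' hFm hFg
  have hfL : ∀ n, MemLp (f n) 2 ν := fun n => hg.mono' (hf n) (hfg n)
  refine ⟨hF, ?_⟩
  have hint : Tendsto (fun n => ∫ x, (f n x - F x) ^ 2 ∂ν) atTop (𝓝 (∫ _, (0 : ℝ) ∂ν)) := by
    refine tendsto_integral_of_dominated_convergence (fun x => 4 * g x ^ 2)
      (fun n => ((hf n).sub hFm).pow 2) (hg.integrable_sq.const_mul 4) (fun n => ?_) ?_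
    · filter_upwards [hfg n, hFg] with x h1 h2
      rw [Real.norm_eq_abs, abs_of_nonneg (sq_nonneg _)]
      have := abs_le.1 h1
      have := abs_le.1 h2
      nlinarith [sq_nonneg (f n x + F x)]
    · filter_upwards [hlim] with x hx
      have := (hx.sub_const (F x)).pow 2
      simpa using this
  rw [integral_zero] at hint
  have h2 := ENNReal.tendsto_ofReal (hint.rpow_const (p := (2 : ℝ)⁻¹) (Or.inr (by norm_num)))
  rw [Real.zero_rpow (by norm_num), ENNReal.ofReal_zero] at h2
  refine h2.congr fun n => ?_
  rw [((hfL n).sub hF).eLpNorm_eq_integral_rpow_norm (by norm_num) (by norm_num)]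
  simp [sq_abs]

/-- The simple integrand that freezes the bounded adapted process `G` at the left end points of the
intervals of length `1 / (n + 1)` in `[0, K]`. -/
noncomputable def gridIntegrand (G : ℝ≥0 → Ω → ℝ) (hG : ∀ s, Measurable[𝓕 s] (G s))
    (hb : ∃ C : ℝ, ∀ s ω, |G s ω| ≤ C) (K n : ℕ) : SimpleIntegrand 𝓕 where
  n := K * (n + 1)
  t i := (i : ℝ≥0) / (n + 1)
  mono i j hij := by
    have : (i : ℝ≥0) ≤ j := by exact_mod_cast hij
    exact div_le_div_of_nonneg_right this zero_le
  ξ i := G ((i : ℝ≥0) / (n + 1))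
  measurable_ξ i := hG _
  bounded_ξ := hb.imp fun _ hC _ ω => hC _ ω

theorem mem_Ioc_grid_iff (n i : ℕ) (s : ℝ≥0) :
    s ∈ Ioc ((i : ℝ≥0) / (n + 1)) (((i + 1 : ℕ) : ℝ≥0) / (n + 1)) ↔
      ⌈s * (n + 1)⌉₊ = i + 1 := by
  have hn : (0 : ℝ≥0) < (n : ℝ≥0) + 1 := by positivity
  rw [mem_Ioc, div_lt_iff₀ hn, le_div_iff₀ hn, Nat.ceil_eq_iff (Nat.succ_ne_zero i),
    Nat.succ_sub_one]

theorem gridIntegrand_value {G : ℝ≥0 → Ω → ℝ} {hG : ∀ s, Measurable[𝓕 s] (G s)}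
    {hb : ∃ C : ℝ, ∀ s ω, |G s ω| ≤ C} {K : ℕ} {s : ℝ≥0} (hs : 0 < s) (hsK : s ≤ K) (n : ℕ)
    (ω : Ω) : (gridIntegrand G hG hb K n).value s ω =
      G (((⌈s * (n + 1)⌉₊ - 1 : ℕ) : ℝ≥0) / (n + 1)) ω := by
  have hpos : 0 < ⌈s * (n + 1)⌉₊ := Nat.ceil_pos.2 (by positivity)
  have hle : ⌈s * (n + 1)⌉₊ ≤ K * (n + 1) := by
    rw [Nat.ceil_le]
    push_cast
    gcongr
  unfold SimpleIntegrand.value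
  rw [Finset.sum_eq_single (⌈s * (n + 1)⌉₊ - 1)]
  · simp only [gridIntegrand]
    rw [indicator_of_mem]
    rw [mem_Ioc_grid_iff]
    omega
  · intro i _ hi
    simp only [gridIntegrand]
    rw [indicator_of_notMem]
    rw [mem_Ioc_grid_iff]
    omega
  · intro h
    refine absurd ?_ h
    simp only [gridIntegrand, Finset.mem_range]
    omega

theorem gridIntegrand_value_of_lt {G : ℝ≥0 → Ω → ℝ} {hG : ∀ s, Measurable[𝓕 s] (G s)}
    {hb : ∃ C : ℝ, ∀ s ω, |G s ω| ≤ C} {K : ℕ} {s : ℝ≥0} (hsK : K < s) (n : ℕ)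
    (ω : Ω) : (gridIntegrand G hG hb K n).value s ω = 0 := by
  refine Finset.sum_eq_zero fun i hi => indicator_of_notMem ?_ _
  have hi' : i < K * (n + 1) := Finset.mem_range.1 hi
  simp only [gridIntegrand]
  rw [mem_Ioc_grid_iff]
  have : K * (n + 1) < ⌈s * (n + 1)⌉₊ := by
    rw [Nat.lt_ceil]
    push_cast
    gcongr
  omega

theorem tendsto_div_nat_add_one {a : ℕ → ℕ} {s : ℝ≥0}
    (h1 : ∀ n : ℕ, s * ((n : ℝ≥0) + 1) ≤ (a n : ℝ≥0) + 1)
    (h2 : ∀ n : ℕ, (a n : ℝ≥0) ≤ s * ((n : ℝ≥0) + 1) + 1) :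
    Tendsto (fun n : ℕ => (a n : ℝ≥0) / (n + 1)) atTop (𝓝 s) := by
  rw [← NNReal.tendsto_coe]
  have hinv : Tendsto (fun n : ℕ => 1 / ((n : ℝ) + 1)) atTop (𝓝 0) :=
    tendsto_one_div_add_atTop_nhds_zero_nat
  have l1 : Tendsto (fun n : ℕ => (s : ℝ) - 1 / ((n : ℝ) + 1)) atTop (𝓝 s) := by
    simpa using hinv.const_sub (s : ℝ)
  have l2 : Tendsto (fun n : ℕ => (s : ℝ) + 1 / ((n : ℝ) + 1)) atTop (𝓝 s) := by
    simpa using hinv.const_add (s : ℝ)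
  refine tendsto_of_tendsto_of_tendsto_of_le_of_le l1 l2 (fun n => ?_) fun n => ?_
  · have hn : (0 : ℝ) < (n : ℝ) + 1 := by positivity
    have : (s : ℝ) * ((n : ℝ) + 1) ≤ a n + 1 := by exact_mod_cast h1 n
    push_cast
    rw [sub_le_iff_le_add, ← add_div, le_div_iff₀ hn]
    exact this
  · have hn : (0 : ℝ) < (n : ℝ) + 1 := by positivity
    have : (a n : ℝ) ≤ s * ((n : ℝ) + 1) + 1 := by exact_mod_cast h2 n
    push_cast
    rw [div_le_iff₀ hn, add_mul, one_div_mul_cancel hn.ne']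
    exact this

/-- The least point of the grid of mesh `1 / (n + 1)` above `x`. -/
noncomputable def gridCeil (n : ℕ) (x : ℝ≥0) : ℝ≥0 := (⌈x * (n + 1)⌉₊ : ℝ≥0) / (n + 1)

/-- The greatest point of the grid of mesh `1 / (n + 1)` below `x`. -/
noncomputable def gridFloor (n : ℕ) (x : ℝ≥0) : ℝ≥0 := (⌊x * (n + 1)⌋₊ : ℝ≥0) / (n + 1)

theorem tendsto_gridCeil (x : ℝ≥0) : Tendsto (fun n => gridCeil n x) atTop (𝓝 x) :=
  tendsto_div_nat_add_one (fun _ => (Nat.le_ceil _).trans (le_add_of_nonneg_right zero_le))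
    fun _ => (Nat.ceil_lt_add_one zero_le).le

theorem tendsto_gridFloor (x : ℝ≥0) : Tendsto (fun n => gridFloor n x) atTop (𝓝 x) :=
  tendsto_div_nat_add_one (fun _ => (Nat.lt_floor_add_one _).le)
    fun _ => (Nat.floor_le zero_le).trans (le_add_of_nonneg_right zero_le)

theorem gridFloor_le (n : ℕ) (x : ℝ≥0) : gridFloor n x ≤ x := by
  have hn : (0 : ℝ≥0) < (n : ℝ≥0) + 1 := by positivity
  rw [gridFloor, div_le_iff₀ hn]
  exact Nat.floor_le zero_le

theorem gridCeil_le (n : ℕ) (x : ℝ≥0) : gridCeil n x ≤ x + 1 := by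
  have hn : (0 : ℝ≥0) < (n : ℝ≥0) + 1 := by positivity
  rw [gridCeil, div_le_iff₀ hn, add_mul, one_mul]
  refine (Nat.ceil_lt_add_one zero_le).le.trans (add_le_add le_rfl ?_)
  exact le_add_of_nonneg_left zero_le

theorem measurable_gridCeil (n : ℕ) : Measurable (gridCeil n) := by
  unfold gridCeil
  exact ((measurable_from_nat (f := fun j : ℕ => (j : ℝ≥0))).comp
    (Nat.measurable_ceil.comp (measurable_id.mul_const ((n : ℝ≥0) + 1)))).div_const _

theorem tendsto_gridIntegrand_value {G : ℝ≥0 → Ω → ℝ} {hG : ∀ s, Measurable[𝓕 s] (G s)}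
    {hb : ∃ C : ℝ, ∀ s ω, |G s ω| ≤ C} {K : ℕ} {s : ℝ≥0} (hs : 0 < s) (hsK : s ≤ K) {ω : Ω}
    (hc : ContinuousAt (fun s => G s ω) s) :
    Tendsto (fun n => (gridIntegrand G hG hb K n).value s ω) atTop (𝓝 (G s ω)) := by
  simp only [gridIntegrand_value hs hsK]
  refine hc.tendsto.comp (tendsto_div_nat_add_one (fun n => ?_) fun n => ?_)
  · have hpos : 0 < ⌈s * (n + 1)⌉₊ := Nat.ceil_pos.2 (by positivity)
    refine (Nat.le_ceil _).trans ?_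
    exact_mod_cast (by omega : ⌈s * (n + 1)⌉₊ ≤ ⌈s * (n + 1)⌉₊ - 1 + 1)
  · refine le_trans ?_ (Nat.ceil_lt_add_one zero_le).le
    exact_mod_cast Nat.sub_le _ _

/-- The discretizations of a bounded adapted process `G` converge to it in `L²` on `[0, K]` if
almost all of its paths are continuous at almost all times. -/
theorem tendsto_eLpNorm_gridIntegrand [IsProbabilityMeasure μ] {G : ℝ≥0 → Ω → ℝ}
    (hG : ∀ s, Measurable[𝓕 s] (G s))
    (hb : ∃ C : ℝ, ∀ s ω, |G s ω| ≤ C) (K : ℕ) {H : ℝ≥0 → Ω → ℝ}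
    (hH : ∀ᵐ p ∂(timeMeasure.prod μ),
      (p.1 ≤ (K : ℝ≥0) → ContinuousAt (fun s => G s p.2) p.1 ∧ G p.1 p.2 = H p.1 p.2) ∧
      ((K : ℝ≥0) < p.1 → H p.1 p.2 = 0)) :
    MemLp (fun p : ℝ≥0 × Ω => H p.1 p.2) 2 (timeMeasure.prod μ) ∧
    Tendsto (fun n => eLpNorm ((fun p : ℝ≥0 × Ω => (gridIntegrand G hG hb K n).value p.1 p.2) -
      fun p => H p.1 p.2) 2 (timeMeasure.prod μ)) atTop (𝓝 0) := by
  obtain ⟨C, hC⟩ := id hb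
  have hpos : ∀ᵐ p ∂(timeMeasure.prod μ), p.1 ≠ 0 :=
    Measure.quasiMeasurePreserving_fst.ae (p := fun s => s ≠ 0) (Measure.ae_ne timeMeasure 0)
  have hms : MeasurableSet (Ioc 0 (K : ℝ≥0) ×ˢ (univ : Set Ω)) :=
    measurableSet_Ioc.prod MeasurableSet.univ
  refine tendsto_eLpNorm_two_of_dominated
    (g := (Ioc 0 (K : ℝ≥0) ×ˢ (univ : Set Ω)).indicator fun _ => C)
    (fun n => (gridIntegrand G hG hb K n).memLp_value.aestronglyMeasurable) ?_ (fun n => ?_) ?_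
  · refine memLp_indicator_const 2 hms C (Or.inr ?_)
    rw [Measure.prod_prod, timeMeasure_Ioc]
    simp
  · filter_upwards [hpos] with p hp
    rcases le_or_gt p.1 (K : ℝ≥0) with h | h
    · rw [indicator_of_mem, gridIntegrand_value (pos_iff_ne_zero.2 hp) h]
      · exact hC _ _
      · exact ⟨⟨pos_iff_ne_zero.2 hp, h⟩, trivial⟩
    · rw [indicator_of_notMem, gridIntegrand_value_of_lt h, abs_zero]
      rintro ⟨⟨_, h'⟩, _⟩
      exact absurd h' (not_le.2 h)
  · filter_upwards [hpos, hH] with p hp hpH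
    rcases le_or_gt p.1 (K : ℝ≥0) with h | h
    · rw [← (hpH.1 h).2]
      exact tendsto_gridIntegrand_value (pos_iff_ne_zero.2 hp) h (hpH.1 h).1
    · rw [hpH.2 h]
      simp only [gridIntegrand_value_of_lt h]
      exact tendsto_const_nhds

/-- A sum of increments over the grid intervals whose left end points lie in `[a, c)` telescopes. -/
theorem sum_grid_increments (w : ℝ≥0 → ℝ) {a c : ℝ≥0} (hac : a ≤ c) {K : ℕ} (hc : c ≤ K) (n : ℕ) :
    ∑ i ∈ Finset.range (K * (n + 1)),
      (if a ≤ (i : ℝ≥0) / (n + 1) ∧ (i : ℝ≥0) / (n + 1) < c then 1 else 0) *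
        (w (((i + 1 : ℕ) : ℝ≥0) / (n + 1)) - w ((i : ℝ≥0) / (n + 1))) =
      w (gridCeil n c) - w (gridCeil n a) := by
  have hn : (0 : ℝ≥0) < (n : ℝ≥0) + 1 := by positivity
  have hle : ⌈a * (n + 1)⌉₊ ≤ ⌈c * (n + 1)⌉₊ := Nat.ceil_mono (by gcongr)
  have hleK : ⌈c * (n + 1)⌉₊ ≤ K * (n + 1) := by
    rw [Nat.ceil_le]
    push_cast
    gcongr
  have hiff : ∀ i : ℕ, (a ≤ (i : ℝ≥0) / (n + 1) ∧ (i : ℝ≥0) / (n + 1) < c) ↔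
      i ∈ Finset.Ico ⌈a * (n + 1)⌉₊ ⌈c * (n + 1)⌉₊ := fun i => by
    rw [Finset.mem_Ico, Nat.ceil_le, Nat.lt_ceil, le_div_iff₀ hn, div_lt_iff₀ hn]
  simp only [hiff, ite_mul, one_mul, zero_mul]
  rw [← Finset.sum_filter]
  have : (Finset.range (K * (n + 1))).filter
      (fun i => i ∈ Finset.Ico ⌈a * (n + 1)⌉₊ ⌈c * (n + 1)⌉₊) =
      Finset.Ico ⌈a * (n + 1)⌉₊ ⌈c * (n + 1)⌉₊ := by
    ext i
    simp only [Finset.mem_filter, Finset.mem_range, Finset.mem_Ico]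
    omega
  rw [this, Finset.sum_Ico_sub (fun i : ℕ => w ((i : ℝ≥0) / (n + 1))) hle]
  rfl

end Grid

/-! ### Itô integrals of deterministic functions of the elapsed time -/

section Pairs

variable {Ω : Type*} {mΩ : MeasurableSpace Ω} {μ : Measure Ω}
  {𝓕 : Filtration ℝ≥0 mΩ} {m : ℕ} {W : Fin m → ℝ≥0 → Ω → ℝ} {τ Δ : Ω → ℝ≥0}

theorem measurable_stopping_self (hτ : IsStoppingTime 𝓕 (fun ω => (τ ω : WithTop ℝ≥0))) :
    Measurable[hτ.measurableSpace] τ := by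
  refine measurable_of_Iic (mδ := hτ.measurableSpace) fun i => ?_
  have := hτ.measurableSet_le' i
  simp only [WithTop.coe_le_coe] at this
  exact this

theorem measurableSet_lt_add {Ω : Type*} {_ : MeasurableSpace Ω} {τ Δ : Ω → ℝ≥0}
    (hτ : Measurable τ) (hΔ : Measurable Δ) (s : ℝ≥0) : MeasurableSet {ω | s < τ ω + Δ ω} :=
  measurableSet_lt measurable_const (hτ.add hΔ)

theorem ae_prod_of_ae [SFinite μ] {P : Ω → Prop} (h : ∀ᵐ ω ∂μ, P ω) :
    ∀ᵐ p ∂(timeMeasure.prod μ), P p.2 :=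
  Measure.quasiMeasurePreserving_snd.ae (p := P) h

theorem ae_prod_ne [SFinite μ] {τ : Ω → ℝ≥0} (hτ : Measurable τ) :
    ∀ᵐ p ∂(timeMeasure.prod μ), p.1 ≠ τ p.2 := by
  have hms : MeasurableSet {p : ℝ≥0 × Ω | p.1 = τ p.2} :=
    measurableSet_eq_fun measurable_fst (hτ.comp measurable_snd)
  have : (timeMeasure.prod μ) {p : ℝ≥0 × Ω | p.1 = τ p.2} = 0 := by
    rw [Measure.prod_apply_symm hms]
    simp
  exact measure_eq_zero_iff_ae_notMem.1 this

/-- A random variable known at time `τ`, restricted to `{τ ≤ s < τ + Δ}`, is known at time `s`. -/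
theorem measurable_ite_interval (hτ : IsStoppingTime 𝓕 (fun ω => (τ ω : WithTop ℝ≥0)))
    (hΔ : Measurable[hτ.measurableSpace] Δ) {f : Ω → ℝ} (hf : Measurable[hτ.measurableSpace] f)
    (s : ℝ≥0) :
    Measurable[𝓕 s] fun ω => if τ ω ≤ s ∧ s < τ ω + Δ ω then f ω else 0 := by
  have hs : MeasurableSet[hτ.measurableSpace] {ω | s < τ ω + Δ ω} :=
    measurableSet_lt_add (measurable_stopping_self hτ) hΔ s
  have h1 : Measurable[hτ.measurableSpace] ({ω | s < τ ω + Δ ω}.indicator f) :=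
    hf.indicator hs
  convert measurable_ite_of_measurable_stopping hτ h1 s using 1
  ext ω
  by_cases h1 : τ ω ≤ s <;> by_cases h2 : s < τ ω + Δ ω <;> simp [indicator, h1, h2]

/-- If `g` is continuous, the restriction of `g` to a half-open interval is continuous off the end
points. -/
theorem continuousAt_ite_interval {g : ℝ≥0 → ℝ} (hg : Continuous g) {a c s : ℝ≥0} (ha : s ≠ a)
    (hc : s ≠ c) : ContinuousAt (fun s => if a ≤ s ∧ s < c then g s else 0) s := by
  rcases lt_or_gt_of_ne ha with h | h
  · refine (continuousAt_const (y := (0 : ℝ))).congr ?_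
    filter_upwards [Iio_mem_nhds h] with x hx
    rw [if_neg fun h' => absurd hx (not_lt.2 h'.1)]
  · rcases lt_or_gt_of_ne hc with h' | h'
    · refine hg.continuousAt.congr ?_
      filter_upwards [Ioo_mem_nhds h h'] with x hx
      rw [if_pos ⟨hx.1.le, hx.2⟩]
    · refine (continuousAt_const (y := (0 : ℝ))).congr ?_
      filter_upwards [Ioi_mem_nhds h'] with x hx
      rw [if_neg fun h'' => absurd hx (not_lt.2 h''.2.le)]

theorem ite_interval_eq_indicator {g : ℝ≥0 → ℝ} {a c s : ℝ≥0} (ha : s ≠ a) (hc : s ≠ c) :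
    (if a ≤ s ∧ s < c then g s else 0) = (Ioc a c).indicator g s := by
  by_cases h : s ∈ Ioc a c
  · rw [indicator_of_mem h, if_pos ⟨h.1.le, lt_of_le_of_ne h.2 hc⟩]
  · rw [indicator_of_notMem h, if_neg fun h' => h ⟨lt_of_le_of_ne h'.1 ha.symm, h'.2.le⟩]

/-- The discretizations of a bounded adapted process that is continuous on `[τ, τ + Δ)` and vanishes
elsewhere converge in `L²`. -/
theorem tendsto_eLpNorm_gridIntegrand_interval [IsProbabilityMeasure μ]
    (hτm : Measurable τ) (hΔm : Measurable Δ) {K : ℕ} (hK : ∀ ω, τ ω + Δ ω ≤ K)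
    {G g : ℝ≥0 → Ω → ℝ} (hG : ∀ s, Measurable[𝓕 s] (G s)) (hb : ∃ C : ℝ, ∀ s ω, |G s ω| ≤ C)
    (hg : ∀ᵐ ω ∂μ, Continuous fun s => g s ω)
    (hGg : ∀ᵐ ω ∂μ, ∀ s, G s ω = if τ ω ≤ s ∧ s < τ ω + Δ ω then g s ω else 0) :
    MemLp (fun p : ℝ≥0 × Ω => (Ioc (τ p.2) (τ p.2 + Δ p.2)).indicator (fun s => g s p.2) p.1) 2
      (timeMeasure.prod μ) ∧
    Tendsto (fun n => eLpNorm ((fun p : ℝ≥0 × Ω => (gridIntegrand G hG hb K n).value p.1 p.2) -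
      fun p => (Ioc (τ p.2) (τ p.2 + Δ p.2)).indicator (fun s => g s p.2) p.1) 2
        (timeMeasure.prod μ)) atTop (𝓝 0) := by
  refine tendsto_eLpNorm_gridIntegrand hG hb K
    (H := fun s ω => (Ioc (τ ω) (τ ω + Δ ω)).indicator (fun s => g s ω) s) ?_
  filter_upwards [ae_prod_of_ae hg, ae_prod_of_ae hGg, ae_prod_ne (μ := μ) hτm,
    ae_prod_ne (μ := μ) (hτm.add hΔm)] with p h1 h2 h3 h4
  refine ⟨fun _ => ⟨?_, ?_⟩, fun h => ?_⟩
  · simp only [h2]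
    exact continuousAt_ite_interval h1 h3 h4
  · rw [h2]
    exact ite_interval_eq_indicator (g := fun s => g s p.2) h3 h4
  · refine indicator_of_notMem ?_ _
    exact fun h' => absurd (h'.2.trans (hK p.2)) (not_le.2 h)

theorem gridIntegrand_after {G : ℝ≥0 → Ω → ℝ} {hG : ∀ s, Measurable[𝓕 s] (G s)}
    {hb : ∃ C : ℝ, ∀ s ω, |G s ω| ≤ C} {K n : ℕ} (h : ∀ s ω, G s ω ≠ 0 → τ ω ≤ s) :
    (gridIntegrand G hG hb K n).After τ :=
  fun _ _ ω hne => h _ ω hne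

/-- The increment of a Brownian motion over `[τ, τ + Δ]` is the Itô integral of `1`. The elementary
integrals of the discretizations telescope to the increment between grid points. -/
theorem isL2Ito_increment [IsProbabilityMeasure μ] (hW : IsBrownianFamily 𝓕 μ W)
    (hτ : IsStoppingTime 𝓕 (fun ω => (τ ω : WithTop ℝ≥0)))
    (hΔ : Measurable[hτ.measurableSpace] Δ) {K : ℕ} (hK : ∀ ω, τ ω + Δ ω ≤ K) (k : Fin m) :
    IsL2Ito 𝓕 μ τ (W k) (fun s ω => (Ioc (τ ω) (τ ω + Δ ω)).indicator (fun _ => 1) s)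
      fun ω => W k (τ ω + Δ ω) ω - W k (τ ω) ω := by
  have hτs := measurable_stopping_self hτ
  have hτm : Measurable τ := hτs.mono hτ.measurableSpace_le le_rfl
  have hΔm : Measurable Δ := hΔ.mono hτ.measurableSpace_le le_rfl
  let G : ℝ≥0 → Ω → ℝ := fun s ω => if τ ω ≤ s ∧ s < τ ω + Δ ω then 1 else 0
  have hGeq : ∀ s ω, G s ω = if τ ω ≤ s ∧ s < τ ω + Δ ω then 1 else 0 := fun _ _ => rfl
  have hG : ∀ s, Measurable[𝓕 s] (G s) := fun s =>
    measurable_ite_interval hτ hΔ measurable_const s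
  have hb : ∃ C : ℝ, ∀ s ω, |G s ω| ≤ C := ⟨1, fun s ω => by rw [hGeq]; split_ifs <;> simp⟩
  obtain ⟨h1, h2⟩ := tendsto_eLpNorm_gridIntegrand_interval (μ := μ) hτm hΔm hK hG hb
    (g := fun _ _ => 1) (Eventually.of_forall fun ω => continuous_const)
    (Eventually.of_forall fun ω s => hGeq s ω)
  refine isL2Ito_of_tendsto_ae hW k
    (H := fun s ω => (Ioc (τ ω) (τ ω + Δ ω)).indicator (fun _ => 1) s) h1
    (fun n => gridIntegrand G hG hb K n) (fun n => gridIntegrand_after fun s ω hne => ?_) h2 ?_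
  · by_contra hcon
    exact hne (by rw [hGeq, if_neg fun h => hcon h.1])
  · filter_upwards [hW.ae_continuous] with ω hω
    have : ∀ n, (gridIntegrand G hG hb K n).integral (W k) ω =
        W k (gridCeil n (τ ω + Δ ω)) ω - W k (gridCeil n (τ ω)) ω := fun n => by
      rw [← sum_grid_increments (fun t => W k t ω) le_self_add (hK ω) n]
      simp only [SimpleIntegrand.integral, gridIntegrand, hGeq]
    simp only [this]
    exact (((hω k).tendsto _).comp (tendsto_gridCeil _)).sub
      (((hω k).tendsto _).comp (tendsto_gridCeil _))

theorem intervalIntegral_ite_lt_add {a t D : ℝ≥0} :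
    ∫ r in (0 : ℝ)..D, (if a ≤ t ∧ t < a + r.toNNReal then (1 : ℝ) else 0) =
      if a ≤ t ∧ t < a + D then (a : ℝ) + D - t else 0 := by
  rw [intervalIntegral.integral_of_le (NNReal.coe_nonneg D)]
  by_cases h : a ≤ t
  · have hset : ∀ r ∈ Ioc (0 : ℝ) D, (if a ≤ t ∧ t < a + r.toNNReal then (1 : ℝ) else 0) =
        (Ioi ((t : ℝ) - a)).indicator (fun _ => 1) r := by
      intro r hr
      have : t < a + r.toNNReal ↔ (t : ℝ) - a < r := by
        rw [← NNReal.coe_lt_coe, NNReal.coe_add, Real.coe_toNNReal _ hr.1.le]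
        constructor <;> intro h <;> linarith
      simp only [h, true_and, this, indicator, mem_Ioi]
    have h0 : (0 : ℝ) ≤ (t : ℝ) - a := sub_nonneg.2 (by exact_mod_cast h)
    have hinter : Ioc (0 : ℝ) D ∩ Ioi ((t : ℝ) - a) = Ioc ((t : ℝ) - a) D := by
      ext r
      simp only [mem_inter_iff, mem_Ioc, mem_Ioi]
      constructor
      · rintro ⟨⟨_, h2⟩, h3⟩; exact ⟨h3, h2⟩
      · rintro ⟨h1, h2⟩; exact ⟨⟨h0.trans_lt h1, h2⟩, h1⟩
    rw [setIntegral_congr_fun measurableSet_Ioc hset, setIntegral_indicator measurableSet_Ioi,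
      hinter, setIntegral_const, Measure.real, Real.volume_Ioc]
    by_cases h2 : t < a + D
    · have h2' : (t : ℝ) < a + D := by exact_mod_cast h2
      rw [if_pos ⟨h, h2⟩, ENNReal.toReal_ofReal (by linarith)]
      simp
      ring
    · have h2' : (a : ℝ) + D ≤ t := by exact_mod_cast not_lt.1 h2
      rw [if_neg fun h' => h2 h'.2, ENNReal.ofReal_of_nonpos (by linarith)]
      simp
  · simp [h]

/-- The time integral of the increments of a Brownian motion over `[τ, τ + Δ]` is the Itô integral
of the remaining time. In the elementary integrals the coefficient `τ + Δ - t` is written as the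
integral over `r ∈ [0, Δ]` of `1_{t < τ + r}`, and the integral over `r` is interchanged with the
sum. -/
theorem isL2Ito_timeIntegral [IsProbabilityMeasure μ] (hW : IsBrownianFamily 𝓕 μ W)
    (hτ : IsStoppingTime 𝓕 (fun ω => (τ ω : WithTop ℝ≥0)))
    (hΔ : Measurable[hτ.measurableSpace] Δ) {K : ℕ} (hK : ∀ ω, τ ω + Δ ω ≤ K) (k : Fin m) :
    IsL2Ito 𝓕 μ τ (W k)
      (fun s ω => (Ioc (τ ω) (τ ω + Δ ω)).indicator (fun s => (τ ω : ℝ) + Δ ω - s) s)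
      fun ω => ∫ t in (τ ω : ℝ)..(τ ω + Δ ω : ℝ), (W k t.toNNReal ω - W k (τ ω) ω) := by
  have hτs := measurable_stopping_self hτ
  have hτm : Measurable τ := hτs.mono hτ.measurableSpace_le le_rfl
  have hΔm : Measurable Δ := hΔ.mono hτ.measurableSpace_le le_rfl
  let G : ℝ≥0 → Ω → ℝ := fun s ω =>
    if τ ω ≤ s ∧ s < τ ω + Δ ω then (τ ω : ℝ) + Δ ω - s else 0
  have hGeq : ∀ s ω, G s ω = if τ ω ≤ s ∧ s < τ ω + Δ ω then (τ ω : ℝ) + Δ ω - s else 0 :=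
    fun _ _ => rfl
  have hf : ∀ s : ℝ≥0, Measurable[hτ.measurableSpace] fun ω => (τ ω : ℝ) + Δ ω - s := fun s =>
    ((measurable_coe_nnreal_real.comp hτs).add (measurable_coe_nnreal_real.comp hΔ)).sub
      measurable_const
  have hG : ∀ s, Measurable[𝓕 s] (G s) := fun s => measurable_ite_interval hτ hΔ (hf s) s
  have hb : ∃ C : ℝ, ∀ s ω, |G s ω| ≤ C := ⟨K, fun s ω => by
    rw [hGeq]
    split_ifs with h
    · have h1 : (τ ω : ℝ) + Δ ω ≤ K := by exact_mod_cast hK ω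
      have h2 : (s : ℝ) < τ ω + Δ ω := by exact_mod_cast h.2
      rw [abs_of_nonneg (by linarith)]
      linarith [s.2]
    · simp⟩
  obtain ⟨h1, h2⟩ := tendsto_eLpNorm_gridIntegrand_interval (μ := μ) hτm hΔm hK hG hb
    (g := fun s ω => (τ ω : ℝ) + Δ ω - s)
    (Eventually.of_forall fun ω => by fun_prop)
    (Eventually.of_forall fun ω s => hGeq s ω)
  refine isL2Ito_of_tendsto_ae hW k
    (H := fun s ω => (Ioc (τ ω) (τ ω + Δ ω)).indicator (fun s => (τ ω : ℝ) + Δ ω - s) s) h1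
    (fun n => gridIntegrand G hG hb K n) (fun n => gridIntegrand_after fun s ω hne => ?_) h2 ?_
  · by_contra hcon
    exact hne (by rw [hGeq, if_neg fun h => hcon h.1])
  · filter_upwards [hW.ae_continuous] with ω hω
    set w : ℝ≥0 → ℝ := fun t => W k t ω with hw
    have hwc : Continuous w := hω k
    have hΔ0 : (0 : ℝ) ≤ Δ ω := (Δ ω).2
    have key : ∀ n, (gridIntegrand G hG hb K n).integral (W k) ω =
        ∫ r in (0 : ℝ)..Δ ω,
          (w (gridCeil n (τ ω + r.toNNReal)) - w (gridCeil n (τ ω))) := fun n => by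
      have hr : ∀ r ∈ uIcc (0 : ℝ) (Δ ω),
          w (gridCeil n (τ ω + r.toNNReal)) - w (gridCeil n (τ ω)) =
          ∑ i ∈ Finset.range (K * (n + 1)), (if τ ω ≤ (i : ℝ≥0) / (n + 1) ∧
            (i : ℝ≥0) / (n + 1) < τ ω + r.toNNReal then 1 else 0) *
            (w (((i + 1 : ℕ) : ℝ≥0) / (n + 1)) - w ((i : ℝ≥0) / (n + 1))) := by
        intro r hr
        rw [uIcc_of_le hΔ0] at hr
        rw [sum_grid_increments w le_self_add ((add_le_add le_rfl
          (Real.toNNReal_le_iff_le_coe.2 hr.2)).trans (hK ω)) n]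
      rw [intervalIntegral.integral_congr hr, intervalIntegral.integral_finsetSum]
      · refine Finset.sum_congr rfl fun i _ => ?_
        rw [intervalIntegral.integral_mul_const, intervalIntegral_ite_lt_add]
        simp only [gridIntegrand, hGeq, hw]
      · intro i _
        refine IntervalIntegrable.mul_const ?_ _
        rw [intervalIntegrable_iff]
        refine Measure.integrableOn_of_bounded (M := 1) (by simp) ?_
          (Eventually.of_forall fun r => ?_)
        · refine (Measurable.ite ?_ measurable_const measurable_const).aestronglyMeasurable
          exact (MeasurableSet.const _).inter
            (measurableSet_lt measurable_const (by fun_prop))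
        · split_ifs <;> simp
    -- the limit, with the integration variable shifted to the elapsed time
    have hlim : (∫ t in (τ ω : ℝ)..(τ ω + Δ ω : ℝ), (W k t.toNNReal ω - W k (τ ω) ω)) =
        ∫ r in (0 : ℝ)..Δ ω, (w (τ ω + r.toNNReal) - w (τ ω)) := by
      have := intervalIntegral.integral_comp_add_left (a := (0 : ℝ)) (b := Δ ω)
        (fun t : ℝ => W k t.toNNReal ω - W k (τ ω) ω) (τ ω : ℝ)
      rw [add_zero] at this
      rw [← this]
      refine intervalIntegral.integral_congr fun r hr => ?_
      rw [uIcc_of_le hΔ0] at hr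
      simp only [hw]
      rw [Real.toNNReal_add (NNReal.coe_nonneg _) hr.1, Real.toNNReal_coe]
    rw [hlim]
    simp only [key]
    obtain ⟨B, hB⟩ := (isCompact_Icc (a := (0 : ℝ≥0)) (b := K + 1)).exists_bound_of_continuousOn
      hwc.continuousOn
    have hB' : ∀ n x, x ≤ (K : ℝ≥0) → ‖w (gridCeil n x)‖ ≤ B := fun n x hx =>
      hB _ ⟨zero_le, (gridCeil_le n x).trans (by gcongr)⟩
    refine intervalIntegral.tendsto_integral_filter_of_dominated_convergence (fun _ => B + B)
      (Eventually.of_forall fun n => ?_)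
      (Eventually.of_forall fun n => Eventually.of_forall fun r hr => ?_)
      (by simp) (Eventually.of_forall fun r hr => ?_)
    · have : Measurable fun r : ℝ => w (gridCeil n (τ ω + r.toNNReal)) - w (gridCeil n (τ ω)) :=
        (hwc.measurable.comp ((measurable_gridCeil n).comp
          (measurable_const.add measurable_real_toNNReal))).sub_const _
      exact this.aestronglyMeasurable
    · rw [uIoc_of_le hΔ0] at hr
      refine (norm_sub_le _ _).trans (add_le_add (hB' n _ ?_) (hB' n _ ?_))
      · exact (add_le_add le_rfl (Real.toNNReal_le_iff_le_coe.2 hr.2)).trans (hK ω)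
      · exact le_self_add.trans (hK ω)
    · exact ((hwc.tendsto _).comp (tendsto_gridCeil _)).sub
        ((hwc.tendsto _).comp (tendsto_gridCeil _))

/-- The Itô integral of the elapsed time over `[τ, τ + Δ]`, by integration by parts. -/
theorem isL2Ito_elapsed [IsProbabilityMeasure μ] (hW : IsBrownianFamily 𝓕 μ W)
    (hτ : IsStoppingTime 𝓕 (fun ω => (τ ω : WithTop ℝ≥0)))
    (hΔ : Measurable[hτ.measurableSpace] Δ) {K : ℕ} (hK : ∀ ω, τ ω + Δ ω ≤ K) (k : Fin m) :
    IsL2Ito 𝓕 μ τ (W k)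
      (fun s ω => (Ioc (τ ω) (τ ω + Δ ω)).indicator (fun s => (s : ℝ) - τ ω) s)
      fun ω => Δ ω * (W k (τ ω + Δ ω) ω - W k (τ ω) ω) -
        ∫ t in (τ ω : ℝ)..(τ ω + Δ ω : ℝ), (W k t.toNNReal ω - W k (τ ω) ω) := by
  have h1 := (isL2Ito_increment hW hτ hΔ hK k).mul hτ (φ := fun ω => (Δ ω : ℝ)) (C := K)
    (measurable_coe_nnreal_real.comp hΔ) fun ω => by
      rw [NNReal.abs_eq]
      exact_mod_cast le_add_self.trans (hK ω)
  refine (h1.linear_comb hW (isL2Ito_timeIntegral hW hτ hΔ hK k) 1 (-1)).congr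
    (Eventually.of_forall fun p => ?_) (Eventually.of_forall fun ω => ?_)
  · by_cases h : p.1 ∈ Ioc (τ p.2) (τ p.2 + Δ p.2) <;> simp [h]
    ring
  · simp only
    ring

end Pairs

/-! ### The iterated Itô integrals -/

section Iterated

variable {Ω : Type*} {mΩ : MeasurableSpace Ω} {μ : Measure Ω}
  {𝓕 : Filtration ℝ≥0 mΩ} {m : ℕ} {W : Fin m → ℝ≥0 → Ω → ℝ} {τ Δ : Ω → ℝ≥0}

theorem integral_timeMeasure_Ioc {h : ℝ≥0 → ℝ} (hh : Measurable h) {a c : ℝ≥0} (hac : a ≤ c) :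
    ∫ s, (Ioc a c).indicator h s ∂timeMeasure = ∫ t in (a : ℝ)..c, h t.toNNReal := by
  rw [timeMeasure, integral_map measurable_real_toNNReal.aemeasurable
    (hh.indicator measurableSet_Ioc).aestronglyMeasurable,
    intervalIntegral.integral_of_le (NNReal.coe_le_coe.2 hac)]
  have heq : ∀ t : ℝ, (Ioc a c).indicator h t.toNNReal =
      (Ioc (a : ℝ) c).indicator (fun t => h t.toNNReal) t := by
    intro t
    have : t.toNNReal ∈ Ioc a c ↔ t ∈ Ioc (a : ℝ) c := by
      rw [mem_Ioc, mem_Ioc, Real.lt_toNNReal_iff_coe_lt, Real.toNNReal_le_iff_le_coe]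
    by_cases ht : t ∈ Ioc (a : ℝ) c
    · rw [indicator_of_mem ht, indicator_of_mem (this.2 ht)]
    · rw [indicator_of_notMem ht, indicator_of_notMem fun h => ht (this.1 h)]
  simp only [heq]
  rw [setIntegral_indicator measurableSet_Ioc]
  congr 2
  ext t
  simp only [mem_inter_iff, mem_Ioi, mem_Ioc]
  constructor
  · exact fun h => h.2
  · exact fun h => ⟨a.2.trans_lt h.1, h⟩

/-- Joint measurability of the paths, up to the null set where they are not continuous. -/
theorem aestronglyMeasurable_path [SFinite μ] (hW : IsBrownianFamily 𝓕 μ W) (k : Fin m) :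
    AEStronglyMeasurable (fun p : ℝ≥0 × Ω => W k p.1 p.2) (timeMeasure.prod μ) := by
  classical
  obtain ⟨N, hN, hNm, hN0⟩ := exists_measurable_superset_of_null (hW.brownian k).cont
  let u : ℝ≥0 → Ω → ℝ := fun t => Nᶜ.indicator (W k t)
  have hc : ∀ ω, Continuous fun t => u t ω := by
    intro ω
    by_cases h : ω ∈ N
    · simp only [u, indicator, mem_compl_iff, h, not_true_eq_false, if_false]
      exact continuous_const
    · have : Continuous fun t => W k t ω := by
        by_contra hcon
        exact h (hN hcon)
      simpa only [u, indicator, mem_compl_iff, h, not_false_eq_true, if_true] using this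
  have hm : Measurable (Function.uncurry u) :=
    measurable_uncurry_of_continuous_of_measurable hc
      fun t => (hW.measurable k t).indicator hNm.compl
  refine ⟨Function.uncurry u, hm.stronglyMeasurable, ?_⟩
  filter_upwards [ae_prod_of_ae (measure_eq_zero_iff_ae_notMem.1 hN0)] with p hp
  have : p.2 ∈ Nᶜ := hp
  simp [Function.uncurry, u, this]

/-- The value of `W k` at the last grid point before `τ` is `𝓕_τ`-measurable: on the event that this
point is `j / (n + 1)` it is known at a time before `τ`. -/
theorem measurable_gridFloor_eval (hW : IsBrownianFamily 𝓕 μ W)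
    (hτ : IsStoppingTime 𝓕 (fun ω => (τ ω : WithTop ℝ≥0))) (k : Fin m) (n : ℕ) :
    Measurable[hτ.measurableSpace] fun ω => W k (gridFloor n (τ ω)) ω := by
  have hτs := measurable_stopping_self hτ
  intro B hB
  have hfl : ∀ j : ℕ, MeasurableSet[hτ.measurableSpace] {ω | ⌊τ ω * (n + 1)⌋₊ = j} := fun j => by
    have : Measurable fun x : ℝ≥0 => ⌊x * (n + 1)⌋₊ :=
      Nat.measurable_floor.comp (measurable_id.mul_const _)
    exact (this.comp hτs) (measurableSet_singleton j)
  have hunion : (fun ω => W k (gridFloor n (τ ω)) ω) ⁻¹' B =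
      ⋃ j : ℕ, {ω | ⌊τ ω * (n + 1)⌋₊ = j} ∩ W k ((j : ℝ≥0) / (n + 1)) ⁻¹' B := by
    ext ω
    simp [gridFloor]
  rw [hunion]
  refine @MeasurableSet.iUnion _ _ hτ.measurableSpace _ _ fun j => ?_
  rw [hτ.measurableSet]
  refine ⟨?_, fun i => ?_⟩
  · exact (hfl j).1.inter
      (le_iSup (fun t => (𝓕 t : MeasurableSpace Ω)) _ _ (hW.adapted k _ hB))
  · by_cases hji : (j : ℝ≥0) / (n + 1) ≤ i
    · have h1 := (hfl j).2 i
      have h2 := 𝓕.mono hji _ (hW.adapted k _ hB)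
      rw [inter_right_comm]
      exact h1.inter h2
    · convert @MeasurableSet.empty _ (𝓕 i) using 1
      refine eq_empty_of_forall_notMem fun ω hω => hji ?_
      have h1 : ⌊τ ω * (n + 1)⌋₊ = j := hω.1.1
      have h2 : τ ω ≤ i := by
        have : (τ ω : WithTop ℝ≥0) ≤ i := hω.2
        exact_mod_cast this
      rw [← h1]
      exact (gridFloor_le n (τ ω)).trans h2

/-- The value of a Brownian motion at the stopping time `τ` has an `𝓕_τ`-measurable version. The
paths are only almost surely continuous and `𝓕` is not complete, so a version is needed. -/
theorem exists_measurable_stopped (hW : IsBrownianFamily 𝓕 μ W)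
    (hτ : IsStoppingTime 𝓕 (fun ω => (τ ω : WithTop ℝ≥0))) (k : Fin m) :
    ∃ V : Ω → ℝ, Measurable[hτ.measurableSpace] V ∧ ∀ᵐ ω ∂μ, W k (τ ω) ω = V ω := by
  refine ⟨fun ω => limsup (fun n => W k (gridFloor n (τ ω)) ω) atTop,
    Measurable.limsup fun n => measurable_gridFloor_eval hW hτ k n, ?_⟩
  filter_upwards [hW.ae_continuous] with ω hω
  exact (((hω k).tendsto _).comp (tendsto_gridFloor (τ ω))).limsup_eq.symm

/-- The increment between the stopping time and a later deterministic time `s` is an increment over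
a step of the `𝓕_τ`-measurable size `s - τ`. The factor `φ` keeps to the event `{τ ≤ s}`; the
subtraction is truncated off it. -/
theorem isL2Ito_increment_to [IsProbabilityMeasure μ] (hW : IsBrownianFamily 𝓕 μ W)
    (hτ : IsStoppingTime 𝓕 (fun ω => (τ ω : WithTop ℝ≥0))) {K : ℕ} (hK : ∀ ω, τ ω ≤ K) (k : Fin m)
    (s : ℝ≥0) {φ : Ω → ℝ} (hφ : Measurable[hτ.measurableSpace] φ) {C : ℝ} (hφC : ∀ ω, |φ ω| ≤ C)
    (hφs : ∀ ω, φ ω ≠ 0 → τ ω ≤ s) :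
    IsL2Ito 𝓕 μ τ (W k) (fun t ω => φ ω * (Ioc (τ ω) s).indicator (fun _ => 1) t)
      fun ω => φ ω * (W k s ω - W k (τ ω) ω) := by
  obtain ⟨n, hn⟩ := exists_nat_ge s
  have hτs := measurable_stopping_self hτ
  have hm : Measurable[hτ.measurableSpace] fun ω => s - τ ω := measurable_const.sub hτs
  have h := (isL2Ito_increment hW hτ hm (K := K + n) (fun ω => by
    push_cast
    exact add_le_add (hK ω) (tsub_le_self.trans hn)) k).mul hτ hφ hφC
  refine h.congr (Eventually.of_forall fun p => ?_) (Eventually.of_forall fun ω => ?_)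
  · by_cases h0 : φ p.2 = 0
    · simp [h0]
    · simp only [add_tsub_cancel_of_le (hφs _ h0)]
  · by_cases h0 : φ ω = 0
    · simp [h0]
    · simp only [add_tsub_cancel_of_le (hφs _ h0)]

theorem integral_mul_increment_to [IsProbabilityMeasure μ] (hW : IsBrownianFamily 𝓕 μ W)
    (hτ : IsStoppingTime 𝓕 (fun ω => (τ ω : WithTop ℝ≥0))) {K : ℕ} (hK : ∀ ω, τ ω ≤ K) (k : Fin m)
    (s : ℝ≥0) {φ : Ω → ℝ} (hφ : Measurable[hτ.measurableSpace] φ) {C : ℝ} (hφC : ∀ ω, |φ ω| ≤ C)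
    (hφs : ∀ ω, φ ω ≠ 0 → τ ω ≤ s) :
    ∫ ω, φ ω * (W k s ω - W k (τ ω) ω) ∂μ = 0 :=
  (isL2Ito_increment_to hW hτ hK k s hφ hφC hφs).integral_eq_zero hW

/-- Conditionally on `𝓕_τ`, the increments between `τ` and `s` are uncorrelated with variance
`s - τ`. -/
theorem integral_mul_increment_to_mul_increment_to [IsProbabilityMeasure μ]
    (hW : IsBrownianFamily 𝓕 μ W)
    (hτ : IsStoppingTime 𝓕 (fun ω => (τ ω : WithTop ℝ≥0))) {K : ℕ} (hK : ∀ ω, τ ω ≤ K)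
    (k l : Fin m) (s : ℝ≥0) {φ : Ω → ℝ} (hφ : Measurable[hτ.measurableSpace] φ) {C : ℝ}
    (hφC : ∀ ω, |φ ω| ≤ C) (hφs : ∀ ω, φ ω ≠ 0 → τ ω ≤ s) :
    Integrable (fun ω => φ ω * ((W k s ω - W k (τ ω) ω) * (W l s ω - W l (τ ω) ω))) μ ∧
    ∫ ω, φ ω * ((W k s ω - W k (τ ω) ω) * (W l s ω - W l (τ ω) ω)) ∂μ =
      if k = l then ∫ ω, φ ω * ((s : ℝ) - τ ω) ∂μ else 0 := by
  have hτs := measurable_stopping_self hτ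
  have hψ : Measurable[hτ.measurableSpace] ({ω | τ ω ≤ s}.indicator fun _ => (1 : ℝ)) :=
    (measurable_const (a := (1 : ℝ))).indicator (hτs measurableSet_Iic)
  have h1 := isL2Ito_increment_to hW hτ hK k s hφ hφC hφs
  have h2 := isL2Ito_increment_to hW hτ hK l s hψ (C := 1)
    (fun ω => by by_cases h : τ ω ≤ s <;> simp [h])
    (fun ω h => by by_contra h'; exact h (by simp [h']))
  have heq : ∀ ω, (φ ω * (W k s ω - W k (τ ω) ω)) *
      ({ω | τ ω ≤ s}.indicator (fun _ => (1 : ℝ)) ω * (W l s ω - W l (τ ω) ω)) =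
      φ ω * ((W k s ω - W k (τ ω) ω) * (W l s ω - W l (τ ω) ω)) := by
    intro ω
    by_cases h0 : φ ω = 0
    · simp [h0]
    · have : ω ∈ {ω | τ ω ≤ s} := hφs ω h0
      rw [indicator_of_mem this]
      ring
  have hint := h1.memLp_integral.integrable_mul h2.memLp_integral
  have hiso := h1.integral_mul hW h2
  simp only [heq] at hiso
  refine ⟨hint.congr (Eventually.of_forall heq), hiso.trans ?_⟩
  split_ifs
  · have hint' := h1.memLp_integrand.integrable_mul h2.memLp_integrand
    have := integral_prod_symm _ hint'
    simp only [Pi.mul_apply] at this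
    rw [this]
    refine integral_congr_ae (Eventually.of_forall fun ω => ?_)
    by_cases h0 : φ ω = 0
    · simp [h0]
    · have hle := hφs ω h0
      have : ω ∈ {ω | τ ω ≤ s} := hle
      have hsq : ∀ t, φ ω * (Ioc (τ ω) s).indicator (fun _ => 1) t *
          ({ω | τ ω ≤ s}.indicator (fun _ => 1) ω * (Ioc (τ ω) s).indicator (fun _ => 1) t) =
          φ ω * (Ioc (τ ω) s).indicator (fun _ => 1) t := by
        intro t
        rw [indicator_of_mem this]
        by_cases ht : t ∈ Ioc (τ ω) s <;> simp [ht]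
      simp only [hsq]
      rw [integral_const_mul, integral_timeMeasure_Ioc measurable_const hle]
      simp
  · rfl

/-- The integrand of the iterated integral: the increments of `W k` after `τ`, cut off at
`τ + Δ`. -/
noncomputable def pathIncrement (W : Fin m → ℝ≥0 → Ω → ℝ) (τ Δ : Ω → ℝ≥0) (k : Fin m) (s : ℝ≥0)
    (ω : Ω) : ℝ :=
  (Ioc (τ ω) (τ ω + Δ ω)).indicator (fun s => W k s ω - W k (τ ω) ω) s

theorem aestronglyMeasurable_pathIncrement [SFinite μ] (hW : IsBrownianFamily 𝓕 μ W)
    (hτ : IsStoppingTime 𝓕 (fun ω => (τ ω : WithTop ℝ≥0)))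
    (hΔ : Measurable Δ) (k : Fin m) :
    AEStronglyMeasurable (fun p : ℝ≥0 × Ω => pathIncrement W τ Δ k p.1 p.2)
      (timeMeasure.prod μ) := by
  obtain ⟨V, hV, hVW⟩ := exists_measurable_stopped hW hτ k
  have hτm : Measurable τ := (measurable_stopping_self hτ).mono hτ.measurableSpace_le le_rfl
  have hVm : Measurable V := hV.mono hτ.measurableSpace_le le_rfl
  have hset1 : MeasurableSet {p : ℝ≥0 × Ω | τ p.2 < p.1} :=
    measurableSet_lt (hτm.comp measurable_snd) measurable_fst
  have hset2 : MeasurableSet {p : ℝ≥0 × Ω | p.1 ≤ τ p.2 + Δ p.2} :=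
    measurableSet_le measurable_fst ((hτm.add hΔ).comp measurable_snd)
  have hset : MeasurableSet {p : ℝ≥0 × Ω | p.1 ∈ Ioc (τ p.2) (τ p.2 + Δ p.2)} :=
    hset1.inter hset2
  refine (((aestronglyMeasurable_path hW k).sub
    (hVm.comp measurable_snd).aestronglyMeasurable).indicator hset).congr ?_
  filter_upwards [ae_prod_of_ae hVW] with p hp
  by_cases h : p.1 ∈ Ioc (τ p.2) (τ p.2 + Δ p.2)
  · simp only [pathIncrement]
    rw [indicator_of_mem h, indicator_of_mem (by exact h)]
    simp [hp]
  · simp only [pathIncrement]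
    rw [indicator_of_notMem h, indicator_of_notMem (by exact h)]

theorem measurable_indicator_Ioc (hτ : IsStoppingTime 𝓕 (fun ω => (τ ω : WithTop ℝ≥0)))
    (hΔ : Measurable[hτ.measurableSpace] Δ) (s : ℝ≥0) :
    Measurable[hτ.measurableSpace] fun ω =>
      (Ioc (τ ω) (τ ω + Δ ω)).indicator (fun _ => (1 : ℝ)) s := by
  have hτs := measurable_stopping_self hτ
  have h1 : MeasurableSet[hτ.measurableSpace] {ω | τ ω < s} := hτs measurableSet_Iio
  have h2 : MeasurableSet[hτ.measurableSpace] {ω | s ≤ τ ω + Δ ω} := (hτs.add hΔ) measurableSet_Ici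
  exact (measurable_const (a := (1 : ℝ))).indicator (h1.inter h2)

/-- The integrand of the iterated integral is square-integrable, by Fubini's theorem and
`integral_mul_increment_to_mul_increment_to` at each deterministic time. -/
theorem memLp_pathIncrement [IsProbabilityMeasure μ] (hW : IsBrownianFamily 𝓕 μ W)
    (hτ : IsStoppingTime 𝓕 (fun ω => (τ ω : WithTop ℝ≥0)))
    (hΔ : Measurable[hτ.measurableSpace] Δ) {K : ℕ} (hK : ∀ ω, τ ω + Δ ω ≤ K) (k : Fin m) :
    MemLp (fun p : ℝ≥0 × Ω => pathIncrement W τ Δ k p.1 p.2) 2 (timeMeasure.prod μ) := by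
  have hΔm : Measurable Δ := hΔ.mono hτ.measurableSpace_le le_rfl
  have hm := aestronglyMeasurable_pathIncrement hW hτ hΔm k
  have hsq : ∀ s ω, pathIncrement W τ Δ k s ω ^ 2 =
      (Ioc (τ ω) (τ ω + Δ ω)).indicator (fun _ => (1 : ℝ)) s *
        ((W k s ω - W k (τ ω) ω) * (W k s ω - W k (τ ω) ω)) := by
    intro s ω
    by_cases h : s ∈ Ioc (τ ω) (τ ω + Δ ω) <;> simp [pathIncrement, h, sq]
  have key := fun s => integral_mul_increment_to_mul_increment_to hW hτ (K := K)
    (fun ω => le_self_add.trans (hK ω)) k k s (measurable_indicator_Ioc hτ hΔ s) (C := 1)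
    (fun ω => by by_cases h : s ∈ Ioc (τ ω) (τ ω + Δ ω) <;> simp [h])
    (fun ω h => by by_contra h'; exact h (indicator_of_notMem (fun h'' => h' h''.1.le) _))
  rw [memLp_two_iff_integrable_sq hm]
  refine (integrable_prod_iff (hm.pow 2)).2 ?_
  simp only [Pi.pow_apply, hsq]
  refine ⟨Eventually.of_forall fun s => (key s).1, ?_⟩
  have hnorm : ∀ s ω, ‖(Ioc (τ ω) (τ ω + Δ ω)).indicator (fun _ => (1 : ℝ)) s *
        ((W k s ω - W k (τ ω) ω) * (W k s ω - W k (τ ω) ω))‖ =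
        (Ioc (τ ω) (τ ω + Δ ω)).indicator (fun _ => (1 : ℝ)) s *
        ((W k s ω - W k (τ ω) ω) * (W k s ω - W k (τ ω) ω)) := fun s ω => by
    rw [← hsq, Real.norm_eq_abs, abs_of_nonneg (sq_nonneg _)]
  have hg : MemLp ((Iic (K : ℝ≥0)).indicator fun _ => (K : ℝ)) 1 timeMeasure := by
    refine memLp_indicator_const 1 measurableSet_Iic _ (Or.inr ?_)
    have : Iic (K : ℝ≥0) ⊆ insert 0 (Ioc 0 (K : ℝ≥0)) := fun x hx => by
      rcases eq_or_ne x 0 with h | h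
      · exact Or.inl h
      · exact Or.inr ⟨pos_iff_ne_zero.2 h, hx⟩
    refine ne_top_of_le_ne_top ?_ ((measure_mono this).trans (measure_union_le {0} _))
    rw [timeMeasure_Ioc]
    simp
  refine (memLp_one_iff_integrable.1 hg).mono' ?_ (Eventually.of_forall fun s => ?_)
  · have := (hm.pow 2).norm.integral_prod_right'
    simpa only [Pi.pow_apply, hsq] using this
  · simp only [hnorm]
    rw [(key s).2, if_pos rfl]
    have hbd : ∀ ω, 0 ≤ (Ioc (τ ω) (τ ω + Δ ω)).indicator (fun _ => (1 : ℝ)) s *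
        ((s : ℝ) - τ ω) ∧ (Ioc (τ ω) (τ ω + Δ ω)).indicator (fun _ => (1 : ℝ)) s *
        ((s : ℝ) - τ ω) ≤ (Iic (K : ℝ≥0)).indicator (fun _ => (K : ℝ)) s := by
      intro ω
      by_cases h : s ∈ Ioc (τ ω) (τ ω + Δ ω)
      · have hsK : s ≤ K := h.2.trans (hK ω)
        have h1 : (τ ω : ℝ) < s := by exact_mod_cast h.1
        have h2 : (s : ℝ) ≤ K := by exact_mod_cast hsK
        rw [indicator_of_mem h, indicator_of_mem (by exact hsK)]
        constructor
        · linarith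
        · linarith [(τ ω).2, NNReal.coe_nonneg (τ ω)]
      · rw [indicator_of_notMem h]
        simp only [zero_mul, le_refl, true_and]
        exact indicator_nonneg (fun _ _ => by positivity) _
    rw [Real.norm_eq_abs, abs_of_nonneg (integral_nonneg fun ω => (hbd ω).1)]
    refine (integral_mono_of_nonneg (Eventually.of_forall fun ω => (hbd ω).1)
      (integrable_const _) (Eventually.of_forall fun ω => (hbd ω).2)).trans ?_
    simp

/-- Truncation of a real number at height `M`. -/
noncomputable def truncate (M x : ℝ) : ℝ := max (-M) (min M x)

theorem abs_truncate_le {M : ℝ} (hM : 0 ≤ M) (x : ℝ) : |truncate M x| ≤ M := by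
  rw [abs_le]
  exact ⟨le_max_left _ _, max_le (by linarith) (min_le_left _ _)⟩

theorem abs_truncate_le_abs {M : ℝ} (hM : 0 ≤ M) (x : ℝ) : |truncate M x| ≤ |x| := by
  rw [abs_le]
  constructor
  · refine le_max_of_le_right (le_min ?_ (neg_abs_le x))
    linarith [abs_nonneg x]
  · exact max_le (by linarith [abs_nonneg x]) ((min_le_right _ _).trans (le_abs_self x))

theorem truncate_eq {M x : ℝ} (h : |x| ≤ M) : truncate M x = x := by
  rw [abs_le] at h
  rw [truncate, min_eq_right h.2, max_eq_right h.1]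

theorem continuous_truncate (M : ℝ) : Continuous (truncate M) := by
  unfold truncate
  fun_prop

/-- The increments of `W k` after `τ`, cut off at `τ + Δ`, can be approximated by simple integrands:
they are truncated, and then discretized. -/
theorem exists_approx_pathIncrement [IsProbabilityMeasure μ] (hW : IsBrownianFamily 𝓕 μ W)
    (hτ : IsStoppingTime 𝓕 (fun ω => (τ ω : WithTop ℝ≥0)))
    (hΔ : Measurable[hτ.measurableSpace] Δ) {K : ℕ} (hK : ∀ ω, τ ω + Δ ω ≤ K) (k : Fin m)
    {ε : ℝ≥0∞} (hε : 0 < ε) :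
    ∃ S : SimpleIntegrand 𝓕, S.After τ ∧
      eLpNorm ((fun p : ℝ≥0 × Ω => S.value p.1 p.2) - fun p => pathIncrement W τ Δ k p.1 p.2) 2
        (timeMeasure.prod μ) ≤ ε := by
  have hτs := measurable_stopping_self hτ
  have hτm : Measurable τ := hτs.mono hτ.measurableSpace_le le_rfl
  have hΔm : Measurable Δ := hΔ.mono hτ.measurableSpace_le le_rfl
  have hm := aestronglyMeasurable_pathIncrement hW hτ hΔm k
  have hε2 : 0 < ε / 2 := ENNReal.half_pos hε.ne'
  have htr : Tendsto (fun n : ℕ => eLpNorm ((fun p : ℝ≥0 × Ω =>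
      truncate n (pathIncrement W τ Δ k p.1 p.2)) - fun p => pathIncrement W τ Δ k p.1 p.2) 2
        (timeMeasure.prod μ)) atTop (𝓝 0) := by
    refine (tendsto_eLpNorm_two_of_dominated
      (g := fun p => |pathIncrement W τ Δ k p.1 p.2|)
      (fun n => (continuous_truncate n).comp_aestronglyMeasurable hm)
      (memLp_pathIncrement hW hτ hΔ hK k).norm
      (fun n => Eventually.of_forall fun p => abs_truncate_le_abs (Nat.cast_nonneg n) _)
      (Eventually.of_forall fun p => ?_)).2
    obtain ⟨n, hn⟩ := exists_nat_ge |pathIncrement W τ Δ k p.1 p.2|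
    refine tendsto_const_nhds.congr' ?_
    filter_upwards [eventually_ge_atTop n] with i hi
    rw [truncate_eq]
    exact hn.trans (by exact_mod_cast hi)
  -- a height of truncation `M` that is good enough, then a mesh that is fine enough for it
  obtain ⟨M, hM⟩ := (ENNReal.tendsto_nhds_zero.1 htr _ hε2).exists
  obtain ⟨V, hV, hVW⟩ := exists_measurable_stopped hW hτ k
  let G : ℝ≥0 → Ω → ℝ := fun s ω => (if τ ω ≤ s ∧ s < τ ω + Δ ω then 1 else 0) *
    truncate M (W k s ω - {ω | τ ω ≤ s}.indicator V ω)
  have hGeq : ∀ s ω, G s ω =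
      if τ ω ≤ s ∧ s < τ ω + Δ ω then truncate M (W k s ω - V ω) else 0 := by
    intro s ω
    by_cases h : τ ω ≤ s ∧ s < τ ω + Δ ω
    · simp [G, h]
    · simp [G, h]
  have hG : ∀ s, Measurable[𝓕 s] (G s) := fun s => by
    have h1 := measurable_ite_interval hτ hΔ (f := fun _ => 1) measurable_const s
    have h2 := (continuous_truncate M).measurable.comp
      ((hW.adapted k s).sub (measurable_ite_of_measurable_stopping hτ hV s))
    exact h1.mul h2
  have hb : ∃ C : ℝ, ∀ s ω, |G s ω| ≤ C := ⟨M, fun s ω => by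
    rw [hGeq]
    split_ifs
    · exact abs_truncate_le (Nat.cast_nonneg M) _
    · simp⟩
  obtain ⟨-, h2⟩ := tendsto_eLpNorm_gridIntegrand_interval (μ := μ) hτm hΔm hK hG hb
    (g := fun s ω => truncate M (W k s ω - W k (τ ω) ω))
    (by
      filter_upwards [hW.ae_continuous] with ω hω
      exact (continuous_truncate _).comp ((hω k).sub continuous_const))
    (by
      filter_upwards [hVW] with ω hω s
      rw [hGeq, hω])
  obtain ⟨n, hn⟩ := (ENNReal.tendsto_nhds_zero.1 h2 _ hε2).exists
  refine ⟨gridIntegrand G hG hb K n, gridIntegrand_after fun s ω hne => ?_, ?_⟩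
  · by_contra hcon
    exact hne (by rw [hGeq, if_neg fun h => hcon h.1])
  · have htreq : (fun p : ℝ≥0 × Ω => (Ioc (τ p.2) (τ p.2 + Δ p.2)).indicator
        (fun s => truncate M (W k s p.2 - W k (τ p.2) p.2)) p.1) =
        fun p => truncate M (pathIncrement W τ Δ k p.1 p.2) := by
      ext p
      have h0 : truncate M 0 = 0 := truncate_eq (by simp)
      by_cases h : p.1 ∈ Ioc (τ p.2) (τ p.2 + Δ p.2)
      · simp only [pathIncrement, indicator_of_mem h]
      · simp only [pathIncrement, indicator_of_notMem h, h0]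
    rw [htreq] at hn
    have hadd := eLpNorm_add_le
      ((gridIntegrand G hG hb K n).memLp_value.aestronglyMeasurable.sub
        ((continuous_truncate M).comp_aestronglyMeasurable hm))
      (((continuous_truncate M).comp_aestronglyMeasurable hm).sub hm) one_le_two
    rw [sub_add_sub_cancel] at hadd
    exact hadd.trans ((add_le_add hn hM).trans (ENNReal.add_halves ε).le)

end Iterated

/-! ### Localization to bounded step sizes -/

section Localization

variable {Ω : Type*} {mΩ : MeasurableSpace Ω} {μ : Measure Ω}
  {𝓕 : Filtration ℝ≥0 mΩ} {m : ℕ} {W : Fin m → ℝ≥0 → Ω → ℝ} {τ Δ : Ω → ℝ≥0}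

/-- The indicator of the event that the step size is at most `N`. -/
noncomputable def stepLe (Δ : Ω → ℝ≥0) (N : ℕ) : Ω → ℝ := {ω | Δ ω ≤ N}.indicator fun _ => 1

theorem stepLe_of_le {N : ℕ} {ω : Ω} (h : Δ ω ≤ N) : stepLe Δ N ω = 1 :=
  indicator_of_mem (by exact h) _

theorem stepLe_of_lt {N : ℕ} {ω : Ω} (h : N < Δ ω) : stepLe Δ N ω = 0 :=
  indicator_of_notMem (by exact not_le.2 h) _

theorem abs_stepLe_le (N : ℕ) (ω : Ω) : |stepLe Δ N ω| ≤ 1 := by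
  rcases le_or_gt (Δ ω) N with h | h
  · simp [stepLe_of_le h]
  · simp [stepLe_of_lt h]

theorem measurable_stepLe {Ω : Type*} {_ : MeasurableSpace Ω} {Δ : Ω → ℝ≥0} (hΔ : Measurable Δ)
    (N : ℕ) : Measurable (stepLe Δ N) :=
  measurable_const.indicator (hΔ measurableSet_Iic)

/-- `I` is the Itô integral of `H`, square-integrable on every event `{Δ ≤ N}`. -/
def IsLocIto (𝓕 : Filtration ℝ≥0 mΩ) (μ : Measure Ω) (τ Δ : Ω → ℝ≥0) (w H : ℝ≥0 → Ω → ℝ)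
    (I : Ω → ℝ) : Prop :=
  ∀ N : ℕ, IsL2Ito 𝓕 μ τ w (fun s ω => stepLe Δ N ω * H s ω) fun ω => stepLe Δ N ω * I ω

theorem tendsto_measure_step_gt [IsFiniteMeasure μ] (hΔ : Measurable Δ) :
    Tendsto (fun n : ℕ => μ {ω | (n : ℝ≥0) < Δ ω}) atTop (𝓝 0) := by
  have h := tendsto_measure_iInter_atTop (μ := μ) (s := fun n : ℕ => {ω | (n : ℝ≥0) < Δ ω})
    (fun n => (measurableSet_lt measurable_const hΔ).nullMeasurableSet)
    (fun i j hij ω (hω : (j : ℝ≥0) < Δ ω) =>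
      lt_of_le_of_lt (show (i : ℝ≥0) ≤ j by exact_mod_cast hij) hω)
    ⟨0, measure_ne_top _ _⟩
  have hempty : ⋂ n : ℕ, {ω | (n : ℝ≥0) < Δ ω} = ∅ := by
    refine eq_empty_of_forall_notMem fun ω hω => ?_
    obtain ⟨n, hn⟩ := exists_nat_ge (Δ ω)
    exact absurd (mem_iInter.1 hω n) (not_lt.2 hn)
  rwa [hempty, measure_empty] at h

theorem eLpNorm_two_sq {α : Type*} {mα : MeasurableSpace α} {ν : Measure α} (f : α → ℝ) :
    eLpNorm f 2 ν ^ 2 = ∫⁻ x, ENNReal.ofReal (f x ^ 2) ∂ν := by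
  have := eLpNorm_nnreal_pow_eq_lintegral (f := f) (μ := ν) (p := 2) two_ne_zero
  simp only [ENNReal.coe_ofNat, NNReal.coe_ofNat, ENNReal.rpow_ofNat] at this
  rw [this]
  refine lintegral_congr fun x => ?_
  rw [← ofReal_norm, ← ENNReal.ofReal_pow (norm_nonneg _), Real.norm_eq_abs, sq_abs]

/-- A locally square-integrable Itô integral is an Itô integral in the sense of limits in
probability. The `n`-th approximation is within `1 / (n + 1)` of the part on `{Δ ≤ n}`; the
probability of the complementary event tends to zero. -/
theorem IsLocIto.isItoIntegral [IsProbabilityMeasure μ] (hW : IsBrownianFamily 𝓕 μ W) {k : Fin m}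
    {H : ℝ≥0 → Ω → ℝ} {I : Ω → ℝ} (h : IsLocIto 𝓕 μ τ Δ (W k) H I) (hΔ : Measurable Δ)
    (hH : ∀ᵐ ω ∂μ, Measurable fun s => H s ω) : IsItoIntegral 𝓕 μ (W k) H I := by
  have hex : ∀ n : ℕ, ∃ S : SimpleIntegrand 𝓕,
      eLpNorm ((fun p : ℝ≥0 × Ω => S.value p.1 p.2) - fun p => stepLe Δ n p.2 * H p.1 p.2) 2
        (timeMeasure.prod μ) ≤ ((n : ℝ≥0∞) + 1)⁻¹ ∧
      eLpNorm (S.integral (W k) - fun ω => stepLe Δ n ω * I ω) 2 μ ≤ ((n : ℝ≥0∞) + 1)⁻¹ := by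
    intro n
    obtain ⟨-, -, S, -, h1, h2⟩ := h n
    have hpos : (0 : ℝ≥0∞) < ((n : ℝ≥0∞) + 1)⁻¹ := by simp
    obtain ⟨i, hi1, hi2⟩ := ((ENNReal.tendsto_nhds_zero.1 h1 _ hpos).and
      (ENNReal.tendsto_nhds_zero.1 h2 _ hpos)).exists
    exact ⟨S i, hi1, hi2⟩
  choose S hS1 hS2 using hex
  have hinv : Tendsto (fun n : ℕ => ((n : ℝ≥0∞) + 1)⁻¹) atTop (𝓝 0) := by
    simpa using (tendsto_add_atTop_iff_nat 1).2 ENNReal.tendsto_inv_nat_nhds_zero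
  have hgt := tendsto_measure_step_gt (μ := μ) hΔ
  refine ⟨hH, S, fun ε hε => ?_, ?_⟩
  -- convergence of the integrands: Markov's inequality for their localized quadratic distance
  · let X : ℕ → Ω → ℝ≥0∞ := fun n ω => ∫⁻ s,
      ENNReal.ofReal (((S n).value s ω - stepLe Δ n ω * H s ω) ^ 2) ∂timeMeasure
    have hXm : ∀ n, AEMeasurable (fun p : ℝ≥0 × Ω =>
        ENNReal.ofReal (((S n).value p.1 p.2 - stepLe Δ n p.2 * H p.1 p.2) ^ 2))
        (timeMeasure.prod μ) := fun n =>
      (((S n).memLp_value.aestronglyMeasurable.sub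
        (h n).memLp_integrand.aestronglyMeasurable).pow 2).aemeasurable.ennreal_ofReal
    have hXswap : ∀ n, AEMeasurable (fun p : Ω × ℝ≥0 =>
        ENNReal.ofReal (((S n).value p.2 p.1 - stepLe Δ n p.1 * H p.2 p.1) ^ 2))
        (μ.prod timeMeasure) := fun n => (hXm n).prod_swap
    have hXint : ∀ n, ∫⁻ ω, X n ω ∂μ ≤ (((n : ℝ≥0∞) + 1)⁻¹) ^ 2 := by
      intro n
      rw [← lintegral_prod_symm _ (hXm n)]
      refine le_trans (le_of_eq ?_) (pow_le_pow_left₀ zero_le (hS1 n) 2)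
      rw [eLpNorm_two_sq]
      rfl
    have hmark : ∀ n, ε ≠ ∞ → μ {ω | ε ≤ X n ω} ≤ (((n : ℝ≥0∞) + 1)⁻¹) ^ 2 / ε := fun n hε' =>
      (meas_ge_le_lintegral_div (hXswap n).lintegral_prod_right' hε.ne' hε').trans
        (ENNReal.div_le_div_right (hXint n) _)
    -- `ε = ∞` is a possible threshold, to which Markov's inequality does not apply
    rcases eq_or_ne ε ∞ with rfl | hε'
    · refine tendsto_of_tendsto_of_tendsto_of_le_of_le tendsto_const_nhds hgt (fun _ => zero_le)
        fun n => measure_mono_ae ?_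
      have hfin : ∀ᵐ ω ∂μ, X n ω < ∞ := by
        refine ae_lt_top' (hXswap n).lintegral_prod_right' (ne_top_of_le_ne_top ?_ (hXint n))
        simp
      filter_upwards [hfin, hH] with ω hω hHω hmem
      by_contra hcon
      have hle : Δ ω ≤ n := not_lt.1 hcon
      have hmem' : (∞ : ℝ≥0∞) ≤ edist (∫⁻ s in Ioi (0 : ℝ), ENNReal.ofReal
        (((S n).value s.toNNReal ω - H s.toNNReal ω) ^ 2)) 0 := hmem
      rw [ENNReal_edist_zero_right, ← lintegral_timeMeasure
        (f := fun s => ENNReal.ofReal (((S n).value s ω - H s ω) ^ 2))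
        (((((S n).measurable_value ω).sub hHω).pow_const 2).ennreal_ofReal)] at hmem'
      simp only [X, stepLe_of_le hle, one_mul] at hω
      exact absurd hω (not_lt.2 hmem')
    · have hlim : Tendsto (fun n : ℕ => μ {ω | (n : ℝ≥0) < Δ ω} + (((n : ℝ≥0∞) + 1)⁻¹) ^ 2 / ε)
          atTop (𝓝 0) := by
        have h2 := ENNReal.Tendsto.div_const (ENNReal.Tendsto.pow (n := 2) hinv) (b := ε)
          (Or.inr hε.ne')
        have := hgt.add h2
        simpa using this
      refine tendsto_of_tendsto_of_tendsto_of_le_of_le tendsto_const_nhds hlim (fun _ => zero_le)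
        fun n => ?_
      refine le_trans (measure_mono_ae ?_) ((measure_union_le _ _).trans
        (add_le_add le_rfl (hmark n hε')))
      filter_upwards [hH] with ω hHω hmem
      have hmem' : ε ≤ edist (∫⁻ s in Ioi (0 : ℝ), ENNReal.ofReal
        (((S n).value s.toNNReal ω - H s.toNNReal ω) ^ 2)) 0 := hmem
      rcases lt_or_ge (n : ℝ≥0) (Δ ω) with hlt | hle
      · exact Or.inl hlt
      · right
        rw [ENNReal_edist_zero_right, ← lintegral_timeMeasure
          (f := fun s => ENNReal.ofReal (((S n).value s ω - H s ω) ^ 2))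
          (((((S n).measurable_value ω).sub hHω).pow_const 2).ennreal_ofReal)] at hmem'
        change ε ≤ X n ω
        simpa only [X, stepLe_of_le hle, one_mul] using hmem'
  -- convergence of the integrals
  · have hJ : TendstoInMeasure μ (fun n => (S n).integral (W k) - fun ω => stepLe Δ n ω * I ω)
        atTop 0 := by
      refine tendstoInMeasure_of_tendsto_eLpNorm two_ne_zero (fun n => ?_)
        aestronglyMeasurable_zero ?_
      · exact ((S n).memLp_integral hW k).aestronglyMeasurable.sub
          (h n).memLp_integral.aestronglyMeasurable
      · simp only [sub_zero]
        exact tendsto_of_tendsto_of_tendsto_of_le_of_le tendsto_const_nhds hinv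
          (fun _ => zero_le) hS2
    intro ε hε
    have hlim := hgt.add (hJ ε hε)
    rw [add_zero] at hlim
    refine tendsto_of_tendsto_of_tendsto_of_le_of_le tendsto_const_nhds hlim (fun _ => zero_le)
      fun n => (measure_mono fun ω hω => ?_).trans (measure_union_le _ _)
    rcases lt_or_ge (n : ℝ≥0) (Δ ω) with hlt | hle
    · exact Or.inl hlt
    · right
      have hω' : ε ≤ edist ((S n).integral (W k) ω) (I ω) := hω
      change ε ≤ edist ((S n).integral (W k) ω - stepLe Δ n ω * I ω) 0
      rwa [stepLe_of_le hle, one_mul, edist_eq_enorm_sub, sub_zero, ← edist_eq_enorm_sub]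

/-- It suffices to know, for each `N`, a square-integrable Itô integral that agrees with the given
one on `{Δ ≤ N}`. -/
theorem isLocIto_of_min (hτ : IsStoppingTime 𝓕 (fun ω => (τ ω : WithTop ℝ≥0)))
    (hΔ : Measurable[hτ.measurableSpace] Δ) {k : Fin m} {H : ℝ≥0 → Ω → ℝ} {I : Ω → ℝ}
    (h : ∀ N : ℕ, ∃ H' I', IsL2Ito 𝓕 μ τ (W k) H' I' ∧
      ∀ ω, Δ ω ≤ N → I' ω = I ω ∧ ∀ s, H' s ω = H s ω) :
    IsLocIto 𝓕 μ τ Δ (W k) H I := by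
  intro N
  obtain ⟨H', I', h1, h2⟩ := h N
  refine (h1.mul hτ (measurable_stepLe hΔ N) (C := 1) (abs_stepLe_le N)).congr
    (Eventually.of_forall fun p => ?_) (Eventually.of_forall fun ω => ?_)
  · rcases le_or_gt (Δ p.2) N with h | h
    · rw [(h2 _ h).2]
    · simp [stepLe_of_lt h]
  · rcases le_or_gt (Δ ω) N with h | h
    · simp only
      rw [(h2 _ h).1]
    · simp [stepLe_of_lt h]

variable {K₀ : ℕ}

theorem add_min_le (hK₀ : ∀ ω, τ ω ≤ K₀) (N : ℕ) (ω : Ω) :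
    τ ω + min (Δ ω) N ≤ (K₀ + N : ℕ) := by
  push_cast
  exact add_le_add (hK₀ ω) (min_le_right _ _)

theorem isLocIto_increment [IsProbabilityMeasure μ] (hW : IsBrownianFamily 𝓕 μ W)
    (hτ : IsStoppingTime 𝓕 (fun ω => (τ ω : WithTop ℝ≥0)))
    (hΔ : Measurable[hτ.measurableSpace] Δ) (hK₀ : ∀ ω, τ ω ≤ K₀) (k : Fin m) :
    IsLocIto 𝓕 μ τ Δ (W k) (fun s ω => (Ioc (τ ω) (τ ω + Δ ω)).indicator (fun _ => 1) s)
      fun ω => W k (τ ω + Δ ω) ω - W k (τ ω) ω :=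
  isLocIto_of_min hτ hΔ fun N => ⟨_, _, isL2Ito_increment hW hτ (Δ := fun ω => min (Δ ω) N)
    (hΔ.min measurable_const) (add_min_le hK₀ N) k,
    fun ω h => ⟨by simp only [min_eq_left h], fun s => by simp only [min_eq_left h]⟩⟩

theorem isLocIto_timeIntegral [IsProbabilityMeasure μ] (hW : IsBrownianFamily 𝓕 μ W)
    (hτ : IsStoppingTime 𝓕 (fun ω => (τ ω : WithTop ℝ≥0)))
    (hΔ : Measurable[hτ.measurableSpace] Δ) (hK₀ : ∀ ω, τ ω ≤ K₀) (k : Fin m) :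
    IsLocIto 𝓕 μ τ Δ (W k)
      (fun s ω => (Ioc (τ ω) (τ ω + Δ ω)).indicator (fun s => (τ ω : ℝ) + Δ ω - s) s)
      fun ω => ∫ t in (τ ω : ℝ)..(τ ω + Δ ω : ℝ), (W k t.toNNReal ω - W k (τ ω) ω) :=
  isLocIto_of_min hτ hΔ fun N => ⟨_, _, isL2Ito_timeIntegral hW hτ (Δ := fun ω => min (Δ ω) N)
    (hΔ.min measurable_const) (add_min_le hK₀ N) k,
    fun ω h => ⟨by simp only [min_eq_left h], fun s => by simp only [min_eq_left h]⟩⟩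

theorem isLocIto_elapsed [IsProbabilityMeasure μ] (hW : IsBrownianFamily 𝓕 μ W)
    (hτ : IsStoppingTime 𝓕 (fun ω => (τ ω : WithTop ℝ≥0)))
    (hΔ : Measurable[hτ.measurableSpace] Δ) (hK₀ : ∀ ω, τ ω ≤ K₀) (k : Fin m) :
    IsLocIto 𝓕 μ τ Δ (W k)
      (fun s ω => (Ioc (τ ω) (τ ω + Δ ω)).indicator (fun s => (s : ℝ) - τ ω) s)
      fun ω => Δ ω * (W k (τ ω + Δ ω) ω - W k (τ ω) ω) -
        ∫ t in (τ ω : ℝ)..(τ ω + Δ ω : ℝ), (W k t.toNNReal ω - W k (τ ω) ω) :=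
  isLocIto_of_min hτ hΔ fun N => ⟨_, _, isL2Ito_elapsed hW hτ (Δ := fun ω => min (Δ ω) N)
    (hΔ.min measurable_const) (add_min_le hK₀ N) k,
    fun ω h => ⟨by simp only [min_eq_left h], fun s => by simp only [min_eq_left h]⟩⟩

/-- The iterated integral `∫ (W k - W k τ) dW l` over `[τ, τ + Δ]` exists. It is glued from the
events `{⌈Δ⌉ = j}`, on which the step size is bounded. -/
theorem exists_isLocIto_iterated [IsProbabilityMeasure μ] (hW : IsBrownianFamily 𝓕 μ W)
    (hτ : IsStoppingTime 𝓕 (fun ω => (τ ω : WithTop ℝ≥0)))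
    (hΔ : Measurable[hτ.measurableSpace] Δ) (hK₀ : ∀ ω, τ ω ≤ K₀) (k l : Fin m) :
    ∃ I, IsLocIto 𝓕 μ τ Δ (W l) (pathIncrement W τ Δ k) I := by
  have hm : ∀ j : ℕ, Measurable[hτ.measurableSpace] fun ω => min (Δ ω) (j : ℝ≥0) := fun j =>
    hΔ.min measurable_const
  choose I hI using fun j : ℕ => exists_isL2Ito_of_forall_approx (τ := τ) hW l
    (memLp_pathIncrement hW hτ (hm j) (add_min_le hK₀ j) k)
    fun ε hε => exists_approx_pathIncrement hW hτ (hm j) (add_min_le hK₀ j) k hε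
  refine ⟨fun ω => I ⌈Δ ω⌉₊ ω, isLocIto_of_min hτ hΔ fun N => ?_⟩
  have hφ : ∀ j : ℕ, Measurable[hτ.measurableSpace]
      ({ω | ⌈Δ ω⌉₊ = j}.indicator fun _ => (1 : ℝ)) := fun j => by
    have h1 := (Nat.measurable_ceil.comp hΔ) (measurableSet_singleton j)
    exact (measurable_const (a := (1 : ℝ))).indicator h1
  refine ⟨_, _, IsL2Ito.sum hW (Finset.range (N + 1)) fun j _ => (hI j).mul hτ (hφ j) (C := 1)
    fun ω => ?_, fun ω hω => ?_⟩
  · by_cases h : ⌈Δ ω⌉₊ = j <;> simp [h]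
  · have hle : ⌈Δ ω⌉₊ ∈ Finset.range (N + 1) :=
      Finset.mem_range.2 (Nat.lt_succ_iff.2 (Nat.ceil_le.2 hω))
    constructor
    · rw [Finset.sum_eq_single_of_mem _ hle]
      · simp
      · intro j _ hj
        simp [hj.symm]
    · intro s
      rw [Finset.sum_eq_single_of_mem _ hle]
      · simp [pathIncrement, min_eq_left (Nat.le_ceil (Δ ω))]
      · intro j _ hj
        simp [hj.symm]

end Localization

/-! ### The algebra of generalized conditional expectations -/

section GenCondExp

variable {Ω : Type*} {E : Type*} [NormedAddCommGroup E] [NormedSpace ℝ E]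
  {m mΩ : MeasurableSpace Ω} {μ : Measure Ω}

theorem IsGenCondExp.congr {X X' Z : Ω → E} (h : IsGenCondExp m μ X Z)
    (hX : X =ᵐ[μ] X') : IsGenCondExp m μ X' Z := by
  obtain ⟨hZ, A, hA, hcov, hI⟩ := h
  refine ⟨hZ, A, hA, hcov, fun n => ⟨(hI n).1.congr (ae_restrict_of_ae hX), (hI n).2.1,
    fun B hB hBA => ?_⟩⟩
  rw [← (hI n).2.2 B hB hBA]
  exact integral_congr_ae (ae_restrict_of_ae (hX.mono fun _ h => h.symm))

theorem IsGenCondExp.add {X X' Z Z' : Ω → E} (h : IsGenCondExp m μ X Z)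
    (h' : IsGenCondExp m μ X' Z') :
    IsGenCondExp m μ (fun ω => X ω + X' ω) fun ω => Z ω + Z' ω := by
  obtain ⟨hZ, A, hA, hcov, hI⟩ := h
  obtain ⟨hZ', A', hA', hcov', hI'⟩ := h'
  refine ⟨hZ.add hZ', fun n => A n.unpair.1 ∩ A' n.unpair.2, fun n => (hA _).inter (hA' _), ?_,
    fun n => ⟨?_, ?_, fun B hB hBA => ?_⟩⟩
  · filter_upwards [hcov, hcov'] with ω ⟨i, hi⟩ ⟨j, hj⟩
    exact ⟨Nat.pair i j, by simpa using ⟨hi, hj⟩⟩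
  · exact ((hI _).1.mono_set inter_subset_left).add ((hI' _).1.mono_set inter_subset_right)
  · exact ((hI _).2.1.mono_set inter_subset_left).add ((hI' _).2.1.mono_set inter_subset_right)
  · have s1 := hBA.trans inter_subset_left
    have s2 := hBA.trans inter_subset_right
    rw [integral_add ((hI _).1.mono_set s1) ((hI' _).1.mono_set s2),
      integral_add ((hI _).2.1.mono_set s1) ((hI' _).2.1.mono_set s2),
      (hI _).2.2 B hB s1, (hI' _).2.2 B hB s2]

/-- A measurable random variable is its own conditional expectation, whether integrable or not; the
exhausting events are `{‖Z‖ ≤ n}`. -/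
theorem isGenCondExp_self [IsFiniteMeasure μ] (hm : m ≤ mΩ) {Z : Ω → E}
    (hZ : StronglyMeasurable[m] Z) : IsGenCondExp m μ Z Z := by
  have hms : ∀ n : ℕ, MeasurableSet[m] {ω | ‖Z ω‖ ≤ n} := fun n =>
    hZ.norm.measurable measurableSet_Iic
  have hint : ∀ n : ℕ, IntegrableOn Z {ω | ‖Z ω‖ ≤ n} μ := fun n =>
    Measure.integrableOn_of_bounded (M := n) (measure_ne_top _ _) (hZ.mono hm).aestronglyMeasurable
      ((ae_restrict_iff' (hm _ (hms n))).2 (Eventually.of_forall fun ω h => h))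
  exact ⟨hZ, fun n => {ω | ‖Z ω‖ ≤ n}, hms, Eventually.of_forall fun ω => exists_nat_ge ‖Z ω‖,
    fun n => ⟨hint n, hint n, fun _ _ _ => rfl⟩⟩

theorem IsGenCondExp.sum [IsFiniteMeasure μ] (hm : m ≤ mΩ) {ι : Type*} (s : Finset ι)
    {X Z : ι → Ω → E} (h : ∀ i ∈ s, IsGenCondExp m μ (X i) (Z i)) :
    IsGenCondExp m μ (fun ω => ∑ i ∈ s, X i ω) fun ω => ∑ i ∈ s, Z i ω := by
  classical
  induction s using Finset.induction_on with
  | empty => simpa using isGenCondExp_self (E := E) hm (stronglyMeasurable_const (b := 0))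
  | insert a s ha ih =>
    simp only [Finset.sum_insert ha]
    exact (h a (Finset.mem_insert_self a s)).add
      (ih fun i hi => h i (Finset.mem_insert_of_mem hi))

/-- Known factors can be taken out of a generalized conditional expectation. -/
theorem IsGenCondExp.smul [IsFiniteMeasure μ] [CompleteSpace E] (hm : m ≤ mΩ) {X Z : Ω → ℝ}
    (h : IsGenCondExp m μ X Z) {v : Ω → E} (hv : StronglyMeasurable[m] v) :
    IsGenCondExp m μ (fun ω => X ω • v ω) fun ω => Z ω • v ω := by
  obtain ⟨hZ, A, hA, hcov, hI⟩ := h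
  have hvs : ∀ n : ℕ, MeasurableSet[m] {ω | ‖v ω‖ ≤ n} := fun n =>
    hv.norm.measurable measurableSet_Iic
  let A' : ℕ → Set Ω := fun n => A n.unpair.1 ∩ {ω | ‖v ω‖ ≤ n.unpair.2}
  have hA' : ∀ n, MeasurableSet[m] (A' n) := fun n => (hA _).inter (hvs _)
  have hvb : ∀ n, ∀ᵐ ω ∂(μ.restrict (A' n)), ‖v ω‖ ≤ n.unpair.2 := fun n =>
    (ae_restrict_iff' (hm _ (hA' n))).2 (Eventually.of_forall fun ω h => h.2)
  have hvm := (hv.mono hm).aestronglyMeasurable (μ := μ)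
  have key : ∀ {U : Ω → ℝ} n, IntegrableOn U (A n.unpair.1) μ →
      IntegrableOn (fun ω => U ω • v ω) (A' n) μ := fun {U} n hU =>
    (hU.mono_set inter_subset_left).smul_bdd (n.unpair.2 : ℝ) hvm.restrict (hvb n)
  refine ⟨hZ.smul hv, A', hA', ?_, fun n => ⟨key n (hI _).1, key n (hI _).2.1,
    fun B hB hBA => ?_⟩⟩
  · filter_upwards [hcov] with ω ⟨i, hi⟩
    obtain ⟨j, hj⟩ := exists_nat_ge ‖v ω‖
    exact ⟨Nat.pair i j, by simpa [A'] using ⟨hi, hj⟩⟩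
  · have hAm := hA n.unpair.1
    have iX : Integrable ((A n.unpair.1).indicator X) μ :=
      (integrable_indicator_iff (hm _ hAm)).2 (hI _).1
    have iZ : Integrable ((A n.unpair.1).indicator Z) μ :=
      (integrable_indicator_iff (hm _ hAm)).2 (hI _).2.1
    have hce : (A n.unpair.1).indicator Z =ᵐ[μ] μ[(A n.unpair.1).indicator X | m] := by
      refine ae_eq_condExp_of_forall_setIntegral_eq hm iX (fun s _ _ => iZ.integrableOn)
        (fun s hs _ => ?_) (hZ.indicator hAm).aestronglyMeasurable
      rw [setIntegral_indicator (hm _ hAm), setIntegral_indicator (hm _ hAm)]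
      exact ((hI _).2.2 _ (hs.inter hAm) inter_subset_right).symm
    have hvB : StronglyMeasurable[m] (B.indicator v) := hv.indicator hB
    have hBv : ∀ ω, ‖B.indicator v ω‖ ≤ n.unpair.2 := by
      intro ω
      by_cases hω : ω ∈ B
      · rw [indicator_of_mem hω]; exact (hBA hω).2
      · rw [indicator_of_notMem hω, norm_zero]; positivity
    have iXv : Integrable ((A n.unpair.1).indicator X • B.indicator v) μ :=
      iX.smul_bdd (n.unpair.2 : ℝ) (hvB.mono hm).aestronglyMeasurable (Eventually.of_forall hBv)
    -- pull the bounded factor `B.indicator v` out of an ordinary conditional expectation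
    have hpull := condExp_smul_of_aestronglyMeasurable_right iX iXv hvB.aestronglyMeasurable
    have hind : ∀ U : Ω → ℝ, ((A n.unpair.1).indicator U • B.indicator v) =
        B.indicator fun ω => U ω • v ω := by
      intro U
      ext ω
      by_cases hω : ω ∈ B
      · have : ω ∈ A n.unpair.1 := (hBA hω).1
        simp [hω, this]
      · simp [hω]
    rw [← integral_indicator (hm _ hB), ← integral_indicator (hm _ hB), ← hind X, ← hind Z,
      ← integral_condExp hm]
    refine integral_congr_ae ?_
    filter_upwards [hpull, hce] with ω h1 h2
    rw [h1, Pi.smul_apply', Pi.smul_apply', h2]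

theorem IsGenCondExp.genCondExp_ae_eq [IsFiniteMeasure μ] [CompleteSpace E] (hm : m ≤ mΩ)
    {X Z : Ω → E} (h : IsGenCondExp m μ X Z) : genCondExp m μ X =ᵐ[μ] Z := by
  have h' : HasGenCondExp m μ X := ⟨_, h⟩
  rw [genCondExp, dif_pos h']
  exact h'.choose_spec.ae_eq hm h

end GenCondExp

/-! ### Conditional moments of the stochastic integrals -/

section Moments

variable {Ω : Type*} {mΩ : MeasurableSpace Ω} {μ : Measure Ω}
  {𝓕 : Filtration ℝ≥0 mΩ} {m : ℕ} {W : Fin m → ℝ≥0 → Ω → ℝ} {τ Δ : Ω → ℝ≥0}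

theorem IsLocIto.integrableOn_mul {k l : Fin m} {H H' : ℝ≥0 → Ω → ℝ}
    {I I' : Ω → ℝ} (h : IsLocIto 𝓕 μ τ Δ (W k) H I) (h' : IsLocIto 𝓕 μ τ Δ (W l) H' I')
    (hΔ : Measurable Δ) (N : ℕ) : IntegrableOn (fun ω => I ω * I' ω) {ω | Δ ω ≤ N} μ := by
  have hs : MeasurableSet {ω | Δ ω ≤ N} := hΔ measurableSet_Iic
  rw [← integrable_indicator_iff hs]
  refine ((h N).memLp_integral.integrable_mul (h' N).memLp_integral).congr
    (Eventually.of_forall fun ω => ?_)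
  rcases le_or_gt (Δ ω) N with hω | hω
  · rw [indicator_of_mem (by exact hω)]
    simp [stepLe_of_le hω]
  · rw [indicator_of_notMem (by exact not_le.2 hω)]
    simp [stepLe_of_lt hω]

theorem IsLocIto.integrable_integrand_mul (hτ : IsStoppingTime 𝓕 (fun ω => (τ ω : WithTop ℝ≥0)))
    {k l : Fin m} {H H' : ℝ≥0 → Ω → ℝ}
    {I I' : Ω → ℝ} (h : IsLocIto 𝓕 μ τ Δ (W k) H I) (h' : IsLocIto 𝓕 μ τ Δ (W l) H' I') {N : ℕ}
    {B : Set Ω} (hB : MeasurableSet[hτ.measurableSpace] B) (hBN : B ⊆ {ω | Δ ω ≤ N}) :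
    Integrable (fun p : ℝ≥0 × Ω => B.indicator (fun _ => (1 : ℝ)) p.2 * (H p.1 p.2 * H' p.1 p.2))
      (timeMeasure.prod μ) := by
  have hBm : Measurable (B.indicator fun _ => (1 : ℝ)) :=
    measurable_const.indicator (hτ.measurableSpace_le _ hB)
  have h0 := ((h N).memLp_integrand.integrable_mul (h' N).memLp_integrand).bdd_mul (c := 1)
    (hBm.comp measurable_snd).aestronglyMeasurable (Eventually.of_forall fun p => by
      by_cases hp : p.2 ∈ B <;> simp [hp])
  refine h0.congr (Eventually.of_forall fun p => ?_)
  by_cases hp : p.2 ∈ B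
  · simp [hp, stepLe_of_le (hBN hp)]
  · simp [hp]

variable [IsProbabilityMeasure μ]

/-- To compute a conditional moment as a power of the step size it is enough to integrate over the
`𝓕_τ`-measurable events on which the step size is bounded. -/
theorem isGenCondExp_of_forall_setIntegral_eq {𝓖 : MeasurableSpace Ω} (h𝓖 : 𝓖 ≤ mΩ)
    (hΔ : Measurable[𝓖] Δ) {X : Ω → ℝ} (c : ℝ) (j : ℕ)
    (hint : ∀ N : ℕ, IntegrableOn X {ω | Δ ω ≤ N} μ)
    (h : ∀ N : ℕ, ∀ B, MeasurableSet[𝓖] B → B ⊆ {ω | Δ ω ≤ N} →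
      ∫ ω in B, X ω ∂μ = ∫ ω in B, c * (Δ ω : ℝ) ^ j ∂μ) :
    IsGenCondExp 𝓖 μ X fun ω => c * (Δ ω : ℝ) ^ j := by
  have hms : ∀ N : ℕ, MeasurableSet[𝓖] {ω | Δ ω ≤ N} := fun N => hΔ measurableSet_Iic
  have hq : Measurable[𝓖] fun ω => c * (Δ ω : ℝ) ^ j :=
    (((measurable_coe_nnreal_real.comp hΔ)).pow_const j).const_mul c
  refine ⟨hq.stronglyMeasurable, fun N => {ω | Δ ω ≤ N}, hms,
    Eventually.of_forall fun ω => exists_nat_ge (Δ ω), fun N => ⟨hint N, ?_, h N⟩⟩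
  refine Measure.integrableOn_of_bounded (M := |c| * N ^ j) (measure_ne_top _ _)
    (hq.mono h𝓖 le_rfl).aestronglyMeasurable
    ((ae_restrict_iff' (h𝓖 _ (hms N))).2 (Eventually.of_forall fun ω hω => ?_))
  have : (Δ ω : ℝ) ≤ N := by exact_mod_cast hω
  rw [Real.norm_eq_abs, abs_mul, abs_pow, NNReal.abs_eq]
  gcongr

/-- The localized Itô isometry. -/
theorem IsLocIto.setIntegral_mul (hW : IsBrownianFamily 𝓕 μ W)
    (hτ : IsStoppingTime 𝓕 (fun ω => (τ ω : WithTop ℝ≥0))) {k l : Fin m} {H H' : ℝ≥0 → Ω → ℝ}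
    {I I' : Ω → ℝ} (h : IsLocIto 𝓕 μ τ Δ (W k) H I) (h' : IsLocIto 𝓕 μ τ Δ (W l) H' I') {N : ℕ}
    {B : Set Ω} (hB : MeasurableSet[hτ.measurableSpace] B) (hBN : B ⊆ {ω | Δ ω ≤ N}) :
    ∫ ω in B, I ω * I' ω ∂μ = if k = l then
      ∫ p, B.indicator (fun _ => (1 : ℝ)) p.2 * (H p.1 p.2 * H' p.1 p.2) ∂(timeMeasure.prod μ)
      else 0 := by
  have hBm : Measurable[hτ.measurableSpace] (B.indicator fun _ => (1 : ℝ)) :=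
    (measurable_const (a := (1 : ℝ))).indicator hB
  have h0 := ((h N).mul hτ hBm (C := 1) fun ω => by
    by_cases hp : ω ∈ B <;> simp [hp]).integral_mul hW (h' N)
  have e1 : ∀ ω, B.indicator (fun _ => (1 : ℝ)) ω * (stepLe Δ N ω * I ω) * (stepLe Δ N ω * I' ω) =
      B.indicator (fun ω => I ω * I' ω) ω := by
    intro ω
    by_cases hp : ω ∈ B
    · simp [hp, stepLe_of_le (hBN hp)]
    · simp [hp]
  have e2 : ∀ p : ℝ≥0 × Ω, B.indicator (fun _ => (1 : ℝ)) p.2 * (stepLe Δ N p.2 * H p.1 p.2) *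
      (stepLe Δ N p.2 * H' p.1 p.2) =
      B.indicator (fun _ => (1 : ℝ)) p.2 * (H p.1 p.2 * H' p.1 p.2) := by
    intro p
    by_cases hp : p.2 ∈ B
    · simp [hp, stepLe_of_le (hBN hp)]
    · simp [hp]
  simp only [e1, e2] at h0
  rw [← h0, integral_indicator (hτ.measurableSpace_le _ hB)]

/-- Itô integrals over `[τ, τ + Δ]` have conditional expectation zero. -/
theorem IsLocIto.isGenCondExp (hW : IsBrownianFamily 𝓕 μ W)
    (hτ : IsStoppingTime 𝓕 (fun ω => (τ ω : WithTop ℝ≥0)))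
    (hΔ : Measurable[hτ.measurableSpace] Δ) {k : Fin m} {H : ℝ≥0 → Ω → ℝ}
    {I : Ω → ℝ} (h : IsLocIto 𝓕 μ τ Δ (W k) H I) :
    IsGenCondExp hτ.measurableSpace μ I fun _ => 0 := by
  have := isGenCondExp_of_forall_setIntegral_eq (μ := μ) hτ.measurableSpace_le hΔ (X := I) 0 0
    (fun N => ?_) fun N B hB hBN => ?_
  · simpa using this
  · have hs : MeasurableSet {ω | Δ ω ≤ N} :=
      (hΔ.mono hτ.measurableSpace_le le_rfl) measurableSet_Iic
    rw [← integrable_indicator_iff hs]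
    refine ((h N).memLp_integral.integrable one_le_two).congr (Eventually.of_forall fun ω => ?_)
    rcases le_or_gt (Δ ω) N with hω | hω
    · rw [indicator_of_mem (by exact hω)]
      simp [stepLe_of_le hω]
    · rw [indicator_of_notMem (by exact not_le.2 hω)]
      simp [stepLe_of_lt hω]
  · have hBm : Measurable[hτ.measurableSpace] (B.indicator fun _ => (1 : ℝ)) :=
      (measurable_const (a := (1 : ℝ))).indicator hB
    have h0 := ((h N).mul hτ hBm (C := 1) fun ω => by
      by_cases hp : ω ∈ B <;> simp [hp]).integral_eq_zero hW
    have e1 : ∀ ω, B.indicator (fun _ => (1 : ℝ)) ω * (stepLe Δ N ω * I ω) =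
        B.indicator I ω := by
      intro ω
      by_cases hp : ω ∈ B
      · simp [hp, stepLe_of_le (hBN hp)]
      · simp [hp]
    simp only [e1] at h0
    rw [← integral_indicator (hτ.measurableSpace_le _ hB), h0]
    simp

/-- The conditional expectation of a product of two locally square-integrable Itô integrals, from
the integral of the product of the integrands. -/
theorem IsLocIto.isGenCondExp_mul (hW : IsBrownianFamily 𝓕 μ W)
    (hτ : IsStoppingTime 𝓕 (fun ω => (τ ω : WithTop ℝ≥0)))
    (hΔ : Measurable[hτ.measurableSpace] Δ) {k l : Fin m} {H H' : ℝ≥0 → Ω → ℝ}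
    {I I' : Ω → ℝ} (h : IsLocIto 𝓕 μ τ Δ (W k) H I) (h' : IsLocIto 𝓕 μ τ Δ (W l) H' I') (c : ℝ)
    (j : ℕ)
    (hHH' : k = l → ∀ N : ℕ, ∀ B, MeasurableSet[hτ.measurableSpace] B → B ⊆ {ω | Δ ω ≤ N} →
      ∫ p, B.indicator (fun _ => (1 : ℝ)) p.2 * (H p.1 p.2 * H' p.1 p.2) ∂(timeMeasure.prod μ) =
        ∫ ω in B, c * (Δ ω : ℝ) ^ j ∂μ) :
    IsGenCondExp hτ.measurableSpace μ (fun ω => I ω * I' ω)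
      fun ω => (if k = l then c else 0) * (Δ ω : ℝ) ^ j := by
  refine isGenCondExp_of_forall_setIntegral_eq hτ.measurableSpace_le hΔ _ _
    (h.integrableOn_mul h' (hΔ.mono hτ.measurableSpace_le le_rfl)) fun N B hB hBN => ?_
  rw [h.setIntegral_mul hW hτ h' hB hBN]
  split_ifs with hkl
  · exact hHH' hkl N B hB hBN
  · simp

/-- If the product of the integrands has a pathwise time integral that is a multiple of a power of
the step size, Fubini's theorem gives the hypothesis of `IsLocIto.isGenCondExp_mul`. -/
theorem IsLocIto.integral_integrand_of_pathwise
    (hτ : IsStoppingTime 𝓕 (fun ω => (τ ω : WithTop ℝ≥0)))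
    {k l : Fin m} {H H' : ℝ≥0 → Ω → ℝ}
    {I I' : Ω → ℝ} (h : IsLocIto 𝓕 μ τ Δ (W k) H I) (h' : IsLocIto 𝓕 μ τ Δ (W l) H' I') (c : ℝ)
    (j : ℕ) (hq : ∀ ω, ∫ s, H s ω * H' s ω ∂timeMeasure = c * (Δ ω : ℝ) ^ j) (N : ℕ)
    (B : Set Ω) (hB : MeasurableSet[hτ.measurableSpace] B) (hBN : B ⊆ {ω | Δ ω ≤ N}) :
      ∫ p, B.indicator (fun _ => (1 : ℝ)) p.2 * (H p.1 p.2 * H' p.1 p.2) ∂(timeMeasure.prod μ) =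
        ∫ ω in B, c * (Δ ω : ℝ) ^ j ∂μ := by
  rw [integral_prod_symm _ (h.integrable_integrand_mul hτ h' hB hBN),
    ← integral_indicator (hτ.measurableSpace_le _ hB)]
  refine integral_congr_ae (Eventually.of_forall fun ω => ?_)
  simp only [integral_const_mul, hq]
  by_cases hω : ω ∈ B <;> simp [hω]

/-- The integrand of an iterated integral is orthogonal to every integrand `g` that is known at time
`τ`: at each deterministic time the increment since `τ` has conditional expectation zero. -/
theorem integral_pathIncrement_mul (hW : IsBrownianFamily 𝓕 μ W)
    (hτ : IsStoppingTime 𝓕 (fun ω => (τ ω : WithTop ℝ≥0)))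
    (hΔ : Measurable[hτ.measurableSpace] Δ) {K₀ : ℕ} (hK₀ : ∀ ω, τ ω ≤ K₀)
    {k l l' : Fin m} {g : ℝ≥0 → Ω → ℝ}
    {I I' : Ω → ℝ} (h : IsLocIto 𝓕 μ τ Δ (W l) (pathIncrement W τ Δ k) I)
    (h' : IsLocIto 𝓕 μ τ Δ (W l')
      (fun s ω => (Ioc (τ ω) (τ ω + Δ ω)).indicator (fun s => g s ω) s) I')
    (hg : ∀ s, Measurable[hτ.measurableSpace] (g s))
    (hgb : ∀ N : ℕ, ∃ C : ℝ, ∀ s ω, Δ ω ≤ N → s ∈ Ioc (τ ω) (τ ω + Δ ω) → |g s ω| ≤ C) (N : ℕ)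
    (B : Set Ω) (hB : MeasurableSet[hτ.measurableSpace] B) (hBN : B ⊆ {ω | Δ ω ≤ N}) :
      ∫ p, B.indicator (fun _ => (1 : ℝ)) p.2 * (pathIncrement W τ Δ k p.1 p.2 *
        (Ioc (τ p.2) (τ p.2 + Δ p.2)).indicator (fun s => g s p.2) p.1) ∂(timeMeasure.prod μ) =
        0 := by
  rw [integral_prod _ (h.integrable_integrand_mul hτ h' hB hBN)]
  refine integral_eq_zero_of_ae (Eventually.of_forall fun s => ?_)
  obtain ⟨C, hC⟩ := hgb N
  have hBm : Measurable[hτ.measurableSpace] (B.indicator fun _ => (1 : ℝ)) :=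
    (measurable_const (a := (1 : ℝ))).indicator hB
  have h0 := integral_mul_increment_to hW hτ hK₀ k s (C := |C|)
    (φ := fun ω => B.indicator (fun _ => (1 : ℝ)) ω *
      ((Ioc (τ ω) (τ ω + Δ ω)).indicator (fun _ => (1 : ℝ)) s * g s ω))
    (hBm.mul ((measurable_indicator_Ioc hτ hΔ s).mul (hg s))) (fun ω => by
      by_cases hω : ω ∈ B
      · by_cases hs : s ∈ Ioc (τ ω) (τ ω + Δ ω)
        · simpa [hω, hs] using (hC s ω (hBN hω) hs).trans (le_abs_self C)
        · simp [hs]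
      · simp [hω]) (fun ω hne => by
      by_contra hcon
      have hs : s ∉ Ioc (τ ω) (τ ω + Δ ω) := fun hs => hcon hs.1.le
      exact hne (by simp [hs]))
  refine Eq.trans (integral_congr_ae (Eventually.of_forall fun ω => ?_)) h0
  by_cases hs : s ∈ Ioc (τ ω) (τ ω + Δ ω)
  · simp [pathIncrement, hs]
    ring
  · simp [pathIncrement, hs]

/-- The covariance of the integrands of two iterated integrals is that of the weights `1` and
`s - τ`, because the increments between `τ` and `s` have conditional variance `s - τ`. -/
theorem integral_pathIncrement_mul_pathIncrement (hW : IsBrownianFamily 𝓕 μ W)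
    (hτ : IsStoppingTime 𝓕 (fun ω => (τ ω : WithTop ℝ≥0)))
    (hΔ : Measurable[hτ.measurableSpace] Δ) {K₀ : ℕ} (hK₀ : ∀ ω, τ ω ≤ K₀)
    {k k' l l' : Fin m} {I I' : Ω → ℝ} (h : IsLocIto 𝓕 μ τ Δ (W l) (pathIncrement W τ Δ k) I)
    (h' : IsLocIto 𝓕 μ τ Δ (W l') (pathIncrement W τ Δ k') I') (N : ℕ)
    (B : Set Ω) (hB : MeasurableSet[hτ.measurableSpace] B) (hBN : B ⊆ {ω | Δ ω ≤ N}) :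
      ∫ p, B.indicator (fun _ => (1 : ℝ)) p.2 * (pathIncrement W τ Δ k p.1 p.2 *
        pathIncrement W τ Δ k' p.1 p.2) ∂(timeMeasure.prod μ) =
        if k = k' then ∫ p, B.indicator (fun _ => (1 : ℝ)) p.2 *
          ((Ioc (τ p.2) (τ p.2 + Δ p.2)).indicator (fun _ => 1) p.1 *
          (Ioc (τ p.2) (τ p.2 + Δ p.2)).indicator (fun s => (s : ℝ) - τ p.2) p.1)
            ∂(timeMeasure.prod μ)
        else 0 := by
  have hBm : Measurable[hτ.measurableSpace] (B.indicator fun _ => (1 : ℝ)) :=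
    (measurable_const (a := (1 : ℝ))).indicator hB
  have key : ∀ s, ∫ ω, B.indicator (fun _ => (1 : ℝ)) ω * (pathIncrement W τ Δ k s ω *
        pathIncrement W τ Δ k' s ω) ∂μ = if k = k' then
        ∫ ω, B.indicator (fun _ => (1 : ℝ)) ω *
          ((Ioc (τ ω) (τ ω + Δ ω)).indicator (fun _ => 1) s *
          (Ioc (τ ω) (τ ω + Δ ω)).indicator (fun s => (s : ℝ) - τ ω) s) ∂μ else 0 := by
    intro s
    have h0 := (integral_mul_increment_to_mul_increment_to hW hτ hK₀ k k' s (C := 1)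
      (φ := fun ω => B.indicator (fun _ => (1 : ℝ)) ω *
        (Ioc (τ ω) (τ ω + Δ ω)).indicator (fun _ => (1 : ℝ)) s)
      (hBm.mul (measurable_indicator_Ioc hτ hΔ s)) (fun ω => by
        by_cases hω : ω ∈ B <;> by_cases hs : s ∈ Ioc (τ ω) (τ ω + Δ ω) <;> simp [hω, hs])
      (fun ω hne => by
        by_contra hcon
        have hs : s ∉ Ioc (τ ω) (τ ω + Δ ω) := fun hs => hcon hs.1.le
        exact hne (by simp [hs]))).2
    have e1 : ∀ ω, B.indicator (fun _ => (1 : ℝ)) ω * (pathIncrement W τ Δ k s ω *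
        pathIncrement W τ Δ k' s ω) = B.indicator (fun _ => (1 : ℝ)) ω *
        (Ioc (τ ω) (τ ω + Δ ω)).indicator (fun _ => (1 : ℝ)) s *
        ((W k s ω - W k (τ ω) ω) * (W k' s ω - W k' (τ ω) ω)) := by
      intro ω
      by_cases hs : s ∈ Ioc (τ ω) (τ ω + Δ ω) <;> simp [pathIncrement, hs]
    have e2 : ∀ ω, B.indicator (fun _ => (1 : ℝ)) ω *
          ((Ioc (τ ω) (τ ω + Δ ω)).indicator (fun _ => 1) s *
          (Ioc (τ ω) (τ ω + Δ ω)).indicator (fun s => (s : ℝ) - τ ω) s) =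
          B.indicator (fun _ => (1 : ℝ)) ω *
          (Ioc (τ ω) (τ ω + Δ ω)).indicator (fun _ => (1 : ℝ)) s * ((s : ℝ) - τ ω) := by
      intro ω
      by_cases hs : s ∈ Ioc (τ ω) (τ ω + Δ ω) <;> simp [hs]
    simp only [e1, e2]
    exact h0
  rw [integral_prod _ (h.integrable_integrand_mul hτ h' hB hBN)]
  simp only [key]
  split_ifs
  · rw [integral_prod _ ((isLocIto_increment hW hτ hΔ hK₀ k).integrable_integrand_mul hτ
      (isLocIto_elapsed hW hτ hΔ hK₀ k) hB hBN)]
  · simp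

end Moments

/-! ### Moments of affine combinations -/

section Affine

variable {Ω : Type*} {𝓖 mΩ : MeasurableSpace Ω} {μ : Measure Ω} [IsFiniteMeasure μ]
  {κ : Type*} [Fintype κ] {X : κ → Ω → ℝ}

theorem isGenCondExp_affine {E : Type*} [NormedAddCommGroup E] [NormedSpace ℝ E] [CompleteSpace E]
    (h𝓖 : 𝓖 ≤ mΩ) (hX : ∀ a, IsGenCondExp 𝓖 μ (X a) fun _ => 0) {A : Ω → E}
    (hA : StronglyMeasurable[𝓖] A) {V : κ → Ω → E} (hV : ∀ a, StronglyMeasurable[𝓖] (V a)) :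
    IsGenCondExp 𝓖 μ (fun ω => A ω + ∑ a, X a ω • V a ω) A := by
  have h := (isGenCondExp_self (μ := μ) h𝓖 hA).add
    (IsGenCondExp.sum h𝓖 Finset.univ fun a _ => (hX a).smul h𝓖 (hV a))
  simpa using h

theorem isGenCondExp_affine_mul_affine (h𝓖 : 𝓖 ≤ mΩ)
    (hX : ∀ a, IsGenCondExp 𝓖 μ (X a) fun _ => 0) {Q : κ → κ → Ω → ℝ}
    (hXX : ∀ a b, IsGenCondExp 𝓖 μ (fun ω => X a ω * X b ω) (Q a b)) {A A' : Ω → ℝ}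
    (hA : StronglyMeasurable[𝓖] A) (hA' : StronglyMeasurable[𝓖] A') {V V' : κ → Ω → ℝ}
    (hV : ∀ a, StronglyMeasurable[𝓖] (V a)) (hV' : ∀ a, StronglyMeasurable[𝓖] (V' a)) :
    IsGenCondExp 𝓖 μ
      (fun ω => (A ω + ∑ a, X a ω * V a ω) * (A' ω + ∑ a, X a ω * V' a ω))
      fun ω => A ω * A' ω + ∑ a, ∑ b, Q a b ω * (V a ω * V' b ω) := by
  have h1 := isGenCondExp_affine h𝓖 hX (hA.mul hA')
    (V := fun a ω => A' ω * V a ω + A ω * V' a ω)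
    fun a => (hA'.mul (hV a)).add (hA.mul (hV' a))
  have h2 := h1.add (IsGenCondExp.sum h𝓖 Finset.univ fun a _ =>
    IsGenCondExp.sum h𝓖 Finset.univ fun b _ =>
      (hXX a b).smul h𝓖 ((hV a).mul (hV' b)))
  refine (h2.congr (Eventually.of_forall fun ω => ?_))
  simp only [smul_eq_mul, Pi.mul_apply]
  have h3 : ∑ a, ∑ b, X a ω * X b ω * (V a ω * V' b ω) =
      (∑ a, X a ω * V a ω) * ∑ b, X b ω * V' b ω := by
    rw [Finset.sum_mul_sum]
    exact Finset.sum_congr rfl fun a _ => Finset.sum_congr rfl fun b _ => by ring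
  have h4 : ∑ a, X a ω * (A' ω * V a ω + A ω * V' a ω) =
      A' ω * (∑ a, X a ω * V a ω) + A ω * ∑ a, X a ω * V' a ω := by
    rw [Finset.mul_sum, Finset.mul_sum, ← Finset.sum_add_distrib]
    exact Finset.sum_congr rfl fun a _ => by ring
  rw [h3, h4]
  ring

end Affine

/-! ### Measurability of the coefficients -/

section Coefficients

variable {d m : ℕ} {T : ℝ} {b : ℝ → EuclideanSpace ℝ (Fin d) → EuclideanSpace ℝ (Fin d)}
  {σ : Fin m → ℝ → EuclideanSpace ℝ (Fin d) → EuclideanSpace ℝ (Fin d)}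

theorem continuousOn_of_comp {g : ℝ → EuclideanSpace ℝ (Fin d) → EuclideanSpace ℝ (Fin d)}
    {s : Set (ℝ × EuclideanSpace ℝ (Fin d))}
    (h : ∀ i, ContinuousOn (Function.uncurry (comp g i)) s) :
    ContinuousOn (Function.uncurry g) s :=
  (PiLp.continuous_toLp 2 fun _ : Fin d => ℝ).comp_continuousOn (continuousOn_pi.2 h)

theorem continuousOn_Lvec (hσ : ∀ k i, IsC12 T (comp (σ k) i)) (k : Fin m)
    {g : ℝ → EuclideanSpace ℝ (Fin d) → EuclideanSpace ℝ (Fin d)}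
    (hg : ∀ i, IsC12 T (comp g i)) :
    ContinuousOn (Function.uncurry (Lvec σ k g)) (Icc 0 T ×ˢ univ) := by
  refine continuousOn_of_comp fun i => ?_
  change ContinuousOn (fun p : ℝ × EuclideanSpace ℝ (Fin d) =>
    ∑ j, σ k p.1 p.2 j * pdX j (comp g i) p.1 p.2) _
  exact continuousOn_finsetSum _ fun j _ =>
    ((hσ k j).continuousOn).mul ((hg i).continuousOn_pdX j)

theorem continuousOn_L0vec (hb : ∀ i, IsC12 T (comp b i)) (hσ : ∀ k i, IsC12 T (comp (σ k) i))
    {g : ℝ → EuclideanSpace ℝ (Fin d) → EuclideanSpace ℝ (Fin d)}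
    (hg : ∀ i, IsC12 T (comp g i)) :
    ContinuousOn (Function.uncurry (L0vec T b σ g)) (Icc 0 T ×ˢ univ) := by
  refine continuousOn_of_comp fun i => ?_
  change ContinuousOn (fun p : ℝ × EuclideanSpace ℝ (Fin d) =>
    pdT T (comp g i) p.1 p.2 + ∑ j, b p.1 p.2 j * pdX j (comp g i) p.1 p.2
    + 1 / 2 * ∑ i', ∑ j, (∑ k, σ k p.1 p.2 i' * σ k p.1 p.2 j) *
      pdX i' (pdX j (comp g i)) p.1 p.2) _
  refine ((hg i).continuousOn_pdT.add (continuousOn_finsetSum _ fun j _ =>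
    (hb j).continuousOn.mul ((hg i).continuousOn_pdX j))).add (continuousOn_const.mul
    (continuousOn_finsetSum _ fun i' _ => continuousOn_finsetSum _ fun j _ =>
      (continuousOn_finsetSum _ fun k _ => (hσ k i').continuousOn.mul (hσ k j).continuousOn).mul
        ((hg i).continuousOn_pdXX i' j)))

theorem stronglyMeasurable_eval {Ω : Type*} {𝓖 : MeasurableSpace Ω}
    {g : ℝ → EuclideanSpace ℝ (Fin d) → EuclideanSpace ℝ (Fin d)}
    (hg : ContinuousOn (Function.uncurry g) (Icc 0 T ×ˢ univ)) {τ : Ω → ℝ≥0}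
    (hτ : Measurable τ) (hτT : ∀ ω, (τ ω : ℝ) ≤ T) {Y : Ω → EuclideanSpace ℝ (Fin d)}
    (hY : Measurable Y) : StronglyMeasurable fun ω => g (τ ω) (Y ω) := by
  have hmem : ∀ ω, ((τ ω : ℝ), Y ω) ∈ Icc 0 T ×ˢ (univ : Set (EuclideanSpace ℝ (Fin d))) :=
    fun ω => ⟨⟨(τ ω).2, hτT ω⟩, mem_univ _⟩
  have h1 : Measurable fun ω => (⟨((τ ω : ℝ), Y ω), hmem ω⟩ :
      Icc 0 T ×ˢ (univ : Set (EuclideanSpace ℝ (Fin d)))) :=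
    ((measurable_coe_nnreal_real.comp hτ).prodMk hY).subtype_mk
  exact ((continuousOn_iff_continuous_domRestrict.1 hg).measurable.comp h1).stronglyMeasurable

end Coefficients

/-! ### The moment matrix of the stochastic integrals in the Itô–Taylor step -/

section MomentMatrix

variable {Ω : Type*} {mΩ : MeasurableSpace Ω} {μ : Measure Ω}
  {𝓕 : Filtration ℝ≥0 mΩ} {m : ℕ} {W : Fin m → ℝ≥0 → Ω → ℝ} {τ Δ : Ω → ℝ≥0}

/-- The integrands `1`, `δ - u`, `u` of the single integrals, as functions of the elapsed time `u`
of a step of size `δ`. -/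
def stepWeight (α : Fin 3) (δ u : ℝ) : ℝ := ![1, δ - u, u] α

/-- The single integrals of the step, in closed form: the increment of `W k`, the time integral of
`W k - W k τ`, and the integral of the elapsed time against `W k`. They are the Itô integrals of
`stepWeight`. -/
noncomputable def stepIntegral (W : Fin m → ℝ≥0 → Ω → ℝ) (τ Δ : Ω → ℝ≥0) (α : Fin 3) (k : Fin m)
    (ω : Ω) : ℝ :=
  ![W k (τ ω + Δ ω) ω - W k (τ ω) ω,
    ∫ t in (τ ω : ℝ)..(τ ω + Δ ω : ℝ), (W k t.toNNReal ω - W k (τ ω) ω),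
    Δ ω * (W k (τ ω + Δ ω) ω - W k (τ ω) ω) -
      ∫ t in (τ ω : ℝ)..(τ ω + Δ ω : ℝ), (W k t.toNNReal ω - W k (τ ω) ω)] α

/-- The integrals `∫₀¹ p q` for `p, q` among `1`, `1 - u`, `u`, that is, among the weights for
`δ = 1`. -/
noncomputable def weightMoment (α β : Fin 3) : ℝ :=
  !![1, 1 / 2, 1 / 2; 1 / 2, 1 / 3, 1 / 6; 1 / 2, 1 / 6, 1 / 3] α β

/-- The degree of homogeneity of `stepWeight`. -/
def weightDegree (α : Fin 3) : ℕ := ![0, 1, 1] α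

theorem continuous_stepWeight (α : Fin 3) (δ : ℝ) : Continuous (stepWeight α δ) := by
  unfold stepWeight
  fin_cases α
  · exact continuous_const
  · exact continuous_const.sub continuous_id
  · exact continuous_id

theorem measurable_stepWeight (α : Fin 3) :
    Measurable fun p : ℝ × ℝ => stepWeight α p.1 p.2 := by
  unfold stepWeight
  fin_cases α
  · exact measurable_const
  · exact measurable_fst.sub measurable_snd
  · exact measurable_snd

theorem abs_stepWeight_le (α : Fin 3) {δ u : ℝ} (h0 : 0 ≤ u) (h1 : u ≤ δ) :
    |stepWeight α δ u| ≤ 1 + δ := by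
  fin_cases α
  · simp [stepWeight]
    linarith
  · simp [stepWeight, abs_of_nonneg (sub_nonneg.2 h1)]
    linarith
  · simp [stepWeight, abs_of_nonneg h0]
    linarith

theorem integral_stepWeight_mul (α β : Fin 3) (δ : ℝ) :
    ∫ u in (0 : ℝ)..δ, stepWeight α δ u * stepWeight β δ u =
      weightMoment α β * δ ^ (1 + weightDegree α + weightDegree β) := by
  have hpoly : ∀ a b c : ℝ, ∫ u in (0 : ℝ)..δ, (a + b * u + c * u ^ 2) =
      a * δ + b * (δ ^ 2 / 2) + c * (δ ^ 3 / 3) := by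
    intro a b c
    rw [intervalIntegral.integral_add (Continuous.intervalIntegrable (by fun_prop) _ _)
      (Continuous.intervalIntegrable (by fun_prop) _ _),
      intervalIntegral.integral_add (Continuous.intervalIntegrable (by fun_prop) _ _)
      (Continuous.intervalIntegrable (by fun_prop) _ _)]
    rw [intervalIntegral.integral_const, intervalIntegral.integral_const_mul,
      intervalIntegral.integral_const_mul, integral_id, integral_pow]
    simp only [smul_eq_mul]
    norm_num
    ring
  -- each product of weights is a quadratic polynomial `a + b * u + c * u ^ 2`
  have key : ∀ a b c : ℝ, (∀ u, stepWeight α δ u * stepWeight β δ u = a + b * u + c * u ^ 2) →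
      a * δ + b * (δ ^ 2 / 2) + c * (δ ^ 3 / 3) =
        weightMoment α β * δ ^ (1 + weightDegree α + weightDegree β) →
      ∫ u in (0 : ℝ)..δ, stepWeight α δ u * stepWeight β δ u =
        weightMoment α β * δ ^ (1 + weightDegree α + weightDegree β) := by
    intro a b c h1 h2
    simp only [h1, hpoly, h2]
  fin_cases α <;> fin_cases β
  · refine key 1 0 0 ?_ ?_ <;> intros <;> simp [stepWeight, weightMoment, weightDegree]
  · refine key δ (-1) 0 ?_ ?_ <;> intros <;> simp [stepWeight, weightMoment, weightDegree] <;> ring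
  · refine key 0 1 0 ?_ ?_ <;> intros <;> simp [stepWeight, weightMoment, weightDegree]
    ring
  · refine key δ (-1) 0 ?_ ?_ <;> intros <;> simp [stepWeight, weightMoment, weightDegree] <;> ring
  · refine key (δ ^ 2) (-2 * δ) 1 ?_ ?_ <;> intros <;>
      simp [stepWeight, weightMoment, weightDegree] <;> ring
  · refine key 0 δ (-1) ?_ ?_ <;> intros <;> simp [stepWeight, weightMoment, weightDegree] <;> ring
  · refine key 0 1 0 ?_ ?_ <;> intros <;> simp [stepWeight, weightMoment, weightDegree]
    ring
  · refine key 0 δ (-1) ?_ ?_ <;> intros <;> simp [stepWeight, weightMoment, weightDegree] <;> ring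
  · refine key 0 0 1 ?_ ?_ <;> intros <;> simp [stepWeight, weightMoment, weightDegree] <;> ring

/-- The moments of the weights over a step starting at time `a`. -/
theorem integral_timeMeasure_stepWeight_mul (α β : Fin 3) (a δ : ℝ≥0) :
    ∫ s, (Ioc a (a + δ)).indicator (fun s => stepWeight α δ ((s : ℝ) - a)) s *
        (Ioc a (a + δ)).indicator (fun s => stepWeight β δ ((s : ℝ) - a)) s ∂timeMeasure =
      weightMoment α β * (δ : ℝ) ^ (1 + weightDegree α + weightDegree β) := by
  have hc : ∀ α, Continuous fun s : ℝ≥0 => stepWeight α δ ((s : ℝ) - a) := fun α =>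
    (continuous_stepWeight α δ).comp (NNReal.continuous_coe.sub continuous_const)
  simp only [← indicator_mul]
  refine (integral_timeMeasure_Ioc ((hc α).mul (hc β)).measurable le_self_add).trans ?_
  rw [← integral_stepWeight_mul]
  have h := intervalIntegral.integral_comp_sub_right
    (fun u => stepWeight α δ u * stepWeight β δ u) (a := (a : ℝ)) (b := (a + δ : ℝ≥0)) (a : ℝ)
  rw [sub_self, NNReal.coe_add, add_sub_cancel_left] at h
  rw [← h, NNReal.coe_add]
  refine intervalIntegral.integral_congr fun t ht => ?_
  rw [uIcc_of_le (by simp)] at ht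
  simp only [Pi.mul_apply, Real.coe_toNNReal t (a.2.trans ht.1)]

variable [IsProbabilityMeasure μ]

theorem isLocIto_stepIntegral (hW : IsBrownianFamily 𝓕 μ W)
    (hτ : IsStoppingTime 𝓕 (fun ω => (τ ω : WithTop ℝ≥0)))
    (hΔ : Measurable[hτ.measurableSpace] Δ) {K₀ : ℕ} (hK₀ : ∀ ω, τ ω ≤ K₀) (α : Fin 3)
    (k : Fin m) :
    IsLocIto 𝓕 μ τ Δ (W k)
      (fun s ω => (Ioc (τ ω) (τ ω + Δ ω)).indicator
        (fun s => stepWeight α (Δ ω) ((s : ℝ) - τ ω)) s) (stepIntegral W τ Δ α k) := by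
  fin_cases α
  · exact isLocIto_increment hW hτ hΔ hK₀ k
  · have h := isLocIto_timeIntegral hW hτ hΔ hK₀ k
    have e : ∀ ω (s : ℝ≥0), (τ ω : ℝ) + Δ ω - s = Δ ω - (s - τ ω) := fun ω s => by ring
    simp only [e] at h
    exact h
  · exact isLocIto_elapsed hW hτ hΔ hK₀ k

theorem isGenCondExp_stepIntegral_mul (hW : IsBrownianFamily 𝓕 μ W)
    (hτ : IsStoppingTime 𝓕 (fun ω => (τ ω : WithTop ℝ≥0)))
    (hΔ : Measurable[hτ.measurableSpace] Δ) {K₀ : ℕ} (hK₀ : ∀ ω, τ ω ≤ K₀) (α β : Fin 3)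
    (k l : Fin m) :
    IsGenCondExp hτ.measurableSpace μ
      (fun ω => stepIntegral W τ Δ α k ω * stepIntegral W τ Δ β l ω)
      fun ω => (if k = l then weightMoment α β else 0) *
        (Δ ω : ℝ) ^ (1 + weightDegree α + weightDegree β) := by
  have h := isLocIto_stepIntegral hW hτ hΔ hK₀ α k
  have h' := isLocIto_stepIntegral hW hτ hΔ hK₀ β l
  exact h.isGenCondExp_mul hW hτ hΔ h' _ _ fun _ => h.integral_integrand_of_pathwise hτ h' _ _
    fun ω => integral_timeMeasure_stepWeight_mul α β (τ ω) (Δ ω)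

theorem isGenCondExp_iterated_mul_stepIntegral (hW : IsBrownianFamily 𝓕 μ W)
    (hτ : IsStoppingTime 𝓕 (fun ω => (τ ω : WithTop ℝ≥0)))
    (hΔ : Measurable[hτ.measurableSpace] Δ) {K₀ : ℕ} (hK₀ : ∀ ω, τ ω ≤ K₀) {k l : Fin m}
    {I : Ω → ℝ} (h : IsLocIto 𝓕 μ τ Δ (W l) (pathIncrement W τ Δ k) I) (β : Fin 3)
    (l' : Fin m) :
    IsGenCondExp hτ.measurableSpace μ (fun ω => I ω * stepIntegral W τ Δ β l' ω)
      fun _ => 0 := by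
  have h' := isLocIto_stepIntegral hW hτ hΔ hK₀ β l'
  have hτs := measurable_stopping_self hτ
  have key := h.isGenCondExp_mul hW hτ hΔ h' 0 0 fun _ N B hB hBN => by
    rw [integral_pathIncrement_mul hW hτ hΔ hK₀ h h' (fun s => ?_) (fun N => ⟨1 + N, ?_⟩) N B hB
      hBN]
    · simp
    · exact (measurable_stepWeight β).comp ((measurable_coe_nnreal_real.comp hΔ).prodMk
        (measurable_const.sub (measurable_coe_nnreal_real.comp hτs)))
    · intro s ω hN hs
      have h1 : (τ ω : ℝ) < s := by exact_mod_cast hs.1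
      have h2 : (s : ℝ) ≤ τ ω + Δ ω := by exact_mod_cast hs.2
      have h3 : (Δ ω : ℝ) ≤ N := by exact_mod_cast hN
      exact (abs_stepWeight_le β (sub_nonneg.2 h1.le) (by linarith)).trans (by linarith)
  simpa using key

theorem isGenCondExp_iterated_mul_iterated (hW : IsBrownianFamily 𝓕 μ W)
    (hτ : IsStoppingTime 𝓕 (fun ω => (τ ω : WithTop ℝ≥0)))
    (hΔ : Measurable[hτ.measurableSpace] Δ) {K₀ : ℕ} (hK₀ : ∀ ω, τ ω ≤ K₀) {k l k' l' : Fin m}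
    {I I' : Ω → ℝ} (h : IsLocIto 𝓕 μ τ Δ (W l) (pathIncrement W τ Δ k) I)
    (h' : IsLocIto 𝓕 μ τ Δ (W l') (pathIncrement W τ Δ k') I') :
    IsGenCondExp hτ.measurableSpace μ (fun ω => I ω * I' ω)
      fun ω => (if l = l' then if k = k' then 1 / 2 else 0 else 0) * (Δ ω : ℝ) ^ 2 := by
  refine h.isGenCondExp_mul hW hτ hΔ h' _ 2 fun _ N B hB hBN => ?_
  rw [integral_pathIncrement_mul_pathIncrement hW hτ hΔ hK₀ h h' N B hB hBN]
  split_ifs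
  -- `∫₀^δ 1 * u du = δ ^ 2 / 2`
  · exact (isLocIto_stepIntegral hW hτ hΔ hK₀ 0 l).integral_integrand_of_pathwise hτ
      (isLocIto_stepIntegral hW hτ hΔ hK₀ 2 l) _ _
      (fun ω => integral_timeMeasure_stepWeight_mul 0 2 (τ ω) (Δ ω)) N B hB hBN
  · simp

/-- The index set of the stochastic integrals in the Itô–Taylor step: `inl (α, k)` stands for
`stepIntegral W τ Δ α k`, and `inr (k, l)` for the iterated integral of `W k` against `W l`. -/
abbrev IntegralIndex (m : ℕ) := (Fin 3 × Fin m) ⊕ (Fin m × Fin m)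

/-- All stochastic integrals of the Itô–Taylor step, given the iterated ones. -/
noncomputable def allIntegrals (W : Fin m → ℝ≥0 → Ω → ℝ) (τ Δ : Ω → ℝ≥0)
    (I : Fin m → Fin m → Ω → ℝ) : IntegralIndex m → Ω → ℝ :=
  Sum.elim (fun p => stepIntegral W τ Δ p.1 p.2) fun p => I p.1 p.2

/-- The conditional second moments of `allIntegrals`, for a step of size `δ`. -/
noncomputable def momentMatrix (δ : ℝ) : IntegralIndex m → IntegralIndex m → ℝ
  | .inl p, .inl q => (if p.2 = q.2 then weightMoment p.1 q.1 else 0) *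
      δ ^ (1 + weightDegree p.1 + weightDegree q.1)
  | .inl _, .inr _ => 0
  | .inr _, .inl _ => 0
  | .inr p, .inr q => (if p.2 = q.2 then if p.1 = q.1 then 1 / 2 else 0 else 0) * δ ^ 2

theorem isGenCondExp_allIntegrals (hW : IsBrownianFamily 𝓕 μ W)
    (hτ : IsStoppingTime 𝓕 (fun ω => (τ ω : WithTop ℝ≥0)))
    (hΔ : Measurable[hτ.measurableSpace] Δ) {K₀ : ℕ} (hK₀ : ∀ ω, τ ω ≤ K₀)
    {I : Fin m → Fin m → Ω → ℝ}
    (hI : ∀ k l, IsLocIto 𝓕 μ τ Δ (W l) (pathIncrement W τ Δ k) (I k l)) (a : IntegralIndex m) :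
    IsGenCondExp hτ.measurableSpace μ (allIntegrals W τ Δ I a) fun _ => 0 := by
  rcases a with p | p
  · exact (isLocIto_stepIntegral hW hτ hΔ hK₀ p.1 p.2).isGenCondExp hW hτ hΔ
  · exact (hI p.1 p.2).isGenCondExp hW hτ hΔ

theorem isGenCondExp_allIntegrals_mul (hW : IsBrownianFamily 𝓕 μ W)
    (hτ : IsStoppingTime 𝓕 (fun ω => (τ ω : WithTop ℝ≥0)))
    (hΔ : Measurable[hτ.measurableSpace] Δ) {K₀ : ℕ} (hK₀ : ∀ ω, τ ω ≤ K₀)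
    {I : Fin m → Fin m → Ω → ℝ}
    (hI : ∀ k l, IsLocIto 𝓕 μ τ Δ (W l) (pathIncrement W τ Δ k) (I k l))
    (a b : IntegralIndex m) :
    IsGenCondExp hτ.measurableSpace μ
      (fun ω => allIntegrals W τ Δ I a ω * allIntegrals W τ Δ I b ω)
      fun ω => momentMatrix (Δ ω) a b := by
  rcases a with p | p <;> rcases b with q | q
  · exact isGenCondExp_stepIntegral_mul hW hτ hΔ hK₀ _ _ _ _
  · refine (isGenCondExp_iterated_mul_stepIntegral hW hτ hΔ hK₀ (hI q.1 q.2) p.1 p.2).congr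
      (Eventually.of_forall fun ω => ?_)
    exact mul_comm _ _
  · exact isGenCondExp_iterated_mul_stepIntegral hW hτ hΔ hK₀ (hI p.1 p.2) q.1 q.2
  · exact isGenCondExp_iterated_mul_iterated hW hτ hΔ hK₀ (hI p.1 p.2) (hI q.1 q.2)

end MomentMatrix

/-! ### The Itô–Taylor step as an affine combination of stochastic integrals -/

section Step

variable {Ω : Type*} {mΩ : MeasurableSpace Ω} {μ : Measure Ω} [IsProbabilityMeasure μ]
  {𝓕 : Filtration ℝ≥0 mΩ} {d m : ℕ} {W : Fin m → ℝ≥0 → Ω → ℝ} {τ Δ : Ω → ℝ≥0}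

theorem itoIntegral_ae_eq (hW : IsBrownianFamily 𝓕 μ W) {k : Fin m} {H : ℝ≥0 → Ω → ℝ}
    {I : Ω → ℝ} (h : IsItoIntegral 𝓕 μ (W k) H I) : itoIntegral 𝓕 μ (W k) H =ᵐ[μ] I := by
  have h' : ∃ I, IsItoIntegral 𝓕 μ (W k) H I := ⟨I, h⟩
  rw [itoIntegral, dif_pos h']
  exact h'.choose_spec.ae_eq hW h

theorem itoIntegralBetween_elapsed_ae_eq (hW : IsBrownianFamily 𝓕 μ W)
    (hτ : IsStoppingTime 𝓕 (fun ω => (τ ω : WithTop ℝ≥0)))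
    (hΔ : Measurable[hτ.measurableSpace] Δ) {K₀ : ℕ} (hK₀ : ∀ ω, τ ω ≤ K₀) (k : Fin m) :
    itoIntegralBetween 𝓕 μ (W k) τ (fun ω => τ ω + Δ ω) (fun t ω => (t : ℝ) - τ ω) =ᵐ[μ]
      stepIntegral W τ Δ 2 k :=
  itoIntegral_ae_eq hW ((isLocIto_stepIntegral hW hτ hΔ hK₀ 2 k).isItoIntegral hW
    (hΔ.mono hτ.measurableSpace_le le_rfl) (Eventually.of_forall fun _ =>
      ((continuous_stepWeight 2 _).comp (NNReal.continuous_coe.sub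
        continuous_const)).measurable.indicator measurableSet_Ioc))

theorem itoIntegralBetween_pathIncrement_ae_eq (hW : IsBrownianFamily 𝓕 μ W)
    (hτ : IsStoppingTime 𝓕 (fun ω => (τ ω : WithTop ℝ≥0)))
    (hΔ : Measurable[hτ.measurableSpace] Δ) {k l : Fin m} {I : Ω → ℝ}
    (hI : IsLocIto 𝓕 μ τ Δ (W l) (pathIncrement W τ Δ k) I) :
    itoIntegralBetween 𝓕 μ (W l) τ (fun ω => τ ω + Δ ω) (fun t ω => W k t ω - W k (τ ω) ω)
      =ᵐ[μ] I := by
  refine itoIntegral_ae_eq hW (hI.isItoIntegral hW (hΔ.mono hτ.measurableSpace_le le_rfl) ?_)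
  filter_upwards [hW.ae_continuous] with ω hω
  exact ((hω k).sub continuous_const).measurable.indicator measurableSet_Ioc

/-- The coefficient fields of the stochastic integrals in the Itô–Taylor step. -/
noncomputable def stepField (T : ℝ)
    (b : ℝ → EuclideanSpace ℝ (Fin d) → EuclideanSpace ℝ (Fin d))
    (σ : Fin m → ℝ → EuclideanSpace ℝ (Fin d) → EuclideanSpace ℝ (Fin d)) :
    IntegralIndex m → ℝ → EuclideanSpace ℝ (Fin d) → EuclideanSpace ℝ (Fin d) :=
  Sum.elim (fun p => ![σ p.2, Lvec σ p.2 b, L0vec T b σ (σ p.2)] p.1) fun p => Lvec σ p.1 (σ p.2)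

variable {T : ℝ} {b : ℝ → EuclideanSpace ℝ (Fin d) → EuclideanSpace ℝ (Fin d)}
  {σ : Fin m → ℝ → EuclideanSpace ℝ (Fin d) → EuclideanSpace ℝ (Fin d)}

theorem continuousOn_stepField (hb : ∀ i, IsC12 T (comp b i))
    (hσ : ∀ k i, IsC12 T (comp (σ k) i)) (a : IntegralIndex m) :
    ContinuousOn (Function.uncurry (stepField T b σ a)) (Icc 0 T ×ˢ univ) := by
  rcases a with ⟨α, k⟩ | ⟨k, l⟩
  · fin_cases α
    · exact continuousOn_of_comp fun i => (hσ k i).continuousOn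
    · exact continuousOn_Lvec hσ k hb
    · exact continuousOn_L0vec hb hσ (hσ k)
  · exact continuousOn_Lvec hσ k (hσ l)

theorem itoTaylorStep_ae_eq (hW : IsBrownianFamily 𝓕 μ W)
    (hτ : IsStoppingTime 𝓕 (fun ω => (τ ω : WithTop ℝ≥0)))
    (hΔ : Measurable[hτ.measurableSpace] Δ) {K₀ : ℕ} (hK₀ : ∀ ω, τ ω ≤ K₀)
    {I : Fin m → Fin m → Ω → ℝ}
    (hI : ∀ k l, IsLocIto 𝓕 μ τ Δ (W l) (pathIncrement W τ Δ k) (I k l))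
    (Y : Ω → EuclideanSpace ℝ (Fin d)) :
    itoTaylorStep 𝓕 μ W T b σ τ Y Δ =ᵐ[μ] fun ω => (Y ω + ((Δ ω : ℝ) • b (τ ω) (Y ω)
      + (1 / 2 * (Δ ω : ℝ) ^ 2) • L0vec T b σ b (τ ω) (Y ω)))
      + ∑ a, allIntegrals W τ Δ I a ω • stepField T b σ a (τ ω) (Y ω) := by
  filter_upwards [ae_all_iff.2 fun k => itoIntegralBetween_elapsed_ae_eq hW hτ hΔ hK₀ k,
    ae_all_iff.2 fun k => ae_all_iff.2 fun l =>
      itoIntegralBetween_pathIncrement_ae_eq hW hτ hΔ (hI k l)] with ω h1 h2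
  simp only [itoTaylorStep, h1, h2, Fintype.sum_sum_type, Fintype.sum_prod_type,
    Fin.sum_univ_three, allIntegrals, stepField, Sum.elim_inl, Sum.elim_inr]
  simp only [stepIntegral, Matrix.cons_val_zero, Matrix.cons_val_one, Matrix.cons_val]
  abel

/-- The moment matrix contracted with the coefficient fields. -/
theorem sum_momentMatrix_mul (T : ℝ) (b : ℝ → EuclideanSpace ℝ (Fin d) → EuclideanSpace ℝ (Fin d))
    (σ : Fin m → ℝ → EuclideanSpace ℝ (Fin d) → EuclideanSpace ℝ (Fin d)) (i j : Fin d)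
    (δ t : ℝ) (x : EuclideanSpace ℝ (Fin d)) :
    (δ * b t x i + 1 / 2 * δ ^ 2 * L0 T b σ (comp b i) t x) *
        (δ * b t x j + 1 / 2 * δ ^ 2 * L0 T b σ (comp b j) t x) +
      ∑ a, ∑ a', momentMatrix δ a a' * (stepField T b σ a t x i * stepField T b σ a' t x j) -
      (δ * b t x i * (δ * b t x j) +
        ∑ k, ∑ l, (if k = l then (1 : ℝ) else 0) * δ * (σ k t x i * σ l t x j)) =
    T2 T b σ i j t x * δ ^ 2 + T3 T b σ i j t x * δ ^ 3 + T4 T b σ i j t x * δ ^ 4 := by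
  simp only [Fintype.sum_sum_type, Fintype.sum_prod_type, Fin.sum_univ_three, momentMatrix,
    stepField, Sum.elim_inl, Sum.elim_inr, ite_mul, zero_mul, Finset.sum_ite_eq, Finset.mem_univ,
    if_true, Finset.sum_const_zero, add_zero, zero_add, T2, T3, T4]
  simp only [weightMoment, weightDegree, Matrix.of_apply, Matrix.cons_val_zero,
    Matrix.cons_val_one, Matrix.cons_val, Lvec, L0vec, mul_add, Finset.sum_add_distrib,
    mul_left_comm _ (2 : ℝ), ← Finset.mul_sum]
  have c1 : ∑ k, σ k t x j * L0 T b σ (comp (σ k) i) t x =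
      ∑ k, L0 T b σ (comp (σ k) i) t x * σ k t x j := Finset.sum_congr rfl fun _ _ => mul_comm _ _
  have c2 : ∑ k, σ k t x j * L σ k (comp b i) t x =
      ∑ k, L σ k (comp b i) t x * σ k t x j := Finset.sum_congr rfl fun _ _ => mul_comm _ _
  rw [c1, c2]
  norm_num
  ring

end Step

end WeakStep

theorem lemma2 {d m : ℕ} {Ω : Type*} {mΩ : MeasurableSpace Ω} (μ : Measure Ω)
    [IsProbabilityMeasure μ] (𝓕 : Filtration ℝ≥0 mΩ)
    (W : Fin m → ℝ≥0 → Ω → ℝ) (hW : IsBrownianFamily 𝓕 μ W)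
    (T : ℝ) (hT : 0 < T)
    (b : ℝ → EuclideanSpace ℝ (Fin d) → EuclideanSpace ℝ (Fin d))
    (σ : Fin m → ℝ → EuclideanSpace ℝ (Fin d) → EuclideanSpace ℝ (Fin d))
    (hb : ∀ i, IsC12 T (comp b i)) (hσ : ∀ k i, IsC12 T (comp (σ k) i))
    (τ : Ω → ℝ≥0) (hτ : IsStoppingTime 𝓕 (fun ω => (τ ω : WithTop ℝ≥0)))
    (hτT : ∀ ω, (τ ω : ℝ) ≤ T)
    (Y : Ω → EuclideanSpace ℝ (Fin d)) (hY : Measurable[hτ.measurableSpace] Y)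
    (Δ : Ω → ℝ≥0) (hΔ : Measurable[hτ.measurableSpace] Δ) (hΔpos : ∀ ω, 0 < Δ ω) :
    (HasGenCondExp hτ.measurableSpace μ (itoTaylorStep 𝓕 μ W T b σ τ Y Δ) ∧
      HasGenCondExp hτ.measurableSpace μ (eulerStep W b σ τ Y Δ) ∧
      genCondExp hτ.measurableSpace μ (itoTaylorStep 𝓕 μ W T b σ τ Y Δ)
          - genCondExp hτ.measurableSpace μ (eulerStep W b σ τ Y Δ)
        =ᵐ[μ] fun ω => (1 / 2 * (Δ ω : ℝ) ^ 2) • L0vec T b σ b (τ ω) (Y ω)) ∧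
    ∀ i j : Fin d,
      HasGenCondExp hτ.measurableSpace μ (fun ω =>
        (itoTaylorStep 𝓕 μ W T b σ τ Y Δ ω i - Y ω i)
          * (itoTaylorStep 𝓕 μ W T b σ τ Y Δ ω j - Y ω j)) ∧
      HasGenCondExp hτ.measurableSpace μ (fun ω =>
        (eulerStep W b σ τ Y Δ ω i - Y ω i) * (eulerStep W b σ τ Y Δ ω j - Y ω j)) ∧
      genCondExp hτ.measurableSpace μ (fun ω =>
          (itoTaylorStep 𝓕 μ W T b σ τ Y Δ ω i - Y ω i)
            * (itoTaylorStep 𝓕 μ W T b σ τ Y Δ ω j - Y ω j))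
        - genCondExp hτ.measurableSpace μ (fun ω =>
          (eulerStep W b σ τ Y Δ ω i - Y ω i) * (eulerStep W b σ τ Y Δ ω j - Y ω j))
        =ᵐ[μ] fun ω =>
          T2 T b σ i j (τ ω) (Y ω) * (Δ ω : ℝ) ^ 2
            + T3 T b σ i j (τ ω) (Y ω) * (Δ ω : ℝ) ^ 3
            + T4 T b σ i j (τ ω) (Y ω) * (Δ ω : ℝ) ^ 4 := by
  obtain ⟨K₀, hK₀'⟩ := exists_nat_ge T
  have hK₀ : ∀ ω, τ ω ≤ (K₀ : ℝ≥0) := fun ω => by exact_mod_cast (hτT ω).trans hK₀'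
  have h𝓖 := hτ.measurableSpace_le
  have hτs := measurable_stopping_self hτ
  choose I hI using fun k l => exists_isLocIto_iterated hW hτ hΔ hK₀ k l
  have hΔr : StronglyMeasurable[hτ.measurableSpace] fun ω => (Δ ω : ℝ) :=
    (measurable_coe_nnreal_real.comp hΔ).stronglyMeasurable
  -- the coefficients are `𝓕_τ`-measurable, as vectors and componentwise
  have hcoord : ∀ {v : Ω → EuclideanSpace ℝ (Fin d)},
      StronglyMeasurable[hτ.measurableSpace] v → ∀ i,
        StronglyMeasurable[hτ.measurableSpace] fun ω => v ω i := fun hv i =>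
    (EuclideanSpace.proj (𝕜 := ℝ) i).continuous.comp_stronglyMeasurable hv
  have hYs : StronglyMeasurable[hτ.measurableSpace] Y := hY.stronglyMeasurable
  have hbm : StronglyMeasurable[hτ.measurableSpace] fun ω => b (τ ω) (Y ω) :=
    stronglyMeasurable_eval (continuousOn_of_comp fun i => (hb i).continuousOn) hτs hτT hY
  have hL0m : StronglyMeasurable[hτ.measurableSpace] fun ω => L0vec T b σ b (τ ω) (Y ω) :=
    stronglyMeasurable_eval (continuousOn_L0vec hb hσ hb) hτs hτT hY
  have hσm : ∀ k, StronglyMeasurable[hτ.measurableSpace] fun ω => σ k (τ ω) (Y ω) := fun k =>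
    stronglyMeasurable_eval (continuousOn_of_comp fun i => (hσ k i).continuousOn) hτs hτT hY
  have hVm : ∀ a, StronglyMeasurable[hτ.measurableSpace] fun ω =>
      stepField T b σ a (τ ω) (Y ω) := fun a =>
    stronglyMeasurable_eval (continuousOn_stepField hb hσ a) hτs hτT hY
  have hDE : StronglyMeasurable[hτ.measurableSpace] fun ω => (Δ ω : ℝ) • b (τ ω) (Y ω) :=
    hΔr.smul hbm
  have hD : StronglyMeasurable[hτ.measurableSpace] fun ω => (Δ ω : ℝ) • b (τ ω) (Y ω)
      + (1 / 2 * (Δ ω : ℝ) ^ 2) • L0vec T b σ b (τ ω) (Y ω) :=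
    hDE.add ((stronglyMeasurable_const.mul (hΔr.pow 2)).smul hL0m)
  -- conditional moments of the stochastic integrals
  have hX := isGenCondExp_allIntegrals hW hτ hΔ hK₀ hI
  have hXX := isGenCondExp_allIntegrals_mul hW hτ hΔ hK₀ hI
  have hXE : ∀ k, IsGenCondExp hτ.measurableSpace μ
      (fun ω => W k (τ ω + Δ ω) ω - W k (τ ω) ω) fun _ => 0 := fun k =>
    (isLocIto_increment hW hτ hΔ hK₀ k).isGenCondExp hW hτ hΔ
  have hXXE : ∀ k l, IsGenCondExp hτ.measurableSpace μ
      (fun ω => (W k (τ ω + Δ ω) ω - W k (τ ω) ω) * (W l (τ ω + Δ ω) ω - W l (τ ω) ω))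
      fun ω => (if k = l then (1 : ℝ) else 0) * (Δ ω : ℝ) := fun k l => by
    simpa [weightMoment, weightDegree, stepIntegral] using
      isGenCondExp_stepIntegral_mul hW hτ hΔ hK₀ 0 0 k l
  -- both steps as affine combinations
  have hTaylor := itoTaylorStep_ae_eq (T := T) (b := b) (σ := σ) hW hτ hΔ hK₀ hI Y
  have hE : eulerStep W b σ τ Y Δ = fun ω => (Y ω + (Δ ω : ℝ) • b (τ ω) (Y ω))
      + ∑ k, (W k (τ ω + Δ ω) ω - W k (τ ω) ω) • σ k (τ ω) (Y ω) := rfl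
  refine ⟨?_, fun i j => ?_⟩
  · have gT := (isGenCondExp_affine h𝓖 hX (hYs.add hD) hVm).congr hTaylor.symm
    have gE : IsGenCondExp hτ.measurableSpace μ (eulerStep W b σ τ Y Δ) _ :=
      isGenCondExp_affine h𝓖 hXE (hYs.add hDE) hσm
    refine ⟨⟨_, gT⟩, ⟨_, gE⟩, ?_⟩
    filter_upwards [gT.genCondExp_ae_eq h𝓖, gE.genCondExp_ae_eq h𝓖] with ω h1 h2
    rw [Pi.sub_apply, h1, h2]
    simp only [Pi.add_apply]
    abel
  · have gT := (isGenCondExp_affine_mul_affine h𝓖 hX hXX (hcoord hD i) (hcoord hD j)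
      (fun a => hcoord (hVm a) i) (fun a => hcoord (hVm a) j)).congr
      (X' := fun ω => (itoTaylorStep 𝓕 μ W T b σ τ Y Δ ω i - Y ω i)
          * (itoTaylorStep 𝓕 μ W T b σ τ Y Δ ω j - Y ω j)) (by
        filter_upwards [hTaylor] with ω hω
        rw [hω]
        simp [add_assoc])
    have gE := (isGenCondExp_affine_mul_affine h𝓖 hXE hXXE (hcoord hDE i) (hcoord hDE j)
      (fun k => hcoord (hσm k) i) (fun k => hcoord (hσm k) j)).congr
      (X' := fun ω => (eulerStep W b σ τ Y Δ ω i - Y ω i) * (eulerStep W b σ τ Y Δ ω j - Y ω j))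
      (Eventually.of_forall fun ω => by
        rw [hE]
        simp [add_assoc])
    refine ⟨⟨_, gT⟩, ⟨_, gE⟩, ?_⟩
    filter_upwards [gT.genCondExp_ae_eq h𝓖, gE.genCondExp_ae_eq h𝓖] with ω h1 h2
    rw [Pi.sub_apply, h1, h2]
    exact sum_momentMatrix_mul T b σ i j (Δ ω) (τ ω) (Y ω)
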